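/- Let $N,M\ge 0$ be integers and let $q\in\mathbb C$ with $q\neq 0$ and $q^2\neq 1$. Let $U_q\mathfrak{gl}_N$ be the unital $\mathbb C$-algebra with generators $e_i,f_i$ ($1\le i\le N-1$), $t_i^{\pm1}$ ($1\le i\le N$) and relations, with $k_i=t_it_{i+1}^{-1}$: $t_it_i^{-1}=t_i^{-1}t_i=1$, $t_it_j=t_jt_i$, $t_ie_jt_i^{-1}=q^{\delta_{i,j}-\delta_{i,j+1}}e_j$, $t_if_jt_i^{-1}=q^{-\delta_{i,j}+\delta_{i,j+1}}f_j$, $e_if_j-f_je_i=\delta_{ij}\frac{k_i-k_i^{-1}}{q-q^{-1}}$, $e_ie_j=e_je_i$ and $f_if_j=f_jf_i$ for $|i-j|\ge2$, and $x_i^2x_j-(q+q^{-1})x_ix_jx_i+x_jx_i^2=0$ for $|i-j|=1$ and $x=e$ or $x=f$. Its coproduct is $\Delta(e_i)=e_i\otimes1+k_i\otimes e_i$, $\Delta(f_i)=f_i\otimes k_i^{-1}+1\otimes f_i$, $\Delta(t_i^{\pm1})=t_i^{\pm1}\otimes t_i^{\pm1}$, its counit is $\varepsilon(e_i)=\varepsilon(f_i)=0$,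 $\varepsilon(t_i)=1$, and the opposite coproduct is $\Delta'=\sigma\circ\Delta$ with $\sigma(a\otimes b)=b\otimes a$. It acts on $\bigwedge V$, $V=\mathbb C^N$ with standard basis $v_1,\dots,v_N$, by $e_i\mapsto\psi_i^*\psi_{i+1}$, $f_i\mapsto\psi_{i+1}^*\psi_i$, $t_i^{\pm1}\mapsto q^{\pm1}\psi_i^*\psi_i+\psi_i\psi_i^*$, where $\psi_i^*$ is left multiplication by $v_i$ and $\psi_i$ is the contraction with the $i$-th dual basis vector. Let $W=\mathbb C^M$ with standard basis $w_1,\dots,w_M$; likewise $U_q\mathfrak{gl}_M$ acts on $\bigwedge W$. Let $U_q\mathfrak{gl}_N$ act on $(\bigwedge V)^{\otimes M}$ through the iterated coproduct $\Delta$ and $U_q\mathfrak{gl}_M$ on $(\bigwedge W)^{\otimes N}$ through the iterated opposite coproduct $\Delta'$. Pull both actions back to $\bigwedge(V\otimes W)$ by the isomorphisms of graded commutative algebras $(\bigwedge W)^{\otimes N}\leftarrow\bigwedge(V\otimes W)\rightarrow(\bigwedge V)^{\otimes M}$ which send $v_i\otimes w_r$ to $1\otimes\cdots\otimes w_r\otimes\cdots\otimes1$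 ($w_r$ in the $i$-th factor), respectively to $1\otimes\cdots\otimes v_i\otimes\cdots\otimes1$ ($v_i$ in the $r$-th factor). Then the two actions on $\bigwedge(V\otimes W)$ commute. If $q$ is not a root of unity, the images of $U_q\mathfrak{gl}_N$ and $U_q\mathfrak{gl}_M$ in $\operatorname{End}\bigwedge(V\otimes W)$ are the commutants of each other, and there is an isomorphism of $U_q\mathfrak{gl}_N\otimes U_q\mathfrak{gl}_M$-modules \[\bigwedge(V\otimes W)\cong\bigoplus_\lambda V^N_\lambda\otimes V^M_{\lambda^t}\] in which every summand is a simple $U_q\mathfrak{gl}_N\otimes U_q\mathfrak{gl}_M$-module. Here $\lambda$ runs over all Young diagrams with at most $N$ rows and at most $M$ columns, $\lambda^t$ is the transposed diagram, and $V^n_\mu$ is the irreducible $U_q\mathfrak{gl}_n$-module of highest weight $\mu$, that is the quotient by its largest proper submodule of the Verma module $U_q\mathfrak{gl}_n/\big(\sum_iU_q\mathfrak{gl}_n\,e_i+\sum_iU_q\mathfrak{gl}_n\,(t_i-q^{\mu_i})\big)$. -/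

import Mathlib

open scoped TensorProduct DirectSum

noncomputable section

namespace SkewHowe

/-! ### The quantum enveloping algebra of `gl_N` -/

/-- The first of the two indices `i, i + 1` of `1, …, N` joined by the `i`-th simple root. -/
def lo {N : ℕ} (i : Fin (N - 1)) : Fin N := ⟨i.1, by omega⟩

/-- The second of the two indices `i, i + 1` of `1, …, N` joined by the `i`-th simple root. -/
def hi {N : ℕ} (i : Fin (N - 1)) : Fin N := ⟨i.1 + 1, by omega⟩

/-- The inner product `(ε_i | α_j)`, where `α_j = ε_j - ε_{j+1}`. -/
def pair {N : ℕ} (i : Fin N) (j : Fin (N - 1)) : ℤ :=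
  (if i = lo j then 1 else 0) - (if i = hi j then 1 else 0)

/-- The generators `e_i, f_i` (one for each simple root) and `t_i, t_i⁻¹` (`i = 1, …, N`). -/
inductive Gen (N : ℕ) : Type
  | e (i : Fin (N - 1)) : Gen N
  | f (i : Fin (N - 1)) : Gen N
  | t (i : Fin N) : Gen N
  | tinv (i : Fin N) : Gen N

namespace Free

variable {N : ℕ}

/-- The free generator `e_i`. -/
def e (i : Fin (N - 1)) : FreeAlgebra ℂ (Gen N) := FreeAlgebra.ι ℂ (Gen.e i)

/-- The free generator `f_i`. -/
def f (i : Fin (N - 1)) : FreeAlgebra ℂ (Gen N) := FreeAlgebra.ι ℂ (Gen.f i)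

/-- The free generator `t_i`. -/
def t (i : Fin N) : FreeAlgebra ℂ (Gen N) := FreeAlgebra.ι ℂ (Gen.t i)

/-- The free generator `t_i⁻¹`. -/
def tinv (i : Fin N) : FreeAlgebra ℂ (Gen N) := FreeAlgebra.ι ℂ (Gen.tinv i)

end Free

open Free in
/-- The defining relations of `U_q gl_N`; here `k_i = t_i t_{i+1}⁻¹`. -/
inductive Rel (N : ℕ) (q : ℂ) : FreeAlgebra ℂ (Gen N) → FreeAlgebra ℂ (Gen N) → Prop
  | t_tinv (i : Fin N) : Rel N q (t i * tinv i) 1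
  | tinv_t (i : Fin N) : Rel N q (tinv i * t i) 1
  | t_comm (i j : Fin N) : Rel N q (t i * t j) (t j * t i)
  | t_e (i : Fin N) (j : Fin (N - 1)) :
      Rel N q (t i * e j * tinv i) (q ^ pair i j • e j)
  | t_f (i : Fin N) (j : Fin (N - 1)) :
      Rel N q (t i * f j * tinv i) (q ^ (-pair i j) • f j)
  | e_f_same (i : Fin (N - 1)) :
      Rel N q (e i * f i - f i * e i)
        ((q - q⁻¹)⁻¹ • (t (lo i) * tinv (hi i) - t (hi i) * tinv (lo i)))
  | e_f_ne (i j : Fin (N - 1)) (h : i ≠ j) : Rel N q (e i * f j - f j * e i) 0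
  | e_far (i j : Fin (N - 1)) (h : i.1 + 1 < j.1 ∨ j.1 + 1 < i.1) :
      Rel N q (e i * e j - e j * e i) 0
  | f_far (i j : Fin (N - 1)) (h : i.1 + 1 < j.1 ∨ j.1 + 1 < i.1) :
      Rel N q (f i * f j - f j * f i) 0
  | e_serre (i j : Fin (N - 1)) (h : i.1 + 1 = j.1 ∨ j.1 + 1 = i.1) :
      Rel N q (e i * e i * e j - (q + q⁻¹) • (e i * e j * e i) + e j * e i * e i) 0
  | f_serre (i j : Fin (N - 1)) (h : i.1 + 1 = j.1 ∨ j.1 + 1 = i.1) :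
      Rel N q (f i * f i * f j - (q + q⁻¹) • (f i * f j * f i) + f j * f i * f i) 0

/-- The quantum enveloping algebra `U_q gl_N`. -/
def Uq (N : ℕ) (q : ℂ) : Type := RingQuot (Rel N q)

instance (N : ℕ) (q : ℂ) : Ring (Uq N q) := inferInstanceAs (Ring (RingQuot (Rel N q)))

instance (N : ℕ) (q : ℂ) : Algebra ℂ (Uq N q) :=
  inferInstanceAs (Algebra ℂ (RingQuot (Rel N q)))

/-- The defining relations, for elements of an arbitrary algebra. -/
structure Satisfies (N : ℕ) (q : ℂ) {A : Type*} [Ring A] [Algebra ℂ A]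
    (e f : Fin (N - 1) → A) (t tinv : Fin N → A) : Prop where
  t_tinv (i) : t i * tinv i = 1
  tinv_t (i) : tinv i * t i = 1
  t_comm (i j) : t i * t j = t j * t i
  t_e (i j) : t i * e j * tinv i = q ^ pair i j • e j
  t_f (i j) : t i * f j * tinv i = q ^ (-pair i j) • f j
  e_f_same (i) : e i * f i - f i * e i =
    (q - q⁻¹)⁻¹ • (t (lo i) * tinv (hi i) - t (hi i) * tinv (lo i))
  e_f_ne (i j) (h : i ≠ j) : e i * f j - f j * e i = 0
  e_far (i j) (h : i.1 + 1 < j.1 ∨ j.1 + 1 < i.1) : e i * e j - e j * e i = 0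
  f_far (i j) (h : i.1 + 1 < j.1 ∨ j.1 + 1 < i.1) : f i * f j - f j * f i = 0
  e_serre (i j) (h : i.1 + 1 = j.1 ∨ j.1 + 1 = i.1) :
    e i * e i * e j - (q + q⁻¹) • (e i * e j * e i) + e j * e i * e i = 0
  f_serre (i j) (h : i.1 + 1 = j.1 ∨ j.1 + 1 = i.1) :
    f i * f i * f j - (q + q⁻¹) • (f i * f j * f i) + f j * f i * f i = 0

namespace Uq

variable {N : ℕ} {q : ℂ}

variable (N q) in
/-- The quotient map from the free algebra. -/
def mk : FreeAlgebra ℂ (Gen N) →ₐ[ℂ] Uq N q := RingQuot.mkAlgHom ℂ (Rel N q)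

variable (q) in
/-- The generator `e_i` of `U_q gl_N`. -/
def e (i : Fin (N - 1)) : Uq N q := mk N q (Free.e i)

variable (q) in
/-- The generator `f_i` of `U_q gl_N`. -/
def f (i : Fin (N - 1)) : Uq N q := mk N q (Free.f i)

variable (q) in
/-- The generator `t_i` of `U_q gl_N`. -/
def t (i : Fin N) : Uq N q := mk N q (Free.t i)

variable (q) in
/-- The generator `t_i⁻¹` of `U_q gl_N`. -/
def tinv (i : Fin N) : Uq N q := mk N q (Free.tinv i)

variable (q) in
/-- The element `k_i = t_i t_{i+1}⁻¹`. -/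
def k (i : Fin (N - 1)) : Uq N q := t q (lo i) * tinv q (hi i)

variable (q) in
/-- The element `k_i⁻¹ = t_{i+1} t_i⁻¹`. -/
def kinv (i : Fin (N - 1)) : Uq N q := t q (hi i) * tinv q (lo i)

theorem mk_rel {x y : FreeAlgebra ℂ (Gen N)} (h : Rel N q x y) : mk N q x = mk N q y :=
  RingQuot.mkAlgHom_rel ℂ h

theorem satisfies : Satisfies N q (A := Uq N q) (e q) (f q) (t q) (tinv q) where
  t_tinv i := by simpa [e, f, t, tinv] using mk_rel (.t_tinv (q := q) i)
  tinv_t i := by simpa [e, f, t, tinv] using mk_rel (.tinv_t (q := q) i)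
  t_comm i j := by simpa [e, f, t, tinv] using mk_rel (.t_comm (q := q) i j)
  t_e i j := by simpa [e, f, t, tinv] using mk_rel (.t_e (q := q) i j)
  t_f i j := by simpa [e, f, t, tinv] using mk_rel (.t_f (q := q) i j)
  e_f_same i := by simpa [e, f, t, tinv] using mk_rel (.e_f_same (q := q) i)
  e_f_ne i j h := by simpa [e, f, t, tinv] using mk_rel (.e_f_ne (q := q) i j h)
  e_far i j h := by simpa [e, f, t, tinv] using mk_rel (.e_far (q := q) i j h)
  f_far i j h := by simpa [e, f, t, tinv] using mk_rel (.f_far (q := q) i j h)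
  e_serre i j h := by simpa [e, f, t, tinv] using mk_rel (.e_serre (q := q) i j h)
  f_serre i j h := by simpa [e, f, t, tinv] using mk_rel (.f_serre (q := q) i j h)

variable {A : Type*} [Ring A] [Algebra ℂ A]

/-- The map on free generators given by four families of elements. -/
def genMap (e f : Fin (N - 1) → A) (t tinv : Fin N → A) : Gen N → A
  | .e i => e i
  | .f i => f i
  | .t i => t i
  | .tinv i => tinv i

/-- The algebra homomorphism out of `U_q gl_N` given by elements satisfying the relations. -/
def lift (e f : Fin (N - 1) → A) (t tinv : Fin N → A) (h : Satisfies N q e f t tinv) :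
    Uq N q →ₐ[ℂ] A :=
  RingQuot.liftAlgHom ℂ ⟨FreeAlgebra.lift ℂ (genMap e f t tinv), by
    intro x y hxy
    have h0 := h.t_tinv; have h1 := h.tinv_t; have h2 := h.t_comm; have h3 := h.t_e
    have h4 := h.t_f; have h5 := h.e_f_same; have h6 := h.e_f_ne; have h7 := h.e_far
    have h8 := h.f_far; have h9 := h.e_serre; have h10 := h.f_serre
    cases hxy <;>
      simp only [Free.e, Free.f, Free.t, Free.tinv, map_mul, map_sub, map_add, map_smul, map_one,
        map_zero, FreeAlgebra.lift_ι_apply, genMap] <;> solve_by_elim⟩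

section lift

variable (e' f' : Fin (N - 1) → A) (t' tinv' : Fin N → A) (h : Satisfies N q e' f' t' tinv')

@[simp] theorem lift_e (i) : lift e' f' t' tinv' h (e q i) = e' i := by
  refine (RingQuot.liftAlgHom_mkAlgHom_apply ℂ _ _ _).trans ?_
  simp [Free.e, genMap]

@[simp] theorem lift_f (i) : lift e' f' t' tinv' h (f q i) = f' i := by
  refine (RingQuot.liftAlgHom_mkAlgHom_apply ℂ _ _ _).trans ?_
  simp [Free.f, genMap]

@[simp] theorem lift_t (i) : lift e' f' t' tinv' h (t q i) = t' i := by
  refine (RingQuot.liftAlgHom_mkAlgHom_apply ℂ _ _ _).trans ?_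
  simp [Free.t, genMap]

@[simp] theorem lift_tinv (i) : lift e' f' t' tinv' h (tinv q i) = tinv' i := by
  refine (RingQuot.liftAlgHom_mkAlgHom_apply ℂ _ _ _).trans ?_
  simp [Free.tinv, genMap]

end lift

end Uq

/-! ### The coproduct, its opposite, and the counit -/

/-- The entry `(α_i | α_j)` of the Cartan matrix. -/
def cartan {N : ℕ} (i j : Fin (N - 1)) : ℤ := pair (lo i) j - pair (hi i) j

theorem cartan_symm {N : ℕ} (i j : Fin (N - 1)) : cartan i j = cartan j i := by
  simp only [cartan, pair, lo, hi, Fin.mk.injEq]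
  split_ifs <;> omega

theorem cartan_self {N : ℕ} (i : Fin (N - 1)) : cartan i i = 2 := by
  simp only [cartan, pair, lo, hi, Fin.mk.injEq]
  split_ifs <;> omega

theorem cartan_far {N : ℕ} (i j : Fin (N - 1)) (h : i.1 + 1 < j.1 ∨ j.1 + 1 < i.1) :
    cartan i j = 0 := by
  simp only [cartan, pair, lo, hi, Fin.mk.injEq]
  split_ifs <;> omega

theorem cartan_adj {N : ℕ} (i j : Fin (N - 1)) (h : i.1 + 1 = j.1 ∨ j.1 + 1 = i.1) :
    cartan i j = -1 := by
  simp only [cartan, pair, lo, hi, Fin.mk.injEq]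
  split_ifs <;> omega

section skew

variable {A : Type*} [Ring A] [Algebra ℂ A]

theorem skew_of_conj {a a' x : A} {c : ℂ} (h : a' * a = 1) (hx : a * x * a' = c • x) :
    a * x = c • (x * a) := by
  rw [← smul_mul_assoc, ← hx, mul_assoc _ a' a, h, mul_one]

theorem skew_inv {a a' x : A} {c : ℂ} (hc : c ≠ 0) (h : a' * a = 1) (h' : a * a' = 1)
    (hx : a * x = c • (x * a)) : a' * x = c⁻¹ • (x * a') := by
  have : x = c • (a' * x * a) := by
    rw [mul_assoc, ← mul_smul_comm, ← hx, ← mul_assoc, h, one_mul]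
  nth_rw 2 [this]
  rw [smul_mul_assoc, smul_smul, inv_mul_cancel₀ hc, one_smul, mul_assoc, h', mul_one]

theorem skew_mul {a b x : A} {c d : ℂ} (ha : a * x = c • (x * a)) (hb : b * x = d • (x * b)) :
    a * b * x = (c * d) • (x * (a * b)) := by
  rw [mul_assoc, hb, mul_smul_comm, ← mul_assoc, ha, smul_mul_assoc, smul_smul, mul_comm d,
    mul_assoc]

/-- The `q`-Serre relation is inherited by the sum of two families that `q`-commute. -/
theorem serre_add {q : ℂ} (hq : q ≠ 0) {x₁ x₂ y₁ y₂ : A}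
    (h11 : y₁ * x₁ = q ^ (2 : ℤ) • (x₁ * y₁)) (h12 : y₁ * x₂ = q ^ (-1 : ℤ) • (x₂ * y₁))
    (h21 : y₂ * x₁ = q ^ (-1 : ℤ) • (x₁ * y₂))
    (hx : x₁ * x₁ * x₂ - (q + q⁻¹) • (x₁ * x₂ * x₁) + x₂ * x₁ * x₁ = 0)
    (hy : y₁ * y₁ * y₂ - (q + q⁻¹) • (y₁ * y₂ * y₁) + y₂ * y₁ * y₁ = 0) :
    (x₁ + y₁) * (x₁ + y₁) * (x₂ + y₂) - (q + q⁻¹) • ((x₁ + y₁) * (x₂ + y₂) * (x₁ + y₁)) +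
      (x₂ + y₂) * (x₁ + y₁) * (x₁ + y₁) = 0 := by
  have h11' (z : A) : y₁ * (x₁ * z) = q ^ (2 : ℤ) • (x₁ * (y₁ * z)) := by
    rw [← mul_assoc, h11, smul_mul_assoc, mul_assoc]
  have h12' (z : A) : y₁ * (x₂ * z) = q ^ (-1 : ℤ) • (x₂ * (y₁ * z)) := by
    rw [← mul_assoc, h12, smul_mul_assoc, mul_assoc]
  have h21' (z : A) : y₂ * (x₁ * z) = q ^ (-1 : ℤ) • (x₁ * (y₂ * z)) := by
    rw [← mul_assoc, h21, smul_mul_assoc, mul_assoc]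
  refine Eq.trans ?_ ((congrArg₂ (· + ·) hx hy).trans (add_zero 0))
  simp only [mul_add, add_mul, mul_assoc, h11, h12, h21, h11', h12', h21', mul_smul_comm,
    smul_mul_assoc, smul_smul]
  match_scalars <;> field_simp <;> ring

end skew

namespace Satisfies

variable {N : ℕ} {q : ℂ} {A : Type*} [Ring A] [Algebra ℂ A]
  {e f : Fin (N - 1) → A} {t tinv : Fin N → A}

theorem commute_t (h : Satisfies N q e f t tinv) (i j) : Commute (t i) (t j) := h.t_comm i j

theorem commute_tinv_t (h : Satisfies N q e f t tinv) (i j) : Commute (tinv i) (t j) := by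
  have := (h.commute_t i j)
  exact (Commute.units_inv_left (u := ⟨t i, tinv i, h.t_tinv i, h.tinv_t i⟩) this :)

theorem commute_tinv (h : Satisfies N q e f t tinv) (i j) : Commute (tinv i) (tinv j) := by
  have := (h.commute_tinv_t i j)
  exact (Commute.units_inv_right (u := ⟨t j, tinv j, h.t_tinv j, h.tinv_t j⟩) this :)

theorem commute_k (h : Satisfies N q e f t tinv) (i j : Fin (N - 1)) :
    Commute (t (lo i) * tinv (hi i)) (t (lo j) * tinv (hi j)) :=
  ((h.commute_t _ _).mul_right (h.commute_tinv_t _ _).symm).mul_left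
    ((h.commute_tinv_t _ _).mul_right (h.commute_tinv _ _))

theorem k_kinv (h : Satisfies N q e f t tinv) (i : Fin (N - 1)) :
    (t (lo i) * tinv (hi i)) * (t (hi i) * tinv (lo i)) = 1 := by
  rw [mul_assoc, ← mul_assoc (tinv _), h.tinv_t, one_mul, h.t_tinv]

theorem kinv_k (h : Satisfies N q e f t tinv) (i : Fin (N - 1)) :
    (t (hi i) * tinv (lo i)) * (t (lo i) * tinv (hi i)) = 1 := by
  rw [mul_assoc, ← mul_assoc (tinv _), h.tinv_t, one_mul, h.t_tinv]

theorem k_e (h : Satisfies N q e f t tinv) (hq : q ≠ 0) (i j : Fin (N - 1)) :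
    (t (lo i) * tinv (hi i)) * e j = q ^ cartan i j • (e j * (t (lo i) * tinv (hi i))) := by
  rw [cartan, zpow_sub₀ hq, div_eq_mul_inv]
  exact skew_mul (skew_of_conj (h.tinv_t _) (h.t_e _ _))
    (skew_inv (zpow_ne_zero _ hq) (h.tinv_t _) (h.t_tinv _)
      (skew_of_conj (h.tinv_t _) (h.t_e _ _)))

theorem k_f (h : Satisfies N q e f t tinv) (hq : q ≠ 0) (i j : Fin (N - 1)) :
    (t (lo i) * tinv (hi i)) * f j = q ^ (-cartan i j) • (f j * (t (lo i) * tinv (hi i))) := by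
  rw [cartan, neg_sub, sub_eq_neg_add, zpow_add₀ hq, ← neg_neg (pair (hi i) j), zpow_neg _ (-_)]
  exact skew_mul (skew_of_conj (h.tinv_t _) (h.t_f _ _))
    (skew_inv (zpow_ne_zero _ hq) (h.tinv_t _) (h.t_tinv _)
      (skew_of_conj (h.tinv_t _) (h.t_f _ _)))

theorem kinv_e (h : Satisfies N q e f t tinv) (hq : q ≠ 0) (i j : Fin (N - 1)) :
    (t (hi i) * tinv (lo i)) * e j = q ^ (-cartan i j) • (e j * (t (hi i) * tinv (lo i))) := by
  rw [zpow_neg]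
  exact skew_inv (zpow_ne_zero _ hq) (h.kinv_k i) (h.k_kinv i) (h.k_e hq i j)

theorem kinv_f (h : Satisfies N q e f t tinv) (hq : q ≠ 0) (i j : Fin (N - 1)) :
    (t (hi i) * tinv (lo i)) * f j = q ^ cartan i j • (f j * (t (hi i) * tinv (lo i))) := by
  rw [← neg_neg (cartan i j), zpow_neg]
  exact skew_inv (zpow_ne_zero _ hq) (h.kinv_k i) (h.k_kinv i) (h.k_f hq i j)

theorem commute_kinv (h : Satisfies N q e f t tinv) (i j : Fin (N - 1)) :
    Commute (t (hi i) * tinv (lo i)) (t (hi j) * tinv (lo j)) :=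
  ((h.commute_t _ _).mul_right (h.commute_tinv_t _ _).symm).mul_left
    ((h.commute_tinv_t _ _).mul_right (h.commute_tinv _ _))

end Satisfies

namespace Uq

variable {N : ℕ} {q : ℂ}

theorem k_e (hq : q ≠ 0) (i j : Fin (N - 1)) : k q i * e q j = q ^ cartan i j • (e q j * k q i) :=
  satisfies.k_e hq i j

theorem k_f (hq : q ≠ 0) (i j : Fin (N - 1)) :
    k q i * f q j = q ^ (-cartan i j) • (f q j * k q i) := satisfies.k_f hq i j

theorem f_kinv (hq : q ≠ 0) (i j : Fin (N - 1)) :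
    f q j * kinv q i = q ^ (-cartan i j) • (kinv q i * f q j) := by
  have := satisfies.kinv_f (N := N) hq i j
  rw [show kinv q i * f q j = _ from this, smul_smul, ← zpow_add₀ hq, neg_add_cancel, zpow_zero,
    one_smul]
  rfl

theorem e_kinv (hq : q ≠ 0) (i j : Fin (N - 1)) :
    e q j * kinv q i = q ^ cartan i j • (kinv q i * e q j) := by
  have := satisfies.kinv_e (N := N) hq i j
  rw [show kinv q i * e q j = _ from this, smul_smul, ← zpow_add₀ hq, add_neg_cancel, zpow_zero,
    one_smul]
  rfl

theorem e_f (i j : Fin (N - 1)) :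
    e q i * f q j - f q j * e q i = if i = j then (q - q⁻¹)⁻¹ • (k q i - kinv q i) else 0 := by
  split_ifs with h
  · subst h; exact satisfies.e_f_same i
  · exact satisfies.e_f_ne i j h

open Algebra.TensorProduct in
theorem comul_satisfies (hq : q ≠ 0) :
    Satisfies N q (A := Uq N q ⊗[ℂ] Uq N q)
      (fun i => e q i ⊗ₜ 1 + k q i ⊗ₜ e q i) (fun i => f q i ⊗ₜ kinv q i + 1 ⊗ₜ f q i)
      (fun i => t q i ⊗ₜ t q i) (fun i => tinv q i ⊗ₜ tinv q i) := by
  have S := satisfies (N := N) (q := q)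
  have tk (i : Fin N) (j) : t q i * k q j * tinv q i = k q j := by
    rw [k, ((S.commute_t i _).mul_right (S.commute_tinv_t _ i).symm).eq, mul_assoc, S.t_tinv,
      mul_one]
  have tkinv (i : Fin N) (j) : t q i * kinv q j * tinv q i = kinv q j := by
    rw [kinv, ((S.commute_t i _).mul_right (S.commute_tinv_t _ i).symm).eq, mul_assoc, S.t_tinv,
      mul_one]
  have ef (i j : Fin (N - 1)) :
      (e q i ⊗ₜ[ℂ] (1 : Uq N q) + k q i ⊗ₜ e q i) * (f q j ⊗ₜ kinv q j + 1 ⊗ₜ f q j) -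
        (f q j ⊗ₜ kinv q j + 1 ⊗ₜ f q j) * (e q i ⊗ₜ 1 + k q i ⊗ₜ e q i) =
      (e q i * f q j - f q j * e q i) ⊗ₜ kinv q j +
        k q i ⊗ₜ (e q i * f q j - f q j * e q i) := by
    simp only [mul_add, add_mul, tmul_mul_tmul, mul_one, one_mul, TensorProduct.sub_tmul,
      TensorProduct.tmul_sub, k_f hq, e_kinv hq, ← TensorProduct.smul_tmul',
      TensorProduct.tmul_smul, smul_smul, cartan_symm j i, ← zpow_add₀ hq]
    rw [add_neg_cancel, zpow_zero, one_smul]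
    abel
  have key (i j : Fin (N - 1)) : (k q i ⊗ₜ[ℂ] e q i) * (e q j ⊗ₜ (1 : Uq N q)) =
      q ^ cartan i j • ((e q j ⊗ₜ (1 : Uq N q)) * (k q i ⊗ₜ e q i)) := by
    simp only [tmul_mul_tmul, mul_one, one_mul, k_e hq, TensorProduct.smul_tmul']
  have keyf (i j : Fin (N - 1)) : ((1 : Uq N q) ⊗ₜ[ℂ] f q i) * (f q j ⊗ₜ kinv q j) =
      q ^ (-cartan i j) • ((f q j ⊗ₜ kinv q j) * ((1 : Uq N q) ⊗ₜ[ℂ] f q i)) := by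
    simp only [tmul_mul_tmul, mul_one, one_mul, f_kinv hq, TensorProduct.tmul_smul,
      cartan_symm j i]
  refine ⟨?_, ?_, ?_, ?_, ?_, ?_, ?_, ?_, ?_, ?_, ?_⟩
  · intro i; simp [S.t_tinv, one_def]
  · intro i; simp [S.tinv_t, one_def]
  · intro i j; simp [S.t_comm i j]
  · intro i j
    simp only [mul_add, add_mul, tmul_mul_tmul, S.t_e, tk, mul_one, S.t_tinv, smul_add,
      TensorProduct.smul_tmul', TensorProduct.tmul_smul]
  · intro i j
    simp only [mul_add, add_mul, tmul_mul_tmul, S.t_f, tkinv, mul_one, S.t_tinv, smul_add,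
      TensorProduct.smul_tmul', TensorProduct.tmul_smul]
  · intro i
    rw [ef, e_f, if_pos rfl]
    simp only [← TensorProduct.smul_tmul', TensorProduct.tmul_smul, ← smul_add,
      TensorProduct.sub_tmul, TensorProduct.tmul_sub, tmul_mul_tmul]
    congr 1
    simp only [k, kinv]
    abel
  · intro i j h
    rw [ef, e_f, if_neg h]
    simp
  · intro i j h
    have h1 := S.e_far i j h
    have h2 := key i j
    have h3 := key j i
    rw [cartan_far i j h, zpow_zero, one_smul] at h2
    rw [cartan_symm, cartan_far i j h, zpow_zero, one_smul] at h3
    rw [sub_eq_zero] at h1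
    simp only [mul_add, add_mul, h2, h3]
    simp only [tmul_mul_tmul, h1, mul_one, (show k q i * k q j = k q j * k q i from
      S.commute_k i j)]
    abel
  · intro i j h
    have h1 := S.f_far i j h
    have h2 := keyf i j
    have h3 := keyf j i
    rw [cartan_far i j h, neg_zero, zpow_zero, one_smul] at h2
    rw [cartan_symm, cartan_far i j h, neg_zero, zpow_zero, one_smul] at h3
    rw [sub_eq_zero] at h1
    simp only [mul_add, add_mul, h2, h3]
    simp only [tmul_mul_tmul, h1, mul_one, (show kinv q i * kinv q j = kinv q j * kinv q i from
      S.commute_kinv i j)]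
    abel
  · intro i j h
    have hc : k q j * k q i = k q i * k q j := S.commute_k j i
    refine serre_add hq ?_ ?_ ?_ ?_ ?_
    · rw [key, cartan_self]
    · rw [key, cartan_adj i j h]
    · rw [key, cartan_symm, cartan_adj i j h]
    · simp only [tmul_mul_tmul, mul_one, TensorProduct.smul_tmul', ← TensorProduct.sub_tmul,
        ← TensorProduct.add_tmul, S.e_serre i j h, TensorProduct.zero_tmul]
    · simp only [tmul_mul_tmul, hc, mul_assoc (k q i), ← TensorProduct.tmul_smul,
        ← TensorProduct.tmul_sub, ← TensorProduct.tmul_add, S.e_serre i j h,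
        TensorProduct.tmul_zero]
  · intro i j h
    have hc : kinv q j * kinv q i = kinv q i * kinv q j := S.commute_kinv j i
    have hs := fun i j h => S.f_serre i j h
    have hq' : q + q⁻¹ = q⁻¹ + q⁻¹⁻¹ := by rw [inv_inv, add_comm]
    rw [hq'] at hs ⊢
    refine serre_add (inv_ne_zero hq) ?_ ?_ ?_ ?_ ?_
    · rw [keyf, cartan_self, inv_zpow']
    · rw [keyf, cartan_adj i j h, inv_zpow']
    · rw [keyf, cartan_symm, cartan_adj i j h, inv_zpow']
    · simp only [tmul_mul_tmul, hc, mul_assoc (kinv q i), TensorProduct.smul_tmul',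
        ← TensorProduct.sub_tmul, ← TensorProduct.add_tmul, hs i j h, TensorProduct.zero_tmul]
    · simp only [tmul_mul_tmul, mul_one, ← TensorProduct.tmul_smul,
        ← TensorProduct.tmul_sub, ← TensorProduct.tmul_add, hs i j h, TensorProduct.tmul_zero]

variable (N) in
/-- The coproduct `Δ`: `Δ e_i = e_i ⊗ 1 + k_i ⊗ e_i`, `Δ f_i = f_i ⊗ k_i⁻¹ + 1 ⊗ f_i`,
`Δ t_i = t_i ⊗ t_i`. -/
def comul (hq : q ≠ 0) : Uq N q →ₐ[ℂ] Uq N q ⊗[ℂ] Uq N q :=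
  lift _ _ _ _ (comul_satisfies hq)

variable (N) in
/-- The opposite coproduct `Δ' = σ ∘ Δ`, where `σ (a ⊗ b) = b ⊗ a`. -/
def comulOp (hq : q ≠ 0) : Uq N q →ₐ[ℂ] Uq N q ⊗[ℂ] Uq N q :=
  (Algebra.TensorProduct.comm ℂ (Uq N q) (Uq N q)).toAlgHom.comp (comul N hq)

theorem counit_satisfies :
    Satisfies N q (A := ℂ) (fun _ => 0) (fun _ => 0) (fun _ => 1) (fun _ => 1) := by
  constructor <;> simp

variable (N q) in
/-- The counit `ε`: `ε e_i = ε f_i = 0`, `ε t_i = 1`. -/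
def counit : Uq N q →ₐ[ℂ] ℂ := lift _ _ _ _ counit_satisfies

end Uq

/-! ### Clifford generators and the Fock representation -/

section car

variable {N : ℕ} {q : ℂ} {A : Type*} [Ring A] [Algebra ℂ A] {c a : Fin N → A}

theorem car_aux {x y z w : A} {ε δ : ℂ} (h1 : y * z + z * y = ε • 1) (h2 : w * x + x * w = δ • 1)
    (h3 : x * z = -(z * x)) (h4 : y * w = -(w * y)) :
    x * y * (z * w) - z * w * (x * y) = ε • (x * w) - δ • (z * y) := by
  have h1' : y * z = ε • 1 - z * y := eq_sub_of_add_eq h1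
  have h2' : w * x = δ • 1 - x * w := eq_sub_of_add_eq h2
  have e1 : x * y * (z * w) = ε • (x * w) - z * x * w * y := by
    calc x * y * (z * w) = x * (y * z) * w := by noncomm_ring
      _ = ε • (x * w) - x * z * (y * w) := by
        rw [h1']; simp only [mul_sub, sub_mul, mul_smul_comm, smul_mul_assoc, mul_one, mul_assoc]
      _ = _ := by rw [h3, h4]; noncomm_ring
  have e2 : z * w * (x * y) = δ • (z * y) - z * x * w * y := by
    calc z * w * (x * y) = z * (w * x) * y := by noncomm_ring
      _ = _ := by
        rw [h2']; simp only [mul_sub, sub_mul, mul_smul_comm, smul_mul_assoc, mul_one, mul_assoc]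
  rw [e1, e2]; abel

/-- Elements satisfying the canonical anticommutation relations give a solution of the relations
of `U_q gl_N`. -/
theorem car_satisfies (hq : q ≠ 0) (hq2 : q ^ 2 ≠ 1)
    (hcc : ∀ i j, c i * c j = -(c j * c i)) (haa : ∀ i j, a i * a j = -(a j * a i))
    (hac : ∀ i j, a i * c j + c j * a i = if i = j then 1 else 0) :
    Satisfies N q (fun i => c (lo i) * a (hi i)) (fun i => c (hi i) * a (lo i))
      (fun i => q • (c i * a i) + a i * c i) (fun i => q⁻¹ • (c i * a i) + a i * c i) := by
  have half {x : A} (h : x = -x) : x = 0 := by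
    have h2 : (2 : ℂ) • x = 0 := by rw [two_smul]; nth_rw 1 [h]; exact neg_add_cancel x
    exact (smul_eq_zero_iff_right two_ne_zero).1 h2
  have c2 (i) : c i * c i = 0 := half (hcc i i)
  have a2 (i) : a i * a i = 0 := half (haa i i)
  have ac (i) : a i * c i = 1 - c i * a i := eq_sub_of_add_eq (by rw [hac, if_pos rfl])
  have ac' {i j} (h : i ≠ j) : a i * c j = -(c j * a i) :=
    eq_neg_of_add_eq_zero_left (by rw [hac, if_neg h])
  have hac' (i j) : a i * c j + c j * a i = (if i = j then (1 : ℂ) else 0) • 1 := by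
    rw [hac]; split_ifs <;> simp
  have cac (i) : c i * a i * c i = c i := by
    rw [mul_assoc, ac, mul_sub, ← mul_assoc, c2]; simp
  have aca (i) : a i * c i * a i = a i := by
    rw [ac, sub_mul, mul_assoc, a2]; simp
  have comm (i j k l) : c i * a j * (c k * a l) - c k * a l * (c i * a j) =
      (if j = k then (1 : ℂ) else 0) • (c i * a l) -
        (if l = i then (1 : ℂ) else 0) • (c k * a j) :=
    car_aux (hac' j k) (hac' l i) (hcc i k) (haa j l)
  have pp (i j) : c i * a i * (c j * a j) = c j * a j * (c i * a i) := by
    have := comm i i j j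
    by_cases h : i = j
    · subst h; rfl
    · rw [if_neg h, if_neg (Ne.symm h)] at this
      simpa [sub_eq_zero] using this
  have pidem (i) : c i * a i * (c i * a i) = c i * a i := by
    rw [← mul_assoc, cac]
  have tc (i j) : (q • (c i * a i) + a i * c i) * c j =
      q ^ (if i = j then 1 else 0 : ℤ) • (c j * (q • (c i * a i) + a i * c i)) := by
    split_ifs with h
    · subst h
      simp only [add_mul, mul_add, smul_mul_assoc, mul_smul_comm, cac, ← mul_assoc, c2, zero_mul]
      simp [mul_assoc, c2]
    · have : c i * a i * c j = c j * (c i * a i) := by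
        rw [mul_assoc, ac' h, mul_neg, ← mul_assoc, hcc]; noncomm_ring
      rw [ac, zpow_zero, one_smul, add_mul, mul_add, sub_mul, mul_sub, smul_mul_assoc,
        mul_smul_comm, this, one_mul, mul_one]
  have ta (i j) : (q • (c i * a i) + a i * c i) * a j =
      q ^ (-(if i = j then 1 else 0) : ℤ) • (a j * (q • (c i * a i) + a i * c i)) := by
    split_ifs with h
    · subst h
      simp only [add_mul, mul_add, smul_mul_assoc, mul_smul_comm, aca, ← mul_assoc, a2, zero_mul]
      simp [mul_assoc, a2, hq, smul_smul]
    · have : c i * a i * a j = a j * (c i * a i) := by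
        rw [mul_assoc, haa, mul_neg, ← mul_assoc, ← mul_assoc, ac' (Ne.symm h)]; noncomm_ring
      rw [ac, neg_zero, zpow_zero, one_smul, add_mul, mul_add, sub_mul, mul_sub, smul_mul_assoc,
        mul_smul_comm, this, one_mul, mul_one]
  have ttinv (i) : (q • (c i * a i) + a i * c i) * (q⁻¹ • (c i * a i) + a i * c i) = 1 := by
    simp only [ac, add_mul, mul_add, sub_mul, mul_sub, smul_mul_assoc, mul_smul_comm, pidem,
      one_mul, mul_one]
    match_scalars
    all_goals field_simp
    all_goals ring
  have tinvt (i) : (q⁻¹ • (c i * a i) + a i * c i) * (q • (c i * a i) + a i * c i) = 1 := by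
    simp only [ac, add_mul, mul_add, sub_mul, mul_sub, smul_mul_assoc, mul_smul_comm, pidem,
      one_mul, mul_one]
    match_scalars
    all_goals field_simp
    all_goals ring
  have conj (i : Fin N) {x y : A} {m n : ℤ}
      (hx : (q • (c i * a i) + a i * c i) * x = q ^ m • (x * (q • (c i * a i) + a i * c i)))
      (hy : (q • (c i * a i) + a i * c i) * y = q ^ n • (y * (q • (c i * a i) + a i * c i))) :
      (q • (c i * a i) + a i * c i) * (x * y) * (q⁻¹ • (c i * a i) + a i * c i) =
        q ^ (m + n) • (x * y) := by
    rw [← mul_assoc, hx, smul_mul_assoc, mul_assoc x, hy, mul_smul_comm, smul_smul,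
      ← zpow_add₀ hq, smul_mul_assoc, ← mul_assoc, mul_assoc (x * y), ttinv, mul_one]
  have lohi (i : Fin (N - 1)) : lo i ≠ hi i := by simp [lo, hi]
  have ee (i : Fin (N - 1)) (z : A) : c (lo i) * a (hi i) * (c (lo i) * z) = 0 := by
    rw [mul_assoc, ← mul_assoc (a _), ac' (lohi i).symm, neg_mul, mul_neg, mul_assoc, ← mul_assoc,
      c2, zero_mul, neg_zero]
  have ff (i : Fin (N - 1)) (z : A) : c (hi i) * a (lo i) * (c (hi i) * z) = 0 := by
    rw [mul_assoc, ← mul_assoc (a _), ac' (lohi i), neg_mul, mul_neg, mul_assoc, ← mul_assoc,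
      c2, zero_mul, neg_zero]
  have serre {x y z : A} (hxx : x * x = 0) (h : x * y - y * x = z) (hz : z * x = 0) :
      x * x * y - (q + q⁻¹) • (x * y * x) + y * x * x = 0 := by
    have : x * y * x = 0 := by
      rw [eq_add_of_sub_eq h, add_mul, hz, mul_assoc, hxx]; simp
    rw [this, mul_assoc y, hxx]; simp
  refine ⟨ttinv, tinvt, ?_, ?_, ?_, ?_, ?_, ?_, ?_, ?_, ?_⟩
  · intro i j
    simp only [ac, add_mul, mul_add, sub_mul, mul_sub, smul_mul_assoc, mul_smul_comm, pp j i,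
      one_mul, mul_one]
    module
  · intro i j
    exact conj i (tc i (lo j)) (ta i (hi j))
  · intro i j
    have := conj i (tc i (hi j)) (ta i (lo j))
    rwa [show -pair i j = (if i = hi j then 1 else 0 : ℤ) + -(if i = lo j then 1 else 0) by
      simp [pair]; ring]
  · intro i
    have hne : q - q⁻¹ ≠ 0 := by
      intro h
      apply hq2
      rw [sub_eq_zero] at h
      rw [pow_two]; nth_rw 1 [h]; exact inv_mul_cancel₀ hq
    have : c (lo i) * a (hi i) * (c (hi i) * a (lo i)) -
        c (hi i) * a (lo i) * (c (lo i) * a (hi i)) =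
        c (lo i) * a (lo i) - c (hi i) * a (hi i) := by
      rw [comm]; simp
    rw [this, eq_inv_smul_iff₀ hne]
    simp only [ac, add_mul, mul_add, sub_mul, mul_sub, smul_mul_assoc, mul_smul_comm,
      pp (hi i) (lo i), one_mul, mul_one]
    match_scalars
    all_goals field_simp
    all_goals ring
  · intro i j h
    have h1 : lo j ≠ lo i := by simpa [lo, Fin.ext_iff] using fun h' => h (Fin.ext h'.symm)
    have h2 : hi i ≠ hi j := by simpa [hi, Fin.ext_iff] using fun h' => h (Fin.ext h')
    rw [comm, if_neg h1, if_neg h2]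
    simp
  · intro i j h
    rw [comm, if_neg (by simp [lo, hi]; omega), if_neg (by simp [lo, hi]; omega)]
    simp
  · intro i j h
    rw [comm, if_neg (by simp [lo, hi]; omega), if_neg (by simp [lo, hi]; omega)]
    simp
  · intro i j h
    refine serre (ee i _) (comm _ _ _ _) ?_
    rcases h with h | h
    · rw [if_pos (by simp [lo, hi, h]), if_neg (by simp [lo, hi]; omega), zero_smul, sub_zero,
        one_smul, mul_assoc, ← mul_assoc (a _), ac' (by simp [lo, hi]; omega)]
      rw [neg_mul, mul_neg, mul_assoc, ← mul_assoc, c2]; simp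
    · rw [if_neg (by simp [lo, hi]; omega), if_pos (by simp [lo, hi, h]), zero_smul, zero_sub,
        one_smul, neg_mul, mul_assoc, ← mul_assoc (a _), ac' (by simp [lo, hi]), neg_mul,
        mul_assoc, a2]
      simp
  · intro i j h
    refine serre (ff i _) (comm _ _ _ _) ?_
    rcases h with h | h
    · rw [if_neg (by simp [lo, hi]; omega), if_pos (by simp [lo, hi, h]), zero_smul, zero_sub,
        one_smul, neg_mul, mul_assoc, ← mul_assoc (a _), ac' (by simp [lo, hi]), neg_mul,
        mul_assoc, a2]
      simp
    · rw [if_pos (by simp [lo, hi, h]), if_neg (by simp [lo, hi]; omega), zero_smul, sub_zero,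
        one_smul, mul_assoc, ← mul_assoc (a _), ac' (by simp [lo, hi]; omega)]
      rw [neg_mul, mul_neg, mul_assoc, ← mul_assoc, c2]; simp

end car

/-- The vector space `ℂⁿ`. -/
abbrev Vec (n : ℕ) : Type := Fin n → ℂ

/-- The exterior algebra `⋀ ℂⁿ`. -/
abbrev Fock (n : ℕ) : Type := ExteriorAlgebra ℂ (Vec n)

/-- The `i`-th standard basis vector of `ℂⁿ`. -/
def stdVec {n : ℕ} (i : Fin n) : Vec n := Pi.single i 1

/-- The creation operator `ψ*_i`, that is `v ↦ v_i ∧ v`. -/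
def create {n : ℕ} (i : Fin n) : Module.End ℂ (Fock n) :=
  LinearMap.mulLeft ℂ (ExteriorAlgebra.ι ℂ (stdVec i))

/-- The annihilation operator `ψ_i`, that is the contraction with the `i`-th dual basis vector. -/
def annih {n : ℕ} (i : Fin n) : Module.End ℂ (Fock n) :=
  CliffordAlgebra.contractLeft (Q := (0 : QuadraticForm ℂ (Vec n))) (LinearMap.proj i)

theorem create_create {n : ℕ} (i j : Fin n) :
    create i * create j = -(create j * create i) := by
  refine LinearMap.ext fun x => ?_
  have := ExteriorAlgebra.ι_add_mul_swap (R := ℂ) (stdVec i) (stdVec j)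
  simp only [create, Module.End.mul_apply, LinearMap.mulLeft_apply, LinearMap.neg_apply,
    ← mul_assoc]
  rw [eq_neg_of_add_eq_zero_left this, neg_mul]

theorem annih_annih {n : ℕ} (i j : Fin n) :
    annih i * annih j = -(annih j * annih i) := by
  refine LinearMap.ext fun x => ?_
  exact CliffordAlgebra.contractLeft_comm _ _ _

theorem annih_create {n : ℕ} (i j : Fin n) :
    annih i * create j + create j * annih i = if i = j then 1 else 0 := by
  refine LinearMap.ext fun x => ?_
  have := CliffordAlgebra.contractLeft_ι_mul (Q := (0 : QuadraticForm ℂ (Vec n)))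
    (d := LinearMap.proj i) (stdVec j) x
  change annih i (create j x) + create j (annih i x) = _
  change annih i (create j x) = _ - create j (annih i x) at this
  rw [this, sub_add_cancel, LinearMap.proj_apply, stdVec, Pi.single_apply]
  split_ifs <;> simp

/-- The representation of `U_q gl_n` on `⋀ ℂⁿ` with `e_i ↦ ψ*_i ψ_{i+1}`, `f_i ↦ ψ*_{i+1} ψ_i` and
`t_i^{±1} ↦ q^{±1} ψ*_i ψ_i + ψ_i ψ*_i`. -/
def fockRep (n : ℕ) {q : ℂ} (hq : q ≠ 0) (hq2 : q ^ 2 ≠ 1) :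
    Uq n q →ₐ[ℂ] Module.End ℂ (Fock n) :=
  Uq.lift _ _ _ _ (car_satisfies hq hq2 create_create annih_annih annih_create)

/-! ### Tensor powers of a representation -/

/-- The canonical isomorphism `X^{⊗ m} ⊗ X ≃ X^{⊗ (m + 1)}`. -/
def snocEquiv (X : Type) [AddCommGroup X] [Module ℂ X] (m : ℕ) :
    (⨂[ℂ]^m X) ⊗[ℂ] X ≃ₗ[ℂ] ⨂[ℂ]^(m + 1) X :=
  (TensorProduct.congr (LinearEquiv.refl ℂ _)
    (PiTensorProduct.subsingletonEquiv (R := ℂ) (s := fun _ => X) (0 : Fin 1)).symm).trans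
    TensorPower.mulEquiv

/-- The action on the `m`-th tensor power of a representation `ρ` through the iterate of a given
coproduct, `Δ^{(0)} = ε` and `Δ^{(m+1)} = (Δ^{(m)} ⊗ id) ∘ Δ`. -/
def tensorRep {n : ℕ} {q : ℂ} (Δ : Uq n q →ₐ[ℂ] Uq n q ⊗[ℂ] Uq n q) {X : Type} [AddCommGroup X]
    [Module ℂ X] (ρ : Uq n q →ₐ[ℂ] Module.End ℂ X) :
    (m : ℕ) → Uq n q →ₐ[ℂ] Module.End ℂ (⨂[ℂ]^m X)
  | 0 => (Algebra.ofId ℂ (Module.End ℂ (⨂[ℂ]^0 X))).comp (Uq.counit n q)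
  | m + 1 => ((snocEquiv X m).conjAlgEquiv ℂ).toAlgHom.comp
      ((Module.endTensorEndAlgHom (R := ℂ) (S := ℂ) (A := ℂ)).comp
        ((Algebra.TensorProduct.map (tensorRep Δ ρ m) ρ).comp Δ))

/-! ### The exterior algebra of a tensor product as a tensor power -/

section exterior

variable {n m : ℕ} {X : Type} [AddCommGroup X] [Module ℂ X]

/-- For linear maps `j_1, …, j_m : ℂⁿ → X`, the linear map `(⋀ ℂⁿ)^{⊗ m} → ⋀ X` with
`ω_1 ⊗ ⋯ ⊗ ω_m ↦ (⋀ j_1) ω_1 ∧ ⋯ ∧ (⋀ j_m) ω_m`. -/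
def wedgeMap (j : Fin m → Vec n →ₗ[ℂ] X) : (⨂[ℂ]^m (Fock n)) →ₗ[ℂ] ExteriorAlgebra ℂ X :=
  PiTensorProduct.lift ((MultilinearMap.mkPiAlgebraFin ℂ m (ExteriorAlgebra ℂ X)).compLinearMap
    fun r => (ExteriorAlgebra.map (j r)).toLinearMap)

theorem wedgeMap_tprod (j : Fin m → Vec n →ₗ[ℂ] X) (ω : Fin m → Fock n) :
    wedgeMap j (PiTensorProduct.tprod ℂ ω) =
      (List.ofFn fun r => ExteriorAlgebra.map (j r) (ω r)).prod := by
  simp [wedgeMap]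

theorem ι_mul_eq (x : X) (ω : ExteriorAlgebra ℂ X) :
    ExteriorAlgebra.ι ℂ x * ω =
      ExteriorAlgebra.map (-LinearMap.id) ω * ExteriorAlgebra.ι ℂ x := by
  induction ω using ExteriorAlgebra.induction with
  | algebraMap r =>
    rw [AlgHom.commutes]
    exact (Algebra.commutes r _).symm
  | ι y =>
    have h1 := ExteriorAlgebra.ι_add_mul_swap (R := ℂ) x y
    rw [ExteriorAlgebra.map_apply_ι, LinearMap.neg_apply, LinearMap.id_apply, map_neg, neg_mul,
      eq_neg_of_add_eq_zero_left h1]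
  | mul a b ha hb =>
    rw [map_mul, ← mul_assoc, ha, mul_assoc, hb, mul_assoc]
  | add a b ha hb =>
    rw [map_add, mul_add, add_mul, ha, hb]

theorem map_map_neg (l : Vec n →ₗ[ℂ] X) (ω : Fock n) :
    ExteriorAlgebra.map l (ExteriorAlgebra.map (-LinearMap.id) ω) =
      ExteriorAlgebra.map (-LinearMap.id) (ExteriorAlgebra.map l ω) := by
  rw [← AlgHom.comp_apply, ← AlgHom.comp_apply, ExteriorAlgebra.map_comp_map,
    ExteriorAlgebra.map_comp_map, LinearMap.comp_neg, LinearMap.neg_comp, LinearMap.comp_id,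
    LinearMap.id_comp]

theorem ι_mul_prod_mem {m : ℕ} (j : Fin m → Vec n →ₗ[ℂ] X) (r : Fin m) (v : Vec n)
    (ω : Fin m → Fock n) :
    ∃ ω' : Fin m → Fock n, ExteriorAlgebra.ι ℂ (j r v) *
      (List.ofFn fun s => ExteriorAlgebra.map (j s) (ω s)).prod =
        (List.ofFn fun s => ExteriorAlgebra.map (j s) (ω' s)).prod := by
  induction m with
  | zero => exact r.elim0
  | succ m ih =>
    rcases Fin.eq_zero_or_eq_succ r with rfl | ⟨r, rfl⟩
    · refine ⟨Fin.cons (ExteriorAlgebra.ι ℂ v * ω 0) fun s => ω s.succ, ?_⟩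
      simp [List.ofFn_succ, mul_assoc]
    · obtain ⟨ω', h⟩ := ih (fun s => j s.succ) r (fun s => ω s.succ)
      refine ⟨Fin.cons (ExteriorAlgebra.map (-LinearMap.id) (ω 0)) ω', ?_⟩
      simp only [List.ofFn_succ, List.prod_cons, Fin.cons_zero, Fin.cons_succ, map_map_neg, ← h]
      rw [← mul_assoc, ι_mul_eq, mul_assoc]

theorem wedgeMap_surjective (j : Fin m → Vec n →ₗ[ℂ] X)
    (hj : ⨆ r, LinearMap.range (j r) = ⊤) : Function.Surjective (wedgeMap j) := by
  have key (x : X) (y) (hy : y ∈ LinearMap.range (wedgeMap j)) :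
      ExteriorAlgebra.ι ℂ x * y ∈ LinearMap.range (wedgeMap j) := by
    have hx : x ∈ ⨆ r, LinearMap.range (j r) := hj ▸ Submodule.mem_top
    induction hx using Submodule.iSup_induction' with
    | zero => simp
    | add x x' _ _ h h' => rw [map_add, add_mul]; exact add_mem h h'
    | mem r x hx =>
      obtain ⟨v, rfl⟩ := hx
      obtain ⟨z, rfl⟩ := hy
      induction z using PiTensorProduct.induction_on with
      | smul_tprod c ω =>
        obtain ⟨ω', h⟩ := ι_mul_prod_mem j r v ω
        rw [map_smul, mul_smul_comm, wedgeMap_tprod, h, ← wedgeMap_tprod]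
        exact Submodule.smul_mem _ _ ⟨_, rfl⟩
      | add a b ha hb => rw [map_add, mul_add]; exact add_mem ha hb
  have one : (1 : ExteriorAlgebra ℂ X) ∈ LinearMap.range (wedgeMap j) :=
    ⟨PiTensorProduct.tprod ℂ fun _ => 1, by rw [wedgeMap_tprod]; simp⟩
  intro y
  change y ∈ LinearMap.range (wedgeMap j)
  suffices h : ∀ y z : ExteriorAlgebra ℂ X, z ∈ LinearMap.range (wedgeMap j) →
      y * z ∈ LinearMap.range (wedgeMap j) by simpa using h y 1 one
  intro y
  induction y using ExteriorAlgebra.induction with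
  | algebraMap r => intro z hz; rw [← Algebra.smul_def]; exact Submodule.smul_mem _ _ hz
  | ι x => exact fun z hz => key x z hz
  | mul a b ha hb => intro z hz; rw [mul_assoc]; exact ha _ (hb _ hz)
  | add a b ha hb => intro z hz; rw [add_mul]; exact add_mem (ha _ hz) (hb _ hz)

theorem wedgeMap_bijective {κ : Type} [Fintype κ] (b : Module.Basis κ ℂ X)
    (hκ : Fintype.card κ = n * m) (j : Fin m → Vec n →ₗ[ℂ] X)
    (hj : ⨆ r, LinearMap.range (j r) = ⊤) : Function.Bijective (wedgeMap j) := by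
  let _ : LinearOrder κ := LinearOrder.lift' (Fintype.equivFin κ) (Fintype.equivFin κ).injective
  have B1 := b.ExteriorAlgebra
  have B2 := Basis.piTensorProduct (fun _ : Fin m => (Pi.basisFun ℂ (Fin n)).ExteriorAlgebra)
  have := Module.Finite.of_basis B1
  have : Module.Finite ℂ (⨂[ℂ]^m (Fock n)) := Module.Finite.of_basis B2
  have hd : Module.finrank ℂ (⨂[ℂ]^m (Fock n)) = Module.finrank ℂ (ExteriorAlgebra ℂ X) := by
    rw [Module.finrank_eq_card_basis B1]
    refine (Module.finrank_eq_card_basis B2).trans ?_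
    simp [hκ, pow_mul]
  exact ⟨(LinearMap.injective_iff_surjective_of_finrank_eq_finrank hd).2
    (wedgeMap_surjective j hj), wedgeMap_surjective j hj⟩

end exterior

/-! ### The two actions on `⋀ (V ⊗ W)`, `V = ℂᴺ`, `W = ℂᴹ` -/

/-- `⋀ (V ⊗ W)` with `V = ℂᴺ` and `W = ℂᴹ`. -/
abbrev Ext (N M : ℕ) : Type := ExteriorAlgebra ℂ (Vec N ⊗[ℂ] Vec M)

/-- The inclusion `v ↦ v ⊗ w_r` of `V` in `V ⊗ W`. -/
def inclV (N : ℕ) {M : ℕ} (r : Fin M) : Vec N →ₗ[ℂ] Vec N ⊗[ℂ] Vec M :=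
  (TensorProduct.mk ℂ (Vec N) (Vec M)).flip (stdVec r)

/-- The inclusion `w ↦ v_i ⊗ w` of `W` in `V ⊗ W`. -/
def inclW {N : ℕ} (M : ℕ) (i : Fin N) : Vec M →ₗ[ℂ] Vec N ⊗[ℂ] Vec M :=
  TensorProduct.mk ℂ (Vec N) (Vec M) (stdVec i)

theorem iSup_inclV (N M : ℕ) : ⨆ r, LinearMap.range (inclV N (M := M) r) = ⊤ := by
  rw [eq_top_iff, ← TensorProduct.span_tmul_eq_top, Submodule.span_le]
  rintro _ ⟨v, w, rfl⟩
  have hw : w = ∑ r, w r • stdVec r := by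
    simpa [stdVec] using (Pi.basisFun ℂ (Fin M)).sum_repr w |>.symm
  rw [hw, TensorProduct.tmul_sum]
  refine Submodule.sum_mem _ fun r _ => ?_
  rw [TensorProduct.tmul_smul]
  exact Submodule.smul_mem _ _ (Submodule.mem_iSup_of_mem r ⟨v, rfl⟩)

theorem iSup_inclW (N M : ℕ) : ⨆ i, LinearMap.range (inclW (N := N) M i) = ⊤ := by
  rw [eq_top_iff, ← TensorProduct.span_tmul_eq_top, Submodule.span_le]
  rintro _ ⟨v, w, rfl⟩
  have hv : v = ∑ r, v r • stdVec r := by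
    simpa [stdVec] using (Pi.basisFun ℂ (Fin N)).sum_repr v |>.symm
  rw [hv, TensorProduct.sum_tmul]
  refine Submodule.sum_mem _ fun r _ => ?_
  rw [← TensorProduct.smul_tmul']
  exact Submodule.smul_mem _ _ (Submodule.mem_iSup_of_mem r ⟨w, rfl⟩)

/-- The isomorphism `(⋀ V)^{⊗ M} ≃ ⋀ (V ⊗ W)`; its inverse is the isomorphism of graded commutative
algebras sending `v_i ⊗ w_r` to `1 ⊗ ⋯ ⊗ v_i ⊗ ⋯ ⊗ 1`, with `v_i` in the `r`-th factor. -/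
def equivV (N M : ℕ) : (⨂[ℂ]^M (Fock N)) ≃ₗ[ℂ] Ext N M :=
  LinearEquiv.ofBijective (wedgeMap (inclV N)) <|
    wedgeMap_bijective ((Pi.basisFun ℂ (Fin N)).tensorProduct (Pi.basisFun ℂ (Fin M)))
      (by simp) _ (iSup_inclV N M)

/-- The isomorphism `(⋀ W)^{⊗ N} ≃ ⋀ (V ⊗ W)`; its inverse is the isomorphism of graded commutative
algebras sending `v_i ⊗ w_r` to `1 ⊗ ⋯ ⊗ w_r ⊗ ⋯ ⊗ 1`, with `w_r` in the `i`-th factor. -/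
def equivW (N M : ℕ) : (⨂[ℂ]^N (Fock M)) ≃ₗ[ℂ] Ext N M :=
  LinearEquiv.ofBijective (wedgeMap (inclW M)) <|
    wedgeMap_bijective ((Pi.basisFun ℂ (Fin N)).tensorProduct (Pi.basisFun ℂ (Fin M)))
      (by simp [mul_comm]) _ (iSup_inclW N M)

/-- The action of `U_q gl_N` on `⋀ (V ⊗ W) ≃ (⋀ V)^{⊗ M}` through the iterated coproduct. (The
images of the generators on `⋀ V` are even, so no signs arise from the grading.) -/
def actN (N M : ℕ) {q : ℂ} (hq : q ≠ 0) (hq2 : q ^ 2 ≠ 1) :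
    Uq N q →ₐ[ℂ] Module.End ℂ (Ext N M) :=
  ((equivV N M).conjAlgEquiv ℂ).toAlgHom.comp
    (tensorRep (Uq.comul N hq) (fockRep N hq hq2) M)

/-- The action of `U_q gl_M` on `⋀ (V ⊗ W) ≃ (⋀ W)^{⊗ N}` through the iterated opposite
coproduct. -/
def actM (N M : ℕ) {q : ℂ} (hq : q ≠ 0) (hq2 : q ^ 2 ≠ 1) :
    Uq M q →ₐ[ℂ] Module.End ℂ (Ext N M) :=
  ((equivW N M).conjAlgEquiv ℂ).toAlgHom.comp
    (tensorRep (Uq.comulOp M hq) (fockRep M hq hq2) N)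

/-! ### Irreducible highest weight modules -/

/-- The left ideal of `U_q gl_n` generated by all `e_i` and all `t_i - q^{μ_i}`; the quotient by it
is the Verma module of highest weight `μ`. -/
def vermaIdeal (n : ℕ) (q : ℂ) (μ : Fin n → ℤ) : Submodule (Uq n q) (Uq n q) :=
  Submodule.span (Uq n q)
    (Set.range (Uq.e q) ∪ Set.range fun i => Uq.t q i - algebraMap ℂ (Uq n q) (q ^ μ i))

/-- The Verma module of highest weight `μ`. -/
abbrev Verma (n : ℕ) (q : ℂ) (μ : Fin n → ℤ) : Type := Uq n q ⧸ vermaIdeal n q μ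

/-- The sum of all proper submodules of the Verma module. -/
def maxSubmodule (n : ℕ) (q : ℂ) (μ : Fin n → ℤ) : Submodule (Uq n q) (Verma n q μ) :=
  sSup {P | P ≠ ⊤}

/-- The irreducible module of highest weight `μ`, that is the quotient of the Verma module by its
largest proper submodule. -/
abbrev Irr (n : ℕ) (q : ℂ) (μ : Fin n → ℤ) : Type := Verma n q μ ⧸ maxSubmodule n q μ

/-- The weight of `gl_n` given by the lengths of the first `n` rows of a Young diagram. -/
def rowWeight (n : ℕ) (lam : YoungDiagram) : Fin n → ℤ := fun i => lam.rowLen i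

/-- The Young diagrams with at most `N` rows and at most `M` columns. -/
abbrev BoxDiagram (N M : ℕ) : Type := {lam : YoungDiagram // lam.colLen 0 ≤ N ∧ lam.rowLen 0 ≤ M}

/-- The action of `U_q gl_N ⊗ U_q gl_M` on `V^N_λ ⊗ V^M_{λᵗ}`. -/
def irrTensorAction (N M : ℕ) (q : ℂ) (lam : YoungDiagram) :
    Uq N q ⊗[ℂ] Uq M q →ₐ[ℂ] Module.End ℂ
      (Irr N q (rowWeight N lam) ⊗[ℂ] Irr M q (rowWeight M lam.transpose)) :=
  (Module.endTensorEndAlgHom (R := ℂ) (S := ℂ) (A := ℂ)).comp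
    (Algebra.TensorProduct.map (Algebra.lsmul ℂ ℂ _) (Algebra.lsmul ℂ ℂ _))

/-- A representation is simple: it is nonzero and has no proper nonzero invariant subspace. -/
def IsSimpleAction {A X : Type} [Ring A] [Algebra ℂ A] [AddCommGroup X] [Module ℂ X]
    (ρ : A →ₐ[ℂ] Module.End ℂ X) : Prop :=
  Nontrivial X ∧ ∀ P : Submodule ℂ X, (∀ a, ∀ x ∈ P, ρ a x ∈ P) → P = ⊥ ∨ P = ⊤

end SkewHowe

end

open SkewHowe

/-! The exterior algebra of V ⊗ W is embedded in the exterior algebra on a grid of sites (i, r),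
with i and r running over ℕ. All operators are written in terms of creation operators c,
annihilation operators a and diagonal operators D w, thought of as q to the power ∑ w k c_k a_k;
only the relations collected in `Fermi` are used. A product c_k a_l, a hop from l to k, is an even
derivation. The iterated coproducts therefore become sums of hops dressed with diagonal factors: e_i
of the first algebra moves a particle from row i + 1 to row i in a column r, with k_i acting on the
columns before r. The second algebra does the same between neighbouring columns (`gridPair`).

Commutation. When a raising operator for rows meets an operator for columns, only the hops inside
one 2 × 2 block of sites interact. Two pairs of hops there have both products equal to zero, and the
commutators of the other two pairs cancel because of the diagonal factors
(`commute_raiseRow_raiseCol`, `commute_raiseRow_lowerCol`). The remaining cases follow by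
transposing the grid while inverting q (`Fermi.flip`) and by taking adjoints for the symmetric form
in which monomials are orthonormal (`FermiForm`).

Joint highest weight vectors. Let q not be a root of unity. The central claim is that the joint
highest weight vectors are, up to scalars, the states in which exactly the sites of a Young diagram
λ in the N × M box are occupied. Such a state has weights λ and λᵗ and is killed by all raising
operators, since every hop up or to the left is blocked or has nothing to move. Conversely, delete
empty last rows and columns, then remove from a joint highest weight vector the last particle of the
last row, and separately the last particle of the last column. Both results are again joint highest
weight vectors, so by induction both have Young diagrams as weights, and comparing the two diagrams
shows that the removed site can be added back. The comparison says nothing when both removals take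
the corner site. That case is settled by `Fermi.corner`, an identity combining root vectors, a
telescoping sum and a geometric series. Finally a vector whose row and column weights are those of a
diagram must be its state (`isState_of_weight`), so each λ occurs once (`exists_howePair`).

Duality. The rest uses only the data in `HowePair`. A nonzero subspace stable under both algebras
contains one of the vectors v_λ (`HowePair.exists_mem`). Applied to orthogonal complements this
replaces complete reducibility: the form is bilinear over ℂ and has no positivity, but B(v_λ, v_λ) =
1 prevents v_λ from lying both in a subspace and in its complement. It follows that the v_λ generate
the whole space, that the orbit of v_λ under one algebra is simple, and that this orbit consists of
all highest weight vectors of the corresponding weight for the other algebra. Hence the commutants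
of the two actions commute with each other, and the density theorem identifies each commutant with
the image of the other action. The orbits are the modules `Irr` (`exists_irr_map`), their tensor
products are simple by Burnside's theorem, and orthogonality for different λ together with
generation gives the decomposition (`exists_equiv`). -/

noncomputable section

namespace SkewHowe

/-! ### Creation, annihilation and diagonal operators for a basis -/

section clifford

variable {κ X : Type} [AddCommGroup X] [Module ℂ X] (b : Module.Basis κ ℂ X)

/-- Left multiplication by the basis vector `b k`. -/
def cr (k : κ) : Module.End ℂ (ExteriorAlgebra ℂ X) :=
  LinearMap.mulLeft ℂ (ExteriorAlgebra.ι ℂ (b k))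

/-- Contraction with the dual basis vector of `b k`. -/
def an (k : κ) : Module.End ℂ (ExteriorAlgebra ℂ X) :=
  CliffordAlgebra.contractLeft (Q := (0 : QuadraticForm ℂ X)) (b.coord k)

/-- The diagonal operator `b k ↦ q ^ w k • b k`, extended multiplicatively. -/
def dg (q : ℂ) (w : κ → ℤ) : Module.End ℂ (ExteriorAlgebra ℂ X) :=
  (ExteriorAlgebra.map (b.constr ℂ fun k => q ^ w k • b k)).toLinearMap

theorem cr_apply (k : κ) (x : ExteriorAlgebra ℂ X) : cr b k x = ExteriorAlgebra.ι ℂ (b k) * x := rfl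

theorem an_ι_mul (k : κ) (v : X) (x : ExteriorAlgebra ℂ X) :
    an b k (ExteriorAlgebra.ι ℂ v * x) =
      b.repr v k • x - ExteriorAlgebra.ι ℂ v * an b k x :=
  CliffordAlgebra.contractLeft_ι_mul (Q := (0 : QuadraticForm ℂ X)) (d := b.coord k) v x

theorem an_algebraMap (k : κ) (z : ℂ) : an b k (algebraMap ℂ _ z) = 0 :=
  CliffordAlgebra.contractLeft_algebraMap (Q := (0 : QuadraticForm ℂ X)) (b.coord k) z

theorem an_one (k : κ) : an b k 1 = 0 := by
  simpa using an_algebraMap b k 1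

theorem cr_cr (k l : κ) : cr b k * cr b l = -(cr b l * cr b k) := by
  refine LinearMap.ext fun x => ?_
  have := ExteriorAlgebra.ι_add_mul_swap (R := ℂ) (b k) (b l)
  simp only [cr, Module.End.mul_apply, LinearMap.mulLeft_apply, LinearMap.neg_apply, ← mul_assoc]
  rw [eq_neg_of_add_eq_zero_left this, neg_mul]

theorem an_an (k l : κ) : an b k * an b l = -(an b l * an b k) :=
  LinearMap.ext fun _ => CliffordAlgebra.contractLeft_comm _ _ _

theorem an_cr [DecidableEq κ] (k l : κ) :
    an b k * cr b l = (if k = l then 1 else 0) - cr b l * an b k := by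
  refine LinearMap.ext fun x => ?_
  simp only [Module.End.mul_apply, cr_apply, an_ι_mul, LinearMap.sub_apply, Module.Basis.repr_self,
    Finsupp.single_apply, eq_comm (a := l)]
  split_ifs <;> simp

theorem an_cr_self (k : κ) : an b k * cr b k = 1 - cr b k * an b k := by
  classical rw [an_cr, if_pos rfl]

theorem dg_ι_mul (q : ℂ) (w : κ → ℤ) (k : κ) (x : ExteriorAlgebra ℂ X) :
    dg b q w (ExteriorAlgebra.ι ℂ (b k) * x) =
      q ^ w k • (ExteriorAlgebra.ι ℂ (b k) * dg b q w x) := by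
  simp [dg, Module.Basis.constr_basis]

theorem dg_one_vec (q : ℂ) (w : κ → ℤ) : dg b q w 1 = 1 := by simp [dg]

/-- Left multiplications by basis vectors generate the exterior algebra from 1. This is the
induction principle behind nearly all operator identities on exterior algebras below. -/
theorem ext_of_ι_mul {Y : Type*} [AddCommGroup Y] [Module ℂ Y]
    {f g : ExteriorAlgebra ℂ X →ₗ[ℂ] Y} (h1 : f 1 = g 1)
    (h : ∀ k x, f x = g x → f (ExteriorAlgebra.ι ℂ (b k) * x) = g (ExteriorAlgebra.ι ℂ (b k) * x)) :
    f = g := by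
  refine LinearMap.ext fun x => ?_
  induction x using CliffordAlgebra.left_induction (Q := (0 : QuadraticForm ℂ X)) with
  | algebraMap r =>
    have : algebraMap ℂ (ExteriorAlgebra ℂ X) r = r • 1 := Algebra.algebraMap_eq_smul_one r
    exact (congrArg f this).trans ((by rw [map_smul, map_smul, h1] : _ = _).trans
      (congrArg g this).symm)
  | add x y hx hy => rw [map_add, map_add, hx, hy]
  | ι_mul x v hx =>
    change f (ExteriorAlgebra.ι ℂ v * x) = g (ExteriorAlgebra.ι ℂ v * x)
    have : f ∘ₗ LinearMap.mulRight ℂ x ∘ₗ ExteriorAlgebra.ι ℂ =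
        g ∘ₗ LinearMap.mulRight ℂ x ∘ₗ ExteriorAlgebra.ι ℂ := b.ext fun k => h k x hx
    exact LinearMap.congr_fun this v

theorem dg_mul_cr (q : ℂ) (w : κ → ℤ) (k : κ) :
    dg b q w * cr b k = q ^ w k • (cr b k * dg b q w) :=
  LinearMap.ext fun x => dg_ι_mul b q w k x

variable {q : ℂ}

theorem dg_mul_dg (hq : q ≠ 0) (w w' : κ → ℤ) : dg b q w * dg b q w' = dg b q (w + w') := by
  refine ext_of_ι_mul b (by simp [dg_one_vec]) fun k x h => ?_
  rw [Module.End.mul_apply] at h ⊢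
  simp only [dg_ι_mul, map_smul, h, smul_smul, Pi.add_apply, zpow_add₀ hq, mul_comm]

theorem dg_zero : dg b q 0 = 1 :=
  ext_of_ι_mul b (by simp [dg_one_vec]) fun k x h => by rw [dg_ι_mul, h]; simp

theorem an_mul_dg (w : κ → ℤ) (k : κ) :
    an b k * dg b q w = q ^ w k • (dg b q w * an b k) := by
  classical
  refine ext_of_ι_mul b (by simp [dg_one_vec, an_one]) fun l x h => ?_
  simp only [Module.End.mul_apply, LinearMap.smul_apply] at h ⊢
  simp only [dg_ι_mul, map_smul, an_ι_mul, h, map_sub, Module.Basis.repr_self,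
    Finsupp.single_apply, smul_sub, mul_smul_comm, smul_smul, mul_comm (q ^ w l)]
  split_ifs with hl
  · subst hl; simp
  · simp

/-- A diagonal operator supported at one basis vector. -/
theorem dg_single [DecidableEq κ] (k : κ) (m : ℤ) :
    dg b q (Pi.single k m) = 1 + (q ^ m - 1) • (cr b k * an b k) := by
  refine ext_of_ι_mul b (by simp [dg_one_vec, an_one]) fun l x h => ?_
  have h2 : ExteriorAlgebra.ι ℂ (b k) * ExteriorAlgebra.ι ℂ (b l) =
      -(ExteriorAlgebra.ι ℂ (b l) * ExteriorAlgebra.ι ℂ (b k)) :=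
    eq_neg_of_add_eq_zero_left (ExteriorAlgebra.ι_add_mul_swap _ _)
  simp only [dg_ι_mul, h, LinearMap.add_apply, Module.End.one_apply, LinearMap.smul_apply,
    Module.End.mul_apply, an_ι_mul, cr_apply, Module.Basis.repr_self, Finsupp.single_apply, mul_sub,
    mul_add, mul_smul_comm, ← mul_assoc, h2]
  by_cases hl : l = k
  · subst hl
    simp
    module
  · rw [Pi.single_eq_of_ne hl, if_neg hl]
    simp

end clifford

/-! ### The algebra of creation, annihilation and diagonal operators -/

/-- Creation and annihilation operators `c k`, `a k` with the canonical anticommutation relations,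
and diagonal operators `D w`, which are to be thought of as `q ^ ∑ w k • c k * a k`. -/
structure Fermi (q : ℂ) {κ A : Type*} [DecidableEq κ] [Ring A] [Algebra ℂ A] (c a : κ → A)
    (D : (κ → ℤ) → A) : Prop where
  ne_zero : q ≠ 0
  cr_cr (k l) : c k * c l = -(c l * c k)
  an_an (k l) : a k * a l = -(a l * a k)
  an_cr (k l) : a k * c l = (if k = l then 1 else 0) - c l * a k
  dg_zero : D 0 = 1
  dg_mul_dg (w w') : D w * D w' = D (w + w')
  dg_mul_cr (w k) : D w * c k = q ^ w k • (c k * D w)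
  an_mul_dg (w k) : a k * D w = q ^ w k • (D w * a k)
  dg_single (k m) : D (Pi.single k m) = 1 + (q ^ m - 1) • (c k * a k)

theorem fermi {κ X : Type} [DecidableEq κ] [AddCommGroup X] [Module ℂ X]
    (b : Module.Basis κ ℂ X) {q : ℂ} (hq : q ≠ 0) : Fermi q (cr b) (an b) (dg b q) :=
  ⟨hq, cr_cr b, an_an b, an_cr b, dg_zero b, dg_mul_dg b hq, dg_mul_cr b q, an_mul_dg b,
    dg_single b⟩

namespace Fermi

variable {q : ℂ} {κ A : Type*} [DecidableEq κ] [Ring A] [Algebra ℂ A] {c a : κ → A}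
  {D : (κ → ℤ) → A} (S : Fermi q c a D)

/-- Inverting q amounts to negating all weights. With φ the transposition of the grid, this
exchanges `raiseRow` and `raiseCol`, because `rowPre` and `colPre` carry opposite signs. Every
statement about rows thus yields one about columns. -/
theorem flip {κ' : Type*} [DecidableEq κ'] (S : Fermi q c a D) (φ : κ' ≃ κ) :
    Fermi q⁻¹ (fun k => c (φ k)) (fun k => a (φ k)) fun w => D fun k => -w (φ.symm k) where
  ne_zero := inv_ne_zero S.ne_zero
  cr_cr k l := S.cr_cr _ _
  an_an k l := S.an_an _ _
  an_cr k l := by simp [S.an_cr]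
  dg_zero := by rw [← S.dg_zero]; congr 1
  dg_mul_dg w w' := by
    rw [S.dg_mul_dg]; congr 1; funext k; simp; ring
  dg_mul_cr w k := by simp [S.dg_mul_cr]
  an_mul_dg w k := by simp [S.an_mul_dg]
  dg_single k m := by
    rw [inv_zpow, ← zpow_neg, ← S.dg_single]
    congr 1; funext l
    by_cases h : l = φ k
    · subst h; simp
    · rw [Pi.single_eq_of_ne h, Pi.single_eq_of_ne (by simpa [Equiv.symm_apply_eq] using h), neg_zero]

theorem an_cr_self (S : Fermi q c a D) (k : κ) : a k * c k = 1 - c k * a k := by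
  rw [S.an_cr, if_pos rfl]

theorem an_cr_ne (S : Fermi q c a D) {k l : κ} (h : k ≠ l) : a k * c l = -(c l * a k) := by
  rw [S.an_cr, if_neg h, zero_sub]

theorem _root_.SkewHowe.eq_zero_of_eq_neg {x : A} (h : x = -x) : x = 0 := by
  have h2 : (2 : ℂ) • x = 0 := by rw [two_smul]; nth_rw 1 [h]; exact neg_add_cancel x
  exact (smul_eq_zero_iff_right two_ne_zero).1 h2

theorem cr_sq (S : Fermi q c a D) (k : κ) : c k * c k = 0 := eq_zero_of_eq_neg (S.cr_cr k k)

theorem an_sq (S : Fermi q c a D) (k : κ) : a k * a k = 0 := eq_zero_of_eq_neg (S.an_an k k)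

theorem dg_mul_an (S : Fermi q c a D) (w : κ → ℤ) (k : κ) :
    D w * a k = q ^ (-w k) • (a k * D w) := by
  rw [S.an_mul_dg, smul_smul, ← zpow_add₀ S.ne_zero, neg_add_cancel, zpow_zero, one_smul]

theorem dg_eq_mul_single (S : Fermi q c a D) {w w' : κ → ℤ} (k : κ) (h : ∀ l ≠ k, w l = w' l) :
    D w = D w' * D (Pi.single k (w k - w' k)) := by
  rw [S.dg_mul_dg]
  congr 1
  funext l
  by_cases hl : l = k
  · subst hl; simp
  · simp [hl, h l hl]

/-- Behind a creation operator the weight of its index is irrelevant. -/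
theorem cr_mul_dg_congr (S : Fermi q c a D) {w w' : κ → ℤ} (k : κ) (h : ∀ l ≠ k, w l = w' l) :
    c k * D w = c k * D w' := by
  rw [S.dg_eq_mul_single k h, S.dg_mul_dg, add_comm, ← S.dg_mul_dg, S.dg_single, ← mul_assoc,
    mul_add, mul_smul_comm, ← mul_assoc, S.cr_sq]
  simp

theorem dg_mul_an_congr (S : Fermi q c a D) {w w' : κ → ℤ} (k : κ) (h : ∀ l ≠ k, w l = w' l) :
    D w * a k = D w' * a k := by
  rw [S.dg_eq_mul_single k h, S.dg_single, mul_assoc, add_mul, smul_mul_assoc, mul_assoc, S.an_sq]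
  simp

theorem dg_mul_cr_congr (S : Fermi q c a D) {w w' : κ → ℤ} (k : κ) (h : ∀ l ≠ k, w l = w' l) :
    D w * c k = q ^ (w k - w' k) • (D w' * c k) := by
  rw [S.dg_mul_cr, S.dg_mul_cr, S.cr_mul_dg_congr k h, smul_smul, ← zpow_add₀ S.ne_zero,
    sub_add_cancel]

/-- The product `c k * a l`, which moves a particle from `l` to `k`. -/
theorem dg_mul_mv (S : Fermi q c a D) (w : κ → ℤ) (k l : κ) :
    D w * (c k * a l) = q ^ (w k - w l) • (c k * a l * D w) := by
  rw [← mul_assoc, S.dg_mul_cr, smul_mul_assoc, mul_assoc, S.dg_mul_an, mul_smul_comm,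
    smul_smul, ← zpow_add₀ S.ne_zero, mul_assoc, sub_eq_add_neg]

theorem mv_mul_dg (S : Fermi q c a D) (w : κ → ℤ) (k l : κ) :
    c k * a l * D w = q ^ (w l - w k) • (D w * (c k * a l)) := by
  rw [S.dg_mul_mv, smul_smul, ← zpow_add₀ S.ne_zero]; simp

theorem commute_dg_cr (S : Fermi q c a D) {w : κ → ℤ} {k : κ} (h : w k = 0) :
    Commute (D w) (c k) := by
  rw [Commute, SemiconjBy, S.dg_mul_cr, h, zpow_zero, one_smul]

theorem commute_dg_an (S : Fermi q c a D) {w : κ → ℤ} {k : κ} (h : w k = 0) :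
    Commute (D w) (a k) := by
  rw [Commute, SemiconjBy, S.dg_mul_an, h, neg_zero, zpow_zero, one_smul]

theorem commute_dg_mv (S : Fermi q c a D) {w : κ → ℤ} {k l : κ} (h : w k = w l) :
    Commute (D w) (c k * a l) := by
  rw [Commute, SemiconjBy, S.dg_mul_mv, h, sub_self, zpow_zero, one_smul]

theorem commute_dg_dg (S : Fermi q c a D) (w w' : κ → ℤ) : Commute (D w) (D w') := by
  rw [Commute, SemiconjBy, S.dg_mul_dg, S.dg_mul_dg, add_comm]

theorem commute_mv_cr (S : Fermi q c a D) {k l m : κ} (h : l ≠ m) :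
    Commute (c k * a l) (c m) := by
  rw [Commute, SemiconjBy, mul_assoc, S.an_cr_ne h, mul_neg, ← mul_assoc, S.cr_cr k m]
  simp [mul_assoc]

theorem commute_mv_an (S : Fermi q c a D) {k l m : κ} (h : k ≠ m) : Commute (c k * a l) (a m) := by
  rw [Commute, SemiconjBy, mul_assoc, S.an_an l m, mul_neg, ← mul_assoc, ← mul_assoc,
    S.an_cr_ne h.symm]
  simp

theorem commute_mv_mv (S : Fermi q c a D) {k l m n : κ} (h : l ≠ m) (h' : k ≠ n) :
    Commute (c k * a l) (c m * a n) :=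
  (S.commute_mv_cr h).mul_right (S.commute_mv_an h')

theorem commute_dg_mv_dg_mv (S : Fermi q c a D) {w w' : κ → ℤ} {k l m n : κ} (h : w m = w n)
    (h' : w' k = w' l) (h1 : l ≠ m) (h2 : k ≠ n) :
    Commute (D w * (c k * a l)) (D w' * (c m * a n)) :=
  ((S.commute_dg_dg w w').mul_right (S.commute_dg_mv h)).mul_left
    ((S.commute_dg_mv h').symm.mul_right (S.commute_mv_mv h1 h2))

theorem mv_mul_mv_same_left (S : Fermi q c a D) {k l : κ} (h : l ≠ k) (n : κ) :
    c k * a l * (c k * a n) = 0 := by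
  rw [← mul_assoc, (S.commute_mv_cr h).eq, ← mul_assoc, S.cr_sq, zero_mul, zero_mul]

theorem mv_mul_mv_same_right (S : Fermi q c a D) {k l : κ} (h : k ≠ l) (n : κ) :
    c n * a l * (c k * a l) = 0 := by
  rw [mul_assoc, ← mul_assoc (a l), S.an_cr_ne h.symm, neg_mul, mul_assoc, S.an_sq]
  simp

/-- The part of the commutation of a raising operator for rows with one for columns which concerns
four cells `k₁, k₂` (first row) and `k₃, k₄` (second row). -/
theorem block_comm (S : Fermi q c a D) {k₁ k₂ k₃ k₄ : κ} (h12 : k₁ ≠ k₂) (h13 : k₁ ≠ k₃)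
    (h14 : k₁ ≠ k₄) (h23 : k₂ ≠ k₃) :
    c k₁ * a k₃ * (D (Pi.single k₁ (-1)) * D (Pi.single k₂ 1) * (c k₃ * a k₄)) -
      (D (Pi.single k₁ (-1)) * D (Pi.single k₂ 1) * (c k₃ * a k₄)) * (c k₁ * a k₃) +
    ((D (Pi.single k₁ 1) * D (Pi.single k₃ (-1)) * (c k₂ * a k₄)) * (c k₁ * a k₂) -
      c k₁ * a k₂ * (D (Pi.single k₁ 1) * D (Pi.single k₃ (-1)) * (c k₂ * a k₄))) = 0 := by
  have hq := S.ne_zero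
  have e11 := S.an_cr_self k₁
  have e22 := S.an_cr_self k₂
  have e33 := S.an_cr_self k₃
  have e12 := S.an_cr_ne h12
  have e21 := S.an_cr_ne h12.symm
  have e13 := S.an_cr_ne h13
  have e31 := S.an_cr_ne h13.symm
  have e23 := S.an_cr_ne h23
  have e32 := S.an_cr_ne h23.symm
  have e41 := S.an_cr_ne h14.symm
  have c21 := S.cr_cr k₂ k₁
  have c31 := S.cr_cr k₃ k₁
  have c32 := S.cr_cr k₃ k₂
  have a21 := S.an_an k₂ k₁
  have a31 := S.an_an k₃ k₁
  have a32 := S.an_an k₃ k₂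
  have a42 := S.an_an k₄ k₂
  have a43 := S.an_an k₄ k₃
  have p1 := S.cr_sq k₁
  -- The diagonal factors live on the four cells, so they are polynomials in c and a. After this the
  -- identity is a normal ordering computation; `as` extends each exchange rule to products nested
  -- to the right.
  simp only [S.dg_single]
  have as {x y z : A} (h : x * y = z) (u : A) : x * (y * u) = z * u := by rw [← mul_assoc, h]
  simp only [mul_add, add_mul, mul_sub, sub_mul, mul_one, one_mul, neg_mul, mul_neg, mul_assoc,
    smul_mul_assoc, mul_smul_comm, smul_neg, smul_sub, smul_add, zero_mul, smul_zero, a42, a43,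
    as e11, as e22, as e33, as e12, as e21, as e13, as e31, as e23, as e32, as e41,
    as c21, as c31, as c32, as a21, as a31, as a32, as p1, sub_zero, neg_zero, add_zero, neg_neg]
  match_scalars <;> field_simp <;> ring

/-- The analogue of `block_comm` for a raising and a lowering operator. -/
theorem block_comm' (S : Fermi q c a D) {k₁ k₂ k₃ k₄ : κ} (h12 : k₁ ≠ k₂) (h13 : k₁ ≠ k₃)
    (h14 : k₁ ≠ k₄) (h23 : k₂ ≠ k₃) (h24 : k₂ ≠ k₄) (h34 : k₃ ≠ k₄) :
    c k₁ * a k₃ * (c k₂ * a k₁) - c k₂ * a k₁ * (c k₁ * a k₃) +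
    ((D (Pi.single k₁ 1) * D (Pi.single k₃ (-1)) * (c k₂ * a k₄)) *
        (D (Pi.single k₁ (-1)) * D (Pi.single k₂ 1) * (c k₄ * a k₃)) -
      (D (Pi.single k₁ (-1)) * D (Pi.single k₂ 1) * (c k₄ * a k₃)) *
        (D (Pi.single k₁ 1) * D (Pi.single k₃ (-1)) * (c k₂ * a k₄))) = 0 := by
  have hq := S.ne_zero
  have mv_dg := S.mv_mul_dg
  -- In either product the diagonal factors disappear: those at k₁ are inverse to each other, and
  -- those at k₂ and k₃ are absorbed by c k₂ and a k₃, with powers of q that cancel.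
  have e1 : D (Pi.single k₁ 1) * D (Pi.single k₃ (-1)) * (c k₂ * a k₄) *
      (D (Pi.single k₁ (-1)) * D (Pi.single k₂ 1) * (c k₄ * a k₃)) =
      c k₂ * a k₄ * (c k₄ * a k₃) := by
    rw [S.dg_mul_dg, S.dg_mul_dg, mul_assoc (D _), ← mul_assoc (c k₂ * a k₄), mv_dg, smul_mul_assoc,
      mul_smul_comm, mul_assoc (D _), ← mul_assoc (D _) (D _), S.dg_mul_dg, ← mul_assoc (D _),
      ← mul_assoc (D _), S.dg_mul_cr_congr (w' := Pi.single k₃ (-1)) k₂, smul_mul_assoc,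
      smul_mul_assoc, smul_smul, ← zpow_add₀ hq, mul_assoc (D _), (S.commute_dg_mv _).eq,
      mul_assoc _ (D _), ← mul_assoc (D _), S.dg_mul_cr, smul_mul_assoc, mul_assoc (c k₄),
      S.dg_mul_an_congr (w' := 0) k₃, S.dg_zero, one_mul]
    · simp [h23, h12.symm, h14.symm, h24.symm, h34.symm]
    · intro l hl; simp [hl]
    · simp [h23, h34.symm]
    · intro l hl
      by_cases h : l = k₁
      · subst h; simp [h12, h13]
      · simp [hl, h]
  have e2 : D (Pi.single k₁ (-1)) * D (Pi.single k₂ 1) * (c k₄ * a k₃) *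
      (D (Pi.single k₁ 1) * D (Pi.single k₃ (-1)) * (c k₂ * a k₄)) =
      c k₄ * a k₃ * (c k₂ * a k₄) := by
    rw [S.dg_mul_dg, S.dg_mul_dg, mul_assoc (D _), ← mul_assoc (c k₄ * a k₃), mv_dg, smul_mul_assoc,
      mul_smul_comm, mul_assoc (D _), ← mul_assoc (D _) (D _), S.dg_mul_dg,
      ← mul_assoc (D _), ← mul_assoc (D _), S.dg_mul_cr, smul_mul_assoc, mul_assoc (c k₄),
      S.dg_mul_an_congr (w' := Pi.single k₂ 1) k₃, S.dg_mul_an, mul_smul_comm, smul_mul_assoc,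
      smul_mul_assoc, mul_assoc (c k₄), mul_assoc (a k₃), ← mul_assoc (D _),
      S.dg_mul_cr_congr (w' := 0) k₂, S.dg_zero, one_mul, smul_mul_assoc, mul_smul_comm,
      mul_smul_comm, smul_smul, smul_smul, smul_smul, mul_assoc (c k₄)]
    · simp [h13.symm, h14.symm, h23.symm, h24.symm, h34.symm, hq]
    · intro l hl; simp [hl]
    · intro l hl
      by_cases h : l = k₁
      · subst h; simp [h12, h13]
      · simp [hl, h]
  rw [e1, e2]
  have a1 := S.an_cr_self k₁
  have a4 := S.an_cr_self k₄
  -- The first commutator is -c k₂ a k₃, with k₁ as intermediate site; the second is +c k₂ a k₃,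
  -- with k₄ as intermediate site.
  have e3 : c k₁ * a k₃ * (c k₂ * a k₁) = c k₂ * (a k₁ * c k₁) * a k₃ - c k₂ * a k₃ := by
    rw [← mul_assoc, (S.commute_mv_cr h23.symm).eq, mul_assoc, mul_assoc, S.an_an k₃ k₁, a1]
    noncomm_ring
  have e4 : c k₄ * a k₃ * (c k₂ * a k₄) = c k₂ * (a k₄ * c k₄) * a k₃ - c k₂ * a k₃ := by
    rw [← mul_assoc, (S.commute_mv_cr h23.symm).eq, mul_assoc, mul_assoc, S.an_an k₃ k₄, a4]
    noncomm_ring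
  rw [e3, e4]
  noncomm_ring

/-- A hop that does not empty the site n commutes with c n, so only diagonal factors contribute: w l
- w k from moving D w past the hop, u n from moving D u past c n. -/
theorem dg_mv_mul_dg_cr (S : Fermi q c a D) (u w : κ → ℤ) {k l n : κ} (h : l ≠ n) :
    D u * (c k * a l) * (D w * c n) =
      q ^ (w l - w k + u n) • (D w * c n * (D u * (c k * a l))) := by
  rw [mul_assoc, ← mul_assoc (c k * a l), S.mv_mul_dg, smul_mul_assoc, mul_smul_comm, mul_assoc,
    (S.commute_mv_cr h).eq, ← mul_assoc (D u), (S.commute_dg_dg u w).eq, mul_assoc,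
    ← mul_assoc (D u), S.dg_mul_cr, smul_mul_assoc, mul_smul_comm, smul_smul, ← zpow_add₀ S.ne_zero,
    mul_assoc (D w) (c n), mul_assoc (c n) (D u)]

/-- When the hop empties the very site being filled, normal ordering leaves a creation operator at
k. The scalar z is free because the cases z = q and z = q⁻¹ are both needed: it is fixed by the hops
elsewhere, which have to drop out of the same q-commutator. -/
theorem dg_mv_mul_dg_cr_sub (S : Fermi q c a D) {u w : κ → ℤ} {k l : κ} (hu : u l = 0) (z : ℂ) :
    D u * (c k * a l) * (D w * c l) - z • (D w * c l * (D u * (c k * a l))) =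
      D (u + w) * c k * (q ^ (w l - w k) • 1 + (z - q ^ (w l - w k)) • (c l * a l)) := by
  have e1 : D u * (c k * a l) * (D w * c l) =
      q ^ (w l - w k) • (D (u + w) * (c k * (a l * c l))) := by
    rw [mul_assoc, ← mul_assoc (c k * a l), S.mv_mul_dg, smul_mul_assoc, mul_smul_comm, mul_assoc,
      ← mul_assoc (D u), S.dg_mul_dg, mul_assoc (c k)]
  have e2 : D w * c l * (D u * (c k * a l)) = -(D (u + w) * (c k * (c l * a l))) := by
    rw [mul_assoc, ← mul_assoc (c l), ← (S.commute_dg_cr hu).eq, mul_assoc (D u), ← mul_assoc (D w),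
      S.dg_mul_dg, ← mul_assoc (c l), S.cr_cr l k, add_comm]
    simp [mul_assoc]
  rw [e1, e2, S.an_cr_self]
  simp only [mul_sub, mul_add, smul_sub, mul_one, sub_smul, mul_smul_comm, smul_neg, mul_assoc]
  abel

end Fermi

/-! ### Raising operators on the grid `ℕ × ℕ` -/

/-- The weight of `k_i` on the columns before `r`. -/
def rowPre (i r : ℕ) (k : ℕ × ℕ) : ℤ :=
  if k.2 < r then (if k.1 = i then 1 else 0) - (if k.1 = i + 1 then 1 else 0) else 0

/-- The weight of `k_r⁻¹` on the rows before `i`. -/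
def colPre (r i : ℕ) (k : ℕ × ℕ) : ℤ :=
  if k.1 < i then (if k.2 = r + 1 then 1 else 0) - (if k.2 = r then 1 else 0) else 0

theorem rowPre_succ (i r : ℕ) :
    rowPre i (r + 1) = rowPre i r + (Pi.single (i, r) 1 + Pi.single (i + 1, r) (-1)) := by
  funext ⟨x, y⟩
  simp only [rowPre, Pi.add_apply, Pi.single_apply, Prod.mk.injEq]
  split_ifs <;> omega

theorem colPre_succ (r i : ℕ) :
    colPre r (i + 1) = colPre r i + (Pi.single (i, r) (-1) + Pi.single (i, r + 1) 1) := by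
  funext ⟨x, y⟩
  simp only [colPre, Pi.add_apply, Pi.single_apply, Prod.mk.injEq]
  split_ifs <;> omega

section

variable {A : Type*} [Ring A] [Algebra ℂ A] (c a : ℕ × ℕ → A) (D : (ℕ × ℕ → ℤ) → A)

/-- The operator of `e_i` on the first `M` columns. -/
def raiseRow (M i : ℕ) : A :=
  ∑ r ∈ Finset.range M, D (rowPre i r) * (c (i, r) * a (i + 1, r))

/-- The operator of `e_r k_r⁻¹`, up to a scalar, on the first `N` rows. -/
def raiseCol (N r : ℕ) : A :=
  ∑ i ∈ Finset.range N, D (colPre r i) * (c (i, r) * a (i, r + 1))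

/-- The operator of `f_r` on the first `N` rows. -/
def lowerCol (N r : ℕ) : A :=
  ∑ i ∈ Finset.range N, D (colPre r i) * (c (i, r + 1) * a (i, r))

end

theorem mul_comm_add_mul_comm {A : Type*} [Ring A] {p z x y x' y' : A} (h : Commute p z)
    (h1 : Commute x z) (h2 : Commute y p) (h3 : Commute x' z) (h4 : Commute y' p) :
    p * x * (z * y) - z * y * (p * x) + (p * x' * (z * y') - z * y' * (p * x')) =
      p * z * (x * y - y * x + (x' * y' - y' * x')) := by
  have key {p z x y : A} (h : Commute x z) : p * x * (z * y) = p * z * (x * y) := by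
    rw [mul_assoc, ← mul_assoc x, h.eq]; noncomm_ring
  rw [key h1, key h2, key h3, key h4, ← h.eq]
  noncomm_ring

/-- Meant for sums of row hops and of column hops: only two pairs of summands in the common 2 × 2
block have a nonzero commutator, and these two commutators cancel. -/
theorem commute_sum_of_pair {A ι ι' : Type*} [Ring A] [DecidableEq ι] [DecidableEq ι']
    (s : Finset ι) (t : Finset ι') (f : ι → A) (g : ι' → A) {i i' : ι} {j j' : ι'}
    (hi : i ∈ s) (hi' : i' ∈ s) (hj : j ∈ t) (hj' : j' ∈ t) (hne : i ≠ i')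
    (h : f i * g j - g j * f i + (f i' * g j' - g j' * f i') = 0)
    (h0 : ∀ x ∈ s, ∀ y ∈ t, ¬(x = i ∧ y = j) → ¬(x = i' ∧ y = j') → Commute (f x) (g y)) :
    Commute (∑ x ∈ s, f x) (∑ y ∈ t, g y) := by
  rw [Commute, SemiconjBy, ← sub_eq_zero, Finset.sum_mul_sum, Finset.sum_mul_sum, Finset.sum_comm,
    ← Finset.sum_sub_distrib]
  simp_rw [← Finset.sum_sub_distrib]
  rw [← Finset.sum_product' (f := fun y x => f x * g y - g y * f x),
    Finset.sum_eq_add (j, i) (j', i') (by simp [hne])]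
  · exact h
  · rintro ⟨y, x⟩ hm ⟨h1, h2⟩
    rw [Finset.mem_product] at hm
    exact sub_eq_zero.2 (h0 x hm.2 y hm.1 (by rintro ⟨rfl, rfl⟩; exact h1 rfl)
      (by rintro ⟨rfl, rfl⟩; exact h2 rfl))
  · intro hm; simp [hi, hj] at hm
  · intro hm; simp [hi', hj'] at hm

namespace Fermi

variable {q : ℂ} {A : Type*} [Ring A] [Algebra ℂ A] {c a : ℕ × ℕ → A}
  {D : (ℕ × ℕ → ℤ) → A}

theorem commute_of_mul_eq_zero (S : Fermi q c a D) {w w' : ℕ × ℕ → ℤ} {k l m n : ℕ × ℕ}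
    (h : c k * a l * (c m * a n) = 0) (h' : c m * a n * (c k * a l) = 0) :
    Commute (D w * (c k * a l)) (D w' * (c m * a n)) := by
  have e (w w' : ℕ × ℕ → ℤ) {k l m n : ℕ × ℕ} (h : c k * a l * (c m * a n) = 0) :
      D w * (c k * a l) * (D w' * (c m * a n)) = 0 := by
    rw [mul_assoc, ← mul_assoc (c k * a l), S.mv_mul_dg, smul_mul_assoc, mul_assoc (D w'), h]
    simp
  rw [Commute, SemiconjBy, e _ _ h, e _ _ h']

/-- The hop in column s and the hop in row j interact only for s in {r, r + 1} and j in {i, i + 1}.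
For (r, i) both create at (i, r), and for (r + 1, i + 1) both annihilate at (i + 1, r + 1), so both
products vanish in these cases. The other two pairs are those of `block_comm`. -/
theorem commute_raiseRow_raiseCol (S : Fermi q c a D) {N M i r : ℕ} (hi : i + 1 < N)
    (hr : r + 1 < M) : Commute (raiseRow c a D M i) (raiseCol c a D N r) := by
  refine commute_sum_of_pair _ _ _ _ (i := r) (i' := r + 1) (j := i + 1) (j' := i)
    (by simp; omega) (by simp; omega) (by simp; omega) (by simp; omega) (by omega) ?_ ?_
  · have hP : Commute (D (rowPre i r)) (D (colPre r i)) := S.commute_dg_dg _ _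
    have B := S.block_comm (k₁ := (i, r)) (k₂ := (i, r + 1)) (k₃ := (i + 1, r))
      (k₄ := (i + 1, r + 1)) (by simp) (by simp) (by simp) (by simp)
    rw [S.dg_mul_dg, S.dg_mul_dg] at B
    rw [rowPre_succ, colPre_succ]
    generalize (Pi.single (i, r) (-1) + Pi.single (i, r + 1) 1 : ℕ × ℕ → ℤ) = w1 at *
    generalize (Pi.single (i, r) 1 + Pi.single (i + 1, r) (-1) : ℕ × ℕ → ℤ) = w2 at *
    have h1 := (S.commute_dg_mv (w := colPre r i) (k := (i, r)) (l := (i + 1, r))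
      (by simp [colPre])).symm
    have h2 := (S.commute_dg_dg w1 _).mul_left ((S.commute_dg_mv (w := rowPre i r)
      (k := (i + 1, r)) (l := (i + 1, r + 1)) (by simp [rowPre])).symm)
    have h3 := (S.commute_dg_dg w2 _).mul_left ((S.commute_dg_mv (w := colPre r i)
      (k := (i, r + 1)) (l := (i + 1, r + 1)) (by simp [colPre])).symm)
    have h4 := (S.commute_dg_mv (w := rowPre i r) (k := (i, r)) (l := (i, r + 1))
      (by simp [rowPre])).symm
    -- Split each prefix weight at index i + 1 or r + 1 into the part outside the block, common to
    -- both pairs, and the part on the block. The common parts commute with everything in the block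
    -- and factor out.
    rw [← S.dg_mul_dg (rowPre i r), ← S.dg_mul_dg (colPre r i), mul_assoc _ (D w1),
      mul_assoc _ (D w2), mul_comm_add_mul_comm hP h1 h2 h3 h4, B, mul_zero]
  · intro s hs j hj h1 h2
    by_cases h3 : s = r ∧ j = i
    · obtain ⟨rfl, rfl⟩ := h3
      exact S.commute_of_mul_eq_zero (S.mv_mul_mv_same_left (by simp) _)
        (S.mv_mul_mv_same_left (by simp) _)
    by_cases h4 : s = r + 1 ∧ j = i + 1
    · obtain ⟨rfl, rfl⟩ := h4
      exact S.commute_of_mul_eq_zero (S.mv_mul_mv_same_right (by simp) _)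
        (S.mv_mul_mv_same_right (by simp) _)
    refine S.commute_dg_mv_dg_mv ?_ ?_ ?_ ?_
    · simp only [rowPre]; split_ifs <;> omega
    · simp only [colPre]; split_ifs <;> omega
    · simp only [ne_eq, Prod.mk.injEq]; omega
    · simp only [ne_eq, Prod.mk.injEq]; omega

/-- As for two raising operators, with the pairs of the block exchanged: now (r, i + 1) and (r + 1,
i) have vanishing products, and (r, i), (r + 1, i + 1) cancel by `block_comm'`. -/
theorem commute_raiseRow_lowerCol (S : Fermi q c a D) {N M i r : ℕ} (hi : i + 1 < N)
    (hr : r + 1 < M) : Commute (raiseRow c a D M i) (lowerCol c a D N r) := by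
  refine commute_sum_of_pair _ _ _ _ (i := r) (i' := r + 1) (j := i) (j' := i + 1)
    (by simp; omega) (by simp; omega) (by simp; omega) (by simp; omega) (by omega) ?_ ?_
  · have hP : Commute (D (rowPre i r)) (D (colPre r i)) := S.commute_dg_dg _ _
    have B := S.block_comm' (k₁ := (i, r)) (k₂ := (i, r + 1)) (k₃ := (i + 1, r))
      (k₄ := (i + 1, r + 1)) (by simp) (by simp) (by simp) (by simp) (by simp) (by simp)
    rw [S.dg_mul_dg, S.dg_mul_dg] at B
    rw [rowPre_succ, colPre_succ]
    generalize (Pi.single (i, r) (-1) + Pi.single (i, r + 1) 1 : ℕ × ℕ → ℤ) = w1 at *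
    generalize (Pi.single (i, r) 1 + Pi.single (i + 1, r) (-1) : ℕ × ℕ → ℤ) = w2 at *
    have h1 := (S.commute_dg_mv (w := colPre r i) (k := (i, r)) (l := (i + 1, r))
      (by simp [colPre])).symm
    have h2 := (S.commute_dg_mv (w := rowPre i r) (k := (i, r + 1)) (l := (i, r))
      (by simp [rowPre])).symm
    have h3 := (S.commute_dg_dg w2 _).mul_left ((S.commute_dg_mv (w := colPre r i)
      (k := (i, r + 1)) (l := (i + 1, r + 1)) (by simp [colPre])).symm)
    have h4 := (S.commute_dg_dg w1 _).mul_left ((S.commute_dg_mv (w := rowPre i r)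
      (k := (i + 1, r + 1)) (l := (i + 1, r)) (by simp [rowPre])).symm)
    rw [← S.dg_mul_dg (rowPre i r), ← S.dg_mul_dg (colPre r i), mul_assoc _ (D w1),
      mul_assoc _ (D w2), mul_comm_add_mul_comm hP h1 h2 h3 h4, B, mul_zero]
  · intro s hs j hj h1 h2
    by_cases h3 : s = r ∧ j = i + 1
    · obtain ⟨rfl, rfl⟩ := h3
      exact S.commute_of_mul_eq_zero (S.mv_mul_mv_same_right (by simp) _)
        (S.mv_mul_mv_same_right (by simp) _)
    by_cases h4 : s = r + 1 ∧ j = i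
    · obtain ⟨rfl, rfl⟩ := h4
      exact S.commute_of_mul_eq_zero (S.mv_mul_mv_same_left (by simp) _)
        (S.mv_mul_mv_same_left (by simp) _)
    refine S.commute_dg_mv_dg_mv ?_ ?_ ?_ ?_
    · simp only [rowPre]; split_ifs <;> omega
    · simp only [colPre]; split_ifs <;> omega
    · simp only [ne_eq, Prod.mk.injEq]; omega
    · simp only [ne_eq, Prod.mk.injEq]; omega

end Fermi

/-! ### Removing a particle from the last row -/

namespace Fermi

variable {q : ℂ} {H : Type*} [AddCommGroup H] [Module ℂ H] {c a : ℕ × ℕ → Module.End ℂ H}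
  {D : (ℕ × ℕ → ℤ) → Module.End ℂ H}

theorem commute_an_raiseRow_term (S : Fermi q c a D) {i r : ℕ} {k : ℕ × ℕ}
    (h : rowPre i r k = 0) (h' : (i, r) ≠ k) :
    Commute (D (rowPre i r) * (c (i, r) * a (i + 1, r))) (a k) :=
  (S.commute_dg_an h).mul_left (S.commute_mv_an h')

theorem commute_an_raiseCol_term (S : Fermi q c a D) {i r : ℕ} {k : ℕ × ℕ}
    (h : colPre r i k = 0) (h' : (i, r) ≠ k) :
    Commute (D (colPre r i) * (c (i, r) * a (i, r + 1))) (a k) :=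
  (S.commute_dg_an h).mul_left (S.commute_mv_an h')

theorem commute_raiseRow_an (S : Fermi q c a D) {M i p s : ℕ} (h : i + 1 < p) :
    Commute (raiseRow c a D M i) (a (p, s)) :=
  Commute.sum_left _ _ _ fun r _ => S.commute_an_raiseRow_term
    (by simp only [rowPre]; split_ifs <;> omega) (by simp; omega)

theorem commute_raiseCol_an (S : Fermi q c a D) {p r s : ℕ} :
    Commute (raiseCol c a D p r) (a (p, s)) :=
  Commute.sum_left _ _ _ fun i hi => S.commute_an_raiseCol_term
    (by simp at hi; simp only [colPre]; split_ifs <;> omega) (by simp at hi; simp; omega)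

theorem apply_comm {T U : Module.End ℂ H} (h : Commute T U) (x : H) : T (U x) = U (T x) :=
  LinearMap.congr_fun h.eq x

/-- Here (p, s) is the last site of row p that may be occupied. A summand fails to commute with a
(p, s) only through its diagonal factor, that is, for i + 1 = p and s < r; such a summand kills both
x and a (p, s) x, because column r of row p is empty. -/
theorem raiseRow_an_apply (S : Fermi q c a D) {M i p s : ℕ} {x : H} (hi : i < p)
    (hs : ∀ r, s < r → r < M → a (p, r) x = 0) (hx : raiseRow c a D M i x = 0) :
    raiseRow c a D M i (a (p, s) x) = 0 := by
  rw [← map_zero (a (p, s)), ← hx, raiseRow, LinearMap.sum_apply, LinearMap.sum_apply, map_sum]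
  refine Finset.sum_congr rfl fun r hr => ?_
  by_cases h : i + 1 = p ∧ s < r
  · obtain ⟨rfl, h⟩ := h
    have h0 := hs r h (by simpa using hr)
    have e : a (i + 1, r) (a (i + 1, s) x) = 0 := by
      have := LinearMap.congr_fun (S.an_an (i + 1, r) (i + 1, s)) x
      simpa [h0] using this
    simp [e, h0]
  · exact apply_comm (S.commute_an_raiseRow_term
      (by simp only [rowPre]; split_ifs <;> omega) (by simp; omega)) x

/-- Only the hop in row p itself can interfere with a (p, s), and only when it creates at (p, s).
That hop takes its particle from (p, s + 1), which is empty. -/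
theorem raiseCol_an_apply (S : Fermi q c a D) {M r p s : ℕ} {x : H} (hr : r + 1 < M)
    (hs : ∀ r, s < r → r < M → a (p, r) x = 0) (hx : raiseCol c a D (p + 1) r x = 0) :
    raiseCol c a D (p + 1) r (a (p, s) x) = 0 := by
  rw [raiseCol, Finset.sum_range_succ, ← raiseCol, LinearMap.add_apply] at hx ⊢
  by_cases h : r = s
  · subst h
    have h0 := hs (r + 1) (by omega) hr
    have e : a (p, r + 1) (a (p, r) x) = 0 := by
      have := LinearMap.congr_fun (S.an_an (p, r + 1) (p, r)) x
      simpa [h0] using this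
    rw [Module.End.mul_apply, Module.End.mul_apply, h0, map_zero, map_zero, add_zero] at hx
    rw [apply_comm S.commute_raiseCol_an, hx]
    simp [e]
  · rw [apply_comm S.commute_raiseCol_an, apply_comm (S.commute_an_raiseCol_term
      (by simp only [colPre]; split_ifs <;> omega) (by simp; omega)), ← map_add, hx, map_zero]

theorem dg_an_apply (S : Fermi q c a D) {w : ℕ × ℕ → ℤ} {m : ℤ} {x : H} (k : ℕ × ℕ)
    (hx : D w x = q ^ m • x) : D w (a k x) = q ^ (m - w k) • a k x := by
  rw [← Module.End.mul_apply, S.dg_mul_an, LinearMap.smul_apply, Module.End.mul_apply, hx, map_smul,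
    smul_smul, ← zpow_add₀ S.ne_zero]
  congr 2; ring

end Fermi

/-! ### Root vectors in the last column -/

/-- The weight of `k_r` on the rows strictly between `i` and `p`. -/
def colSuf (p r i : ℕ) (k : ℕ × ℕ) : ℤ :=
  if i < k.1 ∧ k.1 < p then (if k.2 = r then 1 else 0) - (if k.2 = r + 1 then 1 else 0) else 0

/-- The indicator of the columns before `r` in the row `j`. -/
def rowW (j r : ℕ) (k : ℕ × ℕ) : ℤ := if k.1 = j ∧ k.2 < r then 1 else 0

/-- The indicator of the rows strictly between `j` and `p` in the column `m`. -/
def colAb (j p m : ℕ) (k : ℕ × ℕ) : ℤ := if k.2 = m ∧ j < k.1 ∧ k.1 < p then 1 else 0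

/-- The indicator of the rows before `j` in the column `m`. -/
def colBel (j m : ℕ) (k : ℕ × ℕ) : ℤ := if k.2 = m ∧ k.1 < j then 1 else 0

/-- The operator of `e_r` on the first `p` rows, up to a scalar. -/
def colOp {A : Type*} [Ring A] (c a : ℕ × ℕ → A) (D : (ℕ × ℕ → ℤ) → A) (p r : ℕ) : A :=
  ∑ i ∈ Finset.range p, D (colSuf p r i) * (c (i, r) * a (i, r + 1))

namespace Fermi

section ring

variable {q : ℂ} {A : Type*} [Ring A] [Algebra ℂ A] {c a : ℕ × ℕ → A}
  {D : (ℕ × ℕ → ℤ) → A}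

theorem dg_single_mul_cr (S : Fermi q c a D) (k : ℕ × ℕ) (m : ℤ) :
    D (Pi.single k m) * c k = q ^ m • c k := by
  rw [S.dg_single, add_mul, one_mul, smul_mul_assoc, mul_assoc, S.an_cr_self, mul_sub, mul_one,
    ← mul_assoc, S.cr_sq, zero_mul, sub_zero, sub_smul, one_smul]
  abel

theorem dg_single_mul_an (S : Fermi q c a D) (k : ℕ × ℕ) (m : ℤ) :
    D (Pi.single k m) * a k = a k := by
  rw [S.dg_single, add_mul, one_mul, smul_mul_assoc, mul_assoc, S.an_sq, mul_zero, smul_zero,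
    add_zero]

/-- Multiplying by the full weight of k_r turns diagonal factors on the rows before i into factors
on the rows after i. What is left over at the two sites of the hop is absorbed by a (i, r + 1) and
gives one factor q at c (i, r). -/
theorem colOp_eq (S : Fermi q c a D) (p r : ℕ) :
    colOp c a D p r = q⁻¹ • (D (-colPre r p) * raiseCol c a D p r) := by
  rw [colOp, raiseCol, Finset.mul_sum, Finset.smul_sum]
  refine Finset.sum_congr rfl fun i hi => ?_
  have hi : i < p := by simpa using hi
  have e : -colPre r p + colPre r i =
      colSuf p r i + Pi.single (i, r + 1) (-1) + Pi.single (i, r) 1 := by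
    funext ⟨x, y⟩
    simp only [colPre, colSuf, Pi.add_apply, Pi.neg_apply, Pi.single_apply, Prod.mk.injEq]
    split_ifs <;> omega
  rw [← mul_assoc (D (-colPre r p)), S.dg_mul_dg, e, ← S.dg_mul_dg, mul_assoc (D (_ + _)),
    ← mul_assoc (D (Pi.single _ 1)),
    S.dg_single_mul_cr, zpow_one, smul_mul_assoc, mul_smul_comm, inv_smul_smul₀ S.ne_zero,
    ← S.dg_mul_dg, mul_assoc, ← mul_assoc (D (Pi.single _ _)), (S.commute_dg_cr (by simp)).eq,
    mul_assoc (c _), S.dg_single_mul_an]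

theorem commute_raiseRow_colOp (S : Fermi q c a D) {p m j r : ℕ} (hj : j + 1 < p) (hr : r < m) :
    Commute (raiseRow c a D (m + 1) j) (colOp c a D p r) := by
  rw [S.colOp_eq]
  refine Commute.smul_right (Commute.mul_right ?_
    (S.commute_raiseRow_raiseCol hj (Nat.succ_lt_succ hr))) _
  refine Commute.sum_left _ _ _ fun s _ => (S.commute_dg_dg _ _).mul_left (S.commute_dg_mv ?_).symm
  simp only [colPre, Pi.neg_apply]
  split_ifs <;> omega

/-- Root vectors built from a family `ζ` by a `q`-commutator with `e_j`. -/
theorem root_step (S : Fermi q c a D) {p m j : ℕ} (hj : j + 1 < p) :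
    raiseRow c a D (m + 1) j * (D (rowW (j + 1) m + colAb (j + 1) p m) * c (j + 1, m)) -
      q • (D (rowW (j + 1) m + colAb (j + 1) p m) * c (j + 1, m) * raiseRow c a D (m + 1) j) =
      D (rowW j m + colAb j p m) * c (j, m) := by
  set W := rowW (j + 1) m + colAb (j + 1) p m with hW
  -- The hops in columns s < m satisfy the exchange with factor exactly q and drop out. In column m
  -- the correction term is the diagonal operator supported at (j + 1, m), which extends `colAb` by
  -- one row.
  rw [raiseRow, Finset.sum_mul, Finset.mul_sum, Finset.smul_sum, ← Finset.sum_sub_distrib,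
    Finset.sum_range_succ, Finset.sum_eq_zero, zero_add,
    S.dg_mv_mul_dg_cr_sub (by simp [rowPre])]
  · have e1 : W (j + 1, m) - W (j, m) = 0 := by simp [hW, rowW, colAb]
    have e2 : (1 : A) + (q - 1) • (c (j + 1, m) * a (j + 1, m)) =
        D (Pi.single (j + 1, m) 1) := by rw [S.dg_single, zpow_one]
    rw [e1, zpow_zero, one_smul, e2, mul_assoc, ← (S.commute_dg_cr (by simp)).eq, ← mul_assoc,
      S.dg_mul_dg]
    congr 2
    funext ⟨x, y⟩
    simp only [hW, rowW, colAb, rowPre, Pi.add_apply, Pi.single_apply, Prod.mk.injEq]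
    split_ifs <;> omega
  · intro s hs
    have hs : s < m := by simpa using hs
    have e : W (j + 1, s) - W (j, s) + rowPre j s (j + 1, m) = 1 := by
      simp [hW, rowW, colAb, rowPre, hs]; omega
    rw [S.dg_mv_mul_dg_cr _ _ (by simp; omega), e, zpow_one, sub_self]

/-- Rows before p exchange with factor exactly q⁻¹ and drop out; the hop inside row p moves the
created particle one column to the left. This gives the recursion in r for the root vectors built
from `rowW`. -/
theorem root_base (S : Fermi q c a D) {p r : ℕ} :
    colOp c a D (p + 1) r * (D (rowW p (r + 1)) * c (p, r + 1)) -
      q⁻¹ • (D (rowW p (r + 1)) * c (p, r + 1) * colOp c a D (p + 1) r) =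
      D (rowW p r) * c (p, r) := by
  rw [colOp, Finset.sum_mul, Finset.mul_sum, Finset.smul_sum, ← Finset.sum_sub_distrib,
    Finset.sum_range_succ, Finset.sum_eq_zero, zero_add,
    S.dg_mv_mul_dg_cr_sub (by simp [colSuf])]
  · have e1 : rowW p (r + 1) (p, r + 1) - rowW p (r + 1) (p, r) = -1 := by simp [rowW]
    have e2 : colSuf (p + 1) r p + rowW p (r + 1) = rowW p r + Pi.single (p, r) 1 := by
      funext ⟨x, y⟩
      simp only [rowW, colSuf, Pi.add_apply, Pi.single_apply, Prod.mk.injEq]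
      split_ifs <;> omega
    rw [e1, zpow_neg_one, sub_self, zero_smul, add_zero, e2, ← S.dg_mul_dg, mul_assoc (D _),
      S.dg_single_mul_cr]
    simp [S.ne_zero]
  · intro i hi
    have hi : i < p := by simpa using hi
    have e : rowW p (r + 1) (i, r + 1) - rowW p (r + 1) (i, r) + colSuf (p + 1) r i (p, r + 1) =
        -1 := by
      simp [rowW, colSuf, hi]; omega
    rw [S.dg_mv_mul_dg_cr _ _ (by simp; omega), e, zpow_neg_one, sub_self]

/-- The annihilation operators of the column `m`, with a diagonal twist. -/
def twist (q : ℂ) (a : ℕ × ℕ → A) (D : (ℕ × ℕ → ℤ) → A) (p m j : ℕ) : A :=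
  q ^ (2 * j) • (D (-(colBel j m + colBel j m) - (rowW j m + colAb j p m)) * a (j, m))

/-- The diagonal operators whose differences are the products of `twist` with root vectors. -/
def heightOp (q : ℂ) (D : (ℕ × ℕ → ℤ) → A) (m j : ℕ) : A :=
  q ^ (2 * j) • D (-(colBel j m + colBel j m))

theorem twist_mul (S : Fermi q c a D) {p m j : ℕ} (w : ℕ × ℕ → ℤ) (k : ℕ × ℕ) (hw : w (j, m) = 0) :
    twist q a D p m j * (D (w + (rowW j m + colAb j p m)) * c k) =
      heightOp q D m j * (D w * (a (j, m) * c k)) := by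
  have h0 : (w + (rowW j m + colAb j p m)) (j, m) = 0 := by simp [rowW, colAb, hw]
  rw [twist, heightOp, smul_mul_assoc, smul_mul_assoc, mul_assoc, ← mul_assoc (a _),
    ← (S.commute_dg_an h0).eq, mul_assoc (D _) (a _), ← mul_assoc (D _) (D _), S.dg_mul_dg,
    ← mul_assoc (D _) (D _), S.dg_mul_dg]
  congr 3
  abel

/-- The twist cancels the diagonal factors of the root vector and leaves a_{j,m} c_{j,m} = 1 -
c_{j,m} a_{j,m}, the projection to a vacant site. On the other side, q² D(-2 at (j, m)) - 1 is q² -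
1 times the same projection. -/
theorem heightOp_succ (S : Fermi q c a D) {p m j : ℕ} :
    (q ^ 2 - 1) • (twist q a D p m j * (D (rowW j m + colAb j p m) * c (j, m))) =
      heightOp q D m (j + 1) - heightOp q D m j := by
  have := S.twist_mul (p := p) (m := m) (j := j) 0 (j, m) rfl
  rw [zero_add, S.dg_zero, one_mul] at this
  have e : -(colBel (j + 1) m + colBel (j + 1) m) =
      -(colBel j m + colBel j m) + Pi.single (j, m) (-2) := by
    funext ⟨x, y⟩
    simp only [colBel, Pi.add_apply, Pi.neg_apply, Pi.single_apply, Prod.mk.injEq]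
    split_ifs <;> omega
  rw [this, heightOp, heightOp, e, ← S.dg_mul_dg, S.dg_single, S.an_cr_self]
  simp only [smul_mul_assoc, mul_sub, mul_add, mul_one, mul_smul_comm]
  have hq := S.ne_zero
  match_scalars
  · ring
  · rw [zpow_neg, zpow_ofNat]
    field_simp
    ring

theorem heightOp_zero (S : Fermi q c a D) (m : ℕ) : heightOp q D m 0 = 1 := by
  have : (-(colBel 0 m + colBel 0 m) : ℕ × ℕ → ℤ) = 0 := by funext x; simp [colBel]
  rw [heightOp, this, S.dg_zero]; simp

/-- The sum telescopes. On a vector with μ particles in the first p rows of column m the right-hand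
side is q^(2(p - μ)) - 1, which measures the number of vacancies. -/
theorem sum_heightOp (S : Fermi q c a D) (p m : ℕ) :
    (q ^ 2 - 1) • ∑ j ∈ Finset.range p,
      twist q a D p m j * (D (rowW j m + colAb j p m) * c (j, m)) = heightOp q D m p - 1 := by
  rw [Finset.smul_sum, Finset.sum_congr rfl fun j _ => S.heightOp_succ, Finset.sum_range_sub,
    S.heightOp_zero]

theorem commute_twist_colOp (S : Fermi q c a D) {p m j r : ℕ} (hr : r + 1 < m) :
    Commute (twist q a D p m j) (colOp c a D p r) := by
  refine Commute.smul_left (Commute.sum_right _ _ _ fun i _ => Commute.mul_left ?_ ?_) _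
  · refine (S.commute_dg_dg _ _).mul_right (S.commute_dg_mv ?_)
    simp only [colBel, rowW, colAb, Pi.sub_apply, Pi.neg_apply, Pi.add_apply]
    split_ifs <;> omega
  · refine ((S.commute_dg_an ?_).mul_left (S.commute_mv_an (by simp; omega))).symm
    simp only [colSuf]; split_ifs <;> omega

theorem twist_term_lt (S : Fermi q c a D) {p m j i : ℕ} (hj : j < p) (h : i < j) :
    D (colSuf p m i) * (c (i, m) * a (i, m + 1)) *
      (D (rowW j (m + 1) + colAb j p (m + 1)) * c (j, m + 1)) =
    q⁻¹ • (D (rowW j (m + 1) + colAb j p (m + 1)) * c (j, m + 1) *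
      (D (colSuf p m i) * (c (i, m) * a (i, m + 1)))) := by
  rw [S.dg_mv_mul_dg_cr _ _ (by simp; omega), ← zpow_neg_one]
  congr 2
  simp only [rowW, colAb, colSuf, Pi.add_apply]
  split_ifs <;> omega

theorem twist_term_gt (S : Fermi q c a D) {p m j i : ℕ} (hi : i < p) (h : j < i) :
    D (colSuf p m i) * (c (i, m) * a (i, m + 1)) *
      (D (rowW j (m + 1) + colAb j p (m + 1)) * c (j, m + 1)) =
    q • (D (rowW j (m + 1) + colAb j p (m + 1)) * c (j, m + 1) *
      (D (colSuf p m i) * (c (i, m) * a (i, m + 1)))) := by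
  have e : (rowW j (m + 1) + colAb j p (m + 1)) (i, m + 1) -
      (rowW j (m + 1) + colAb j p (m + 1)) (i, m) + colSuf p m i (j, m + 1) = 1 := by
    simp [rowW, colAb, colSuf, hi, h, h.ne', h.not_gt]
  rw [S.dg_mv_mul_dg_cr _ _ (by simp; omega), e, zpow_one]

theorem twist_term_eq (S : Fermi q c a D) {p m j : ℕ} :
    twist q a D p (m + 1) j * (D (colSuf p m j) * (c (j, m) * a (j, m + 1)) *
      (D (rowW j (m + 1) + colAb j p (m + 1)) * c (j, m + 1)) -
    q⁻¹ • (D (rowW j (m + 1) + colAb j p (m + 1)) * c (j, m + 1) *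
      (D (colSuf p m j) * (c (j, m) * a (j, m + 1))))) =
    -(q⁻¹ • (heightOp q D (m + 1) j * (D (colSuf p m j) * (c (j, m) * a (j, m + 1))))) := by
  have e : (rowW j (m + 1) + colAb j p (m + 1)) (j, m + 1) -
      (rowW j (m + 1) + colAb j p (m + 1)) (j, m) = -1 := by simp [rowW, colAb]
  rw [S.dg_mv_mul_dg_cr_sub (by simp [colSuf]), e, zpow_neg_one, sub_self, zero_smul, add_zero,
    mul_smul_comm, mul_smul_comm, mul_one, S.twist_mul _ _ (by simp [colSuf]),
    S.an_cr_ne (by simp)]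
  simp

/-- Expand `colOp` over rows i, with hops Y i. Pairs with i < j contribute nothing, the pair i = j
gives -q⁻¹ h i Y i, and the pairs with j < i give q⁻¹ (h (j + 1) - h j) Y i. The last telescope to
q⁻¹ (h i - 1) Y i, so every h i cancels. -/
theorem sum_twist (S : Fermi q c a D) (p m : ℕ) :
    ∑ j ∈ Finset.range p, twist q a D p (m + 1) j *
      (colOp c a D p m * (D (rowW j (m + 1) + colAb j p (m + 1)) * c (j, m + 1)) -
        q⁻¹ • (D (rowW j (m + 1) + colAb j p (m + 1)) * c (j, m + 1) * colOp c a D p m)) =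
      -(q⁻¹ • colOp c a D p m) := by
  have hq := S.ne_zero
  set Y : ℕ → A := fun i => D (colSuf p m i) * (c (i, m) * a (i, m + 1)) with hY
  set h := heightOp q D (m + 1) with hh
  have key : ∀ i ∈ Finset.range p, ∀ j ∈ Finset.range p, twist q a D p (m + 1) j *
      (Y i * (D (rowW j (m + 1) + colAb j p (m + 1)) * c (j, m + 1)) -
        q⁻¹ • (D (rowW j (m + 1) + colAb j p (m + 1)) * c (j, m + 1) * Y i)) =
      q⁻¹ • ((if j < i then h (j + 1) - h j else 0) * Y i) +
        (if j = i then -(q⁻¹ • (h i * Y i)) else 0) := by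
    intro i hi j hj
    have hi : i < p := by simpa using hi
    have hj : j < p := by simpa using hj
    rcases lt_trichotomy i j with hij | rfl | hij
    · rw [S.twist_term_lt hj hij, if_neg (by omega), if_neg (by omega), sub_self]; simp
    · rw [S.twist_term_eq, if_neg (lt_irrefl _), if_pos rfl]; simp [hY, hh]
    · rw [S.twist_term_gt hi hij, if_pos hij, if_neg (by omega), add_zero, ← S.heightOp_succ (p := p),
        smul_mul_assoc, smul_smul, ← sub_smul, mul_smul_comm, mul_assoc (twist _ _ _ _ _ _)]
      congr 1
      field_simp
  have e (j : ℕ) : twist q a D p (m + 1) j *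
      (colOp c a D p m * (D (rowW j (m + 1) + colAb j p (m + 1)) * c (j, m + 1)) -
        q⁻¹ • (D (rowW j (m + 1) + colAb j p (m + 1)) * c (j, m + 1) * colOp c a D p m)) =
      ∑ i ∈ Finset.range p, twist q a D p (m + 1) j *
      (Y i * (D (rowW j (m + 1) + colAb j p (m + 1)) * c (j, m + 1)) -
        q⁻¹ • (D (rowW j (m + 1) + colAb j p (m + 1)) * c (j, m + 1) * Y i)) := by
    rw [colOp, ← Finset.mul_sum, Finset.sum_sub_distrib, Finset.sum_mul, Finset.mul_sum,
      Finset.smul_sum]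
  rw [Finset.sum_congr rfl fun j _ => e j, Finset.sum_comm, colOp, Finset.smul_sum,
    ← Finset.sum_neg_distrib]
  refine Finset.sum_congr rfl fun i hi => ?_
  rw [Finset.sum_congr rfl (key i hi), Finset.sum_add_distrib, ← Finset.smul_sum, ← Finset.sum_mul,
    ← Finset.sum_filter, Finset.sum_ite_eq' , if_pos hi]
  have hf : {j ∈ Finset.range p | j < i} = Finset.range i := by
    ext j; simp at hi ⊢; omega
  rw [hf, Finset.sum_range_sub, hh, S.heightOp_zero, sub_mul, one_mul, smul_sub]
  abel

end ring

end Fermi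

/-! ### Root vectors applied to a joint highest weight vector -/

namespace Fermi

variable {q : ℂ} {H : Type*} [AddCommGroup H] [Module ℂ H] {c a : ℕ × ℕ → Module.End ℂ H}
  {D : (ℕ × ℕ → ℤ) → Module.End ℂ H}

theorem cr_an_apply (S : Fermi q c a D) {k l : ℕ × ℕ} (h : k ≠ l) {x : H} (hx : c k x = 0) :
    c k (a l x) = 0 := by
  have := LinearMap.congr_fun (S.an_cr_ne h.symm) x
  simpa [hx] using this

theorem an_an_apply (S : Fermi q c a D) {k l : ℕ × ℕ} {x : H} (hx : a k x = 0) :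
    a k (a l x) = 0 := by
  have := LinearMap.congr_fun (S.an_an k l) x
  simpa [hx] using this

theorem dg_single_of_an (S : Fermi q c a D) {k : ℕ × ℕ} {x : H} (hx : a k x = 0) (m : ℤ) :
    D (Pi.single k m) x = x := by
  simp [S.dg_single, hx]

theorem dg_single_of_cr (S : Fermi q c a D) {k : ℕ × ℕ} {x : H} (hx : c k x = 0) (m : ℤ) :
    D (Pi.single k m) x = q ^ m • x := by
  have h := LinearMap.congr_fun (S.an_cr_self k) x
  simp only [Module.End.mul_apply, hx, map_zero, LinearMap.sub_apply, Module.End.one_apply] at h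
  rw [S.dg_single]
  simp [← sub_eq_zero.1 h.symm, sub_smul]

theorem dg_rowW_apply (S : Fermi q c a D) {p r₀ : ℕ} {y : H} (r : ℕ)
    (h1 : ∀ s < r₀, c (p, s) y = 0) (h2 : ∀ s, r₀ ≤ s → s < r → a (p, s) y = 0) :
    D (-rowW p r) y = q ^ (-(min r r₀ : ℕ) : ℤ) • y := by
  induction r with
  | zero =>
    have : -rowW p 0 = 0 := by funext x; simp [rowW]
    rw [this, S.dg_zero]; simp
  | succ r ih =>
    have e : -rowW p (r + 1) = -rowW p r + Pi.single (p, r) (-1) := by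
      funext ⟨x, y⟩
      simp only [rowW, Pi.add_apply, Pi.neg_apply, Pi.single_apply, Prod.mk.injEq]
      split_ifs <;> omega
    have ih := ih fun s hs hs' => h2 s hs (by omega)
    rw [e, ← S.dg_mul_dg, Module.End.mul_apply]
    by_cases h : r < r₀
    · rw [S.dg_single_of_cr (h1 r h), map_smul, ih, smul_smul, ← zpow_add₀ S.ne_zero]
      congr 2; omega
    · rw [S.dg_single_of_an (h2 r (by omega) (by omega)), ih]
      congr 4; omega

/-- The highest weight condition replaces the hops in the first p rows by minus the hop in row p.
Since row p holds at most one particle in the columns r₀, …, m, removing a particle after that hop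
leaves only the delta term. So `colOp` shifts the vectors a (p, r) x to a (p, r + 1) x. -/
theorem an_apply_raise (S : Fermi q c a D) {p r₀ m r s : ℕ} {x : H}
    (h2 : ∀ r s, r₀ ≤ r → r ≤ m → r₀ ≤ s → s ≤ m → a (p, s) (a (p, r) x) = 0)
    (hV : raiseCol c a D (p + 1) r x = 0) (hr : r₀ ≤ r) (hr' : r < m) (hs : r₀ ≤ s) (hs' : s ≤ m) :
    colOp c a D p r (a (p, s) x) = if s = r then -(q⁻¹ • a (p, r + 1) x) else 0 := by
  rw [raiseCol, Finset.sum_range_succ, ← raiseCol, LinearMap.add_apply] at hV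
  have e1 : raiseCol c a D p r (a (p, s) x) =
      -(D (colPre r p) (a (p, s) (c (p, r) (a (p, r + 1) x)))) := by
    rw [apply_comm S.commute_raiseCol_an, eq_neg_of_add_eq_zero_left hV, map_neg,
      Module.End.mul_apply, Module.End.mul_apply,
      apply_comm (S.commute_dg_an (by simp [colPre])).symm]
  have e2 : a (p, s) (c (p, r) (a (p, r + 1) x)) = if s = r then a (p, r + 1) x else 0 := by
    have h0 := h2 (r + 1) s (by omega) (by omega) hs hs'
    have := LinearMap.congr_fun (S.an_cr (p, s) (p, r)) (a (p, r + 1) x)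
    rw [Module.End.mul_apply] at this
    rw [this]
    by_cases h : s = r
    · simp only [h, if_true, LinearMap.sub_apply, Module.End.one_apply, Module.End.mul_apply]
      subst h
      rw [h0, map_zero, sub_zero]
    · simp [h, h0]
  rw [S.colOp_eq, LinearMap.smul_apply, Module.End.mul_apply, e1, e2, map_neg,
    ← Module.End.mul_apply, S.dg_mul_dg, neg_add_cancel, S.dg_zero]
  split_ifs <;> simp

/-- This is the equation e_p x = 0 rewritten. Columns before r₀ do not contribute because (p, r) is
already occupied there, and in the others the part of the diagonal factor on row p + 1 acts by the
constant q^(-r₀), which is divided out. -/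
theorem sum_root_base (S : Fermi q c a D) {p r₀ m : ℕ} {x : H} (hm : r₀ ≤ m)
    (h1 : ∀ i ≤ p + 1, ∀ r < r₀, c (i, r) x = 0)
    (h2 : ∀ r s, r₀ ≤ r → r ≤ m → r₀ ≤ s → s ≤ m → a (p + 1, s) (a (p + 1, r) x) = 0)
    (hE : raiseRow c a D (m + 1) p x = 0) :
    ∑ r ∈ Finset.Ico r₀ (m + 1), (D (rowW p r) * c (p, r)) (a (p + 1, r) x) = 0 := by
  rw [raiseRow, LinearMap.sum_apply, Finset.range_eq_Ico,
    ← Finset.sum_Ico_consecutive _ (Nat.zero_le r₀) (by omega), Finset.sum_eq_zero, zero_add] at hE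
  · rw [← smul_eq_zero_iff_right (zpow_ne_zero (-(r₀ : ℤ)) S.ne_zero), ← hE, Finset.smul_sum]
    refine Finset.sum_congr rfl fun r hr => ?_
    rw [Finset.mem_Ico] at hr
    have e : rowPre p r = rowW p r + -rowW (p + 1) r := by
      funext ⟨x, y⟩
      simp only [rowW, rowPre, Pi.add_apply, Pi.neg_apply]
      split_ifs <;> omega
    have e2 := S.dg_rowW_apply (p := p + 1) (r₀ := r₀) (y := a (p + 1, r) x) r
      (fun s hs => S.cr_an_apply (by simp; omega) (h1 _ le_rfl _ hs))
      (fun s hs hs' => h2 _ _ (by omega) (by omega) hs (by omega))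
    rw [e, ← S.dg_mul_dg, mul_assoc, ← mul_assoc (D (-_)),
      (S.commute_dg_cr (w := -rowW (p + 1) r) (by simp [rowW])).eq, Module.End.mul_apply, Module.End.mul_apply, Module.End.mul_apply, Module.End.mul_apply, e2,
      map_smul, map_smul, min_eq_right hr.1]
  · intro r hr
    have hr : r < r₀ := by simpa using hr
    rw [Module.End.mul_apply, Module.End.mul_apply,
      S.cr_an_apply (by simp) (h1 _ (by omega) _ hr), map_zero]

/-- Start from the relation given by the lowest raising operator and take successive q-commutators
with e_j for decreasing j. The relation survives because e_j kills every a (p, r) x, and the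
recursion in r survives because e_j commutes with `colOp`. -/
theorem exists_root (S : Fermi q c a D) {p r₀ m : ℕ} {x : H} (hm : r₀ ≤ m)
    (h1 : ∀ i ≤ p, ∀ r < r₀, c (i, r) x = 0)
    (h2 : ∀ r s, r₀ ≤ r → r ≤ m → r₀ ≤ s → s ≤ m → a (p, s) (a (p, r) x) = 0)
    (hE : ∀ i < p, raiseRow c a D (m + 1) i x = 0) (j : ℕ) (hj : j < p) :
    ∃ ζ : ℕ → Module.End ℂ H, ∑ r ∈ Finset.Ico r₀ (m + 1), ζ r (a (p, r) x) = 0 ∧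
      (∀ r < m, colOp c a D p r * ζ (r + 1) - q⁻¹ • (ζ (r + 1) * colOp c a D p r) = ζ r) ∧
      ζ m = D (rowW j m + colAb j p m) * c (j, m) := by
  obtain ⟨p, rfl⟩ : ∃ p', p = p' + 1 := ⟨p - 1, by omega⟩
  induction (Nat.le_of_lt_succ hj) using Nat.decreasingInduction with
  | self =>
    refine ⟨fun r => D (rowW p r) * c (p, r), S.sum_root_base hm h1 h2 (hE p (by omega)),
      fun r _ => S.root_base, ?_⟩
    have e : rowW p m + colAb p (p + 1) m = rowW p m := by
      funext ⟨x, y⟩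
      simp only [rowW, colAb, Pi.add_apply]
      split_ifs <;> omega
    rw [e]
  | of_succ j hj' ih =>
    obtain ⟨ζ, i1, i2, i3⟩ := ih (by omega)
    set E := raiseRow c a D (m + 1) j with hEdef
    have hjp : j + 1 < p + 1 := by omega
    -- The q-commutator with E = e_j. On a (p + 1, r) x the second term vanishes, so the new
    -- relation is E applied to the old one.
    refine ⟨fun r => E * ζ r - q • (ζ r * E), ?_, fun r hr => ?_, ?_⟩
    · have e (r : ℕ) : (E * ζ r - q • (ζ r * E)) (a (p + 1, r) x) = E (ζ r (a (p + 1, r) x)) := by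
        have : E (a (p + 1, r) x) = 0 := by
          rw [hEdef, apply_comm (S.commute_raiseRow_an hjp), hE j hj, map_zero]
        simp [this]
      simp_rw [e]
      rw [← map_sum, i1, map_zero]
    · have hc := S.commute_raiseRow_colOp (m := m) hjp hr
      rw [← hEdef] at hc
      simp only [← i2 r hr]
      generalize colOp c a D (p + 1) r = X at *
      simp only [mul_sub, sub_mul, smul_mul_assoc, mul_smul_comm, smul_sub]
      have e1 (z : Module.End ℂ H) : X * (E * z) = E * (X * z) := by
        rw [← mul_assoc, ← hc.eq, mul_assoc]
      have e2 (z : Module.End ℂ H) : z * E * X = z * X * E := by rw [mul_assoc, hc.eq, mul_assoc]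
      rw [e1, mul_assoc E, e2, mul_assoc X, smul_comm q q⁻¹]
      abel
    · simp only [i3]
      exact S.root_step hjp

/-- Multiply the relations of `exists_root` by the twisted annihilators of column m and add over j:
this gives operators T r with ∑ T r (a (p, r) x) = 0. At r = m the operator is diagonal, by
telescoping. For r < m the recursion makes T r (a (p, r) x) equal to q^(-2(m - r)) a (p, m) x. The
resulting geometric series gives the factor in the conclusion. When q is not a root of unity and μ ≤
p, it is nonzero unless μ = p and r₀ = m. -/
theorem corner (S : Fermi q c a D) {p r₀ m : ℕ} {μ : ℤ} {x : H} (hm : r₀ ≤ m)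
    (h1 : ∀ i ≤ p, ∀ r < r₀, c (i, r) x = 0)
    (h2 : ∀ r s, r₀ ≤ r → r ≤ m → r₀ ≤ s → s ≤ m → a (p, s) (a (p, r) x) = 0)
    (hE : ∀ i < p, raiseRow c a D (m + 1) i x = 0)
    (hV : ∀ r, r₀ ≤ r → r < m → raiseCol c a D (p + 1) r x = 0)
    (hw : D (colBel p m) (a (p, m) x) = q ^ μ • a (p, m) x) :
    (q ^ (2 * (p - μ)) - q ^ (-(2 * (m - r₀ : ℤ)))) • a (p, m) x = 0 := by
  have hq := S.ne_zero
  choose! ζ i1 i2 i3 using S.exists_root hm h1 h2 hE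
  set y : ℕ → H := fun r => a (p, r) x with hy
  set T : ℕ → Module.End ℂ H := fun r => ∑ j ∈ Finset.range p, twist q a D p m j * ζ j r with hT
  have hA (r s : ℕ) (hr : r₀ ≤ r) (hr' : r < m) (hs : r₀ ≤ s) (hs' : s ≤ m) :=
    S.an_apply_raise h2 (hV r hr hr') hr hr' hs hs'
  have hsum : ∑ r ∈ Finset.Ico r₀ (m + 1), T r (y r) = 0 := by
    simp only [hT, LinearMap.sum_apply, Module.End.mul_apply]
    rw [Finset.sum_comm]
    refine Finset.sum_eq_zero fun j hj => ?_
    rw [← map_sum, i1 j (by simpa using hj), map_zero]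
  have hTm : (q ^ 2 - 1) • T m (y m) = (q ^ (2 * (p - μ)) - 1) • y m := by
    have e : T m = ∑ j ∈ Finset.range p,
        twist q a D p m j * (D (rowW j m + colAb j p m) * c (j, m)) :=
      Finset.sum_congr rfl fun j hj => by rw [i3 j (by simpa using hj)]
    have e2 : D (-(colBel p m + colBel p m)) (y m) = q ^ (-(2 * μ)) • y m := by
      have e3 : D (colBel p m + colBel p m) (y m) = q ^ (2 * μ) • y m := by
        rw [← S.dg_mul_dg, Module.End.mul_apply, hw, map_smul, hw, smul_smul, ← zpow_add₀ hq]
        congr 2; ring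
      have e4 := congrArg (D (-(colBel p m + colBel p m))) e3
      rw [← Module.End.mul_apply, S.dg_mul_dg, neg_add_cancel, S.dg_zero, map_smul,
        Module.End.one_apply] at e4
      rw [e4, smul_smul, ← zpow_add₀ hq, ← e4]; simp
    rw [e, ← LinearMap.smul_apply, S.sum_heightOp, LinearMap.sub_apply, heightOp,
      LinearMap.smul_apply, e2, smul_smul, ← zpow_natCast, ← zpow_add₀ hq, sub_smul, one_smul,
      Module.End.one_apply]
    congr 3; push_cast; ring
  -- The twists involve column m only through annihilators and weights not seen by `colOp` in the
  -- columns r, r + 1 < m, so they pass through the recursion. At r + 1 = m they do not, and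
  -- `sum_twist` takes over.
  have hTstep (r : ℕ) (hr : r + 1 < m) : T r = colOp c a D p r * T (r + 1) -
      q⁻¹ • (T (r + 1) * colOp c a D p r) := by
    rw [hT]
    simp only [Finset.mul_sum, Finset.sum_mul, Finset.smul_sum, ← Finset.sum_sub_distrib]
    refine Finset.sum_congr rfl fun j hj => ?_
    rw [← i2 j (by simpa using hj) r (by omega), mul_sub, mul_smul_comm, ← mul_assoc, ← mul_assoc,
      (S.commute_twist_colOp hr).eq, mul_assoc, mul_assoc]
  have hTlast (r : ℕ) (hr : r + 1 = m) : T r = -(q⁻¹ • colOp c a D p r) := by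
    subst hr
    rw [← S.sum_twist]
    exact Finset.sum_congr rfl fun j hj => by
      rw [← i3 j (by simpa using hj), i2 j (by simpa using hj) r (by omega)]
  have hT0 (s : ℕ) (hs : s < m) : ∀ r, r₀ ≤ r → r < s → T s (y r) = 0 := by
    induction (Nat.le_sub_one_of_lt hs) using Nat.decreasingInduction with
    | self =>
      intro r hr hrs
      rw [hTlast _ (by omega)]
      simp [hy, hA (m - 1) r (by omega) (by omega) hr (by omega), hrs.ne]
    | of_succ s hs' ih =>
      intro r hr hrs
      rw [hTstep _ (by omega), LinearMap.sub_apply, LinearMap.smul_apply, Module.End.mul_apply,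
        Module.End.mul_apply, ih (by omega) r hr (by omega),
        hA s r (by omega) (by omega) hr (by omega), if_neg hrs.ne]
      simp
  have hTy (r : ℕ) (hr : r < m) (hr0 : r₀ ≤ r) : T r (y r) = q ^ (-(2 * (m - r : ℤ))) • y m := by
    induction (Nat.le_sub_one_of_lt hr) using Nat.decreasingInduction with
    | self =>
      rw [hTlast _ (by omega)]
      simp only [hy, LinearMap.neg_apply, LinearMap.smul_apply,
        hA (m - 1) (m - 1) (by omega) (by omega) (by omega) (by omega), if_true, smul_neg, neg_neg,
        smul_smul, Nat.sub_add_cancel (show 1 ≤ m by omega), Nat.cast_sub (show 1 ≤ m by omega)]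
      congr 1
      rw [← zpow_neg_one, ← zpow_add₀ hq]
      congr 1; push_cast; ring
    | of_succ s hs' ih =>
      have ih := ih (by omega) (by omega)
      rw [hTstep _ (by omega), LinearMap.sub_apply, LinearMap.smul_apply, Module.End.mul_apply,
        Module.End.mul_apply, hT0 (s + 1) (by omega) s hr0 (by omega),
        hA s s hr0 (by omega) hr0 (by omega), if_pos rfl, map_zero, map_neg, map_smul,
        show a (p, s + 1) x = y (s + 1) from rfl, ih, zero_sub, smul_neg, neg_neg, smul_smul,
        smul_smul, ← zpow_neg_one, ← zpow_add₀ hq, ← zpow_add₀ hq]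
      congr 2; push_cast; ring
  -- The partial geometric sum, multiplied by q² - 1 so that no division is needed.
  have hgeom (n : ℕ) (hn : r₀ + n ≤ m) :
      (q ^ 2 - 1) • ∑ r ∈ Finset.Ico r₀ (r₀ + n), T r (y r) =
      (q ^ (-(2 * (m - r₀ - n : ℤ))) - q ^ (-(2 * (m - r₀ : ℤ)))) • y m := by
    induction n with
    | zero => simp
    | succ n ih =>
      rw [← add_assoc, Finset.sum_Ico_succ_top (by omega), smul_add, ih (by omega),
        hTy _ (by omega) (by omega), smul_smul, ← add_smul]
      congr 1
      rw [sub_mul, one_mul, ← zpow_natCast, ← zpow_add₀ hq]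
      have e1 : ((2 : ℕ) : ℤ) + -(2 * ((m : ℤ) - ((r₀ + n : ℕ) : ℤ))) =
        -(2 * ((m : ℤ) - r₀ - ((n + 1 : ℕ) : ℤ))) := by push_cast; ring
      have e2 : -(2 * ((m : ℤ) - ((r₀ + n : ℕ) : ℤ))) = -(2 * ((m : ℤ) - r₀ - n)) := by
        push_cast; ring
      rw [e1, e2]; ring
  have hg := hgeom (m - r₀) (by omega)
  rw [Finset.sum_Ico_succ_top hm] at hsum
  rw [show r₀ + (m - r₀) = m by omega, Nat.cast_sub hm, sub_self, mul_zero, neg_zero,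
    zpow_zero] at hg
  have := congrArg ((q ^ 2 - 1) • ·) hsum
  simp only [smul_add, smul_zero] at this
  rw [hg, hTm, ← add_smul] at this
  rw [← this]
  congr 1; ring

end Fermi

/-! ### Joint highest weight vectors -/

theorem zpow_injective_of_not_root {q : ℂ} (hq : q ≠ 0) (h : ∀ n : ℕ, 0 < n → q ^ n ≠ 1) {a b : ℤ}
    (hab : q ^ a = q ^ b) : a = b := by
  have key (n : ℕ) (hn : q ^ (n : ℤ) = 1) : n = 0 := by
    by_contra h0
    exact h n (Nat.pos_of_ne_zero h0) (by simpa using hn)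
  have h1 : q ^ (a - b) = 1 := by rw [zpow_sub₀ hq, hab, div_self (zpow_ne_zero _ hq)]
  obtain ⟨n, hn | hn⟩ := Int.eq_nat_or_neg (a - b)
  · have := key n (hn ▸ h1); omega
  · have := key n (by rw [hn, zpow_neg, inv_eq_one] at h1; exact h1)
    omega

theorem YoungDiagram.exists_insert (μ : YoungDiagram) {p g : ℕ} (h1 : μ.rowLen p = g)
    (h2 : μ.colLen g = p) : ∃ lam : YoungDiagram, (∀ x, x ∈ lam ↔ x = (p, g) ∨ x ∈ μ) ∧
      (∀ i, lam.rowLen i = μ.rowLen i + if i = p then 1 else 0) ∧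
      ∀ r, lam.colLen r = μ.colLen r + if r = g then 1 else 0 := by
  have hrow (i j) : (i, j) ∈ μ ↔ j < μ.rowLen i := YoungDiagram.mem_iff_lt_rowLen
  have hcol (i j) : (i, j) ∈ μ ↔ i < μ.colLen j := YoungDiagram.mem_iff_lt_colLen
  let lam : YoungDiagram := ⟨insert (p, g) μ.cells, by
    rintro ⟨i, j⟩ ⟨i', j'⟩ hle hm
    simp only [Finset.coe_insert, Set.mem_insert_iff, Finset.mem_coe, YoungDiagram.mem_cells,
      Prod.mk.injEq] at hm ⊢
    obtain ⟨hi, hj⟩ : i' ≤ i ∧ j' ≤ j := hle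
    rcases hm with ⟨rfl, rfl⟩ | hm
    · by_cases hip : i' < i
      · exact Or.inr (μ.up_left_mem le_rfl hj ((hcol _ _).2 (by omega)))
      · by_cases hjp : j' < j
        · exact Or.inr (μ.up_left_mem hi le_rfl ((hrow _ _).2 (by omega)))
        · exact Or.inl (by omega)
    · exact Or.inr (μ.up_left_mem hi hj hm)⟩
  have hmem (x) : x ∈ lam ↔ x = (p, g) ∨ x ∈ μ := by
    rw [← YoungDiagram.mem_cells, ← YoungDiagram.mem_cells]; exact Finset.mem_insert
  refine ⟨lam, hmem, fun i => ?_, fun r => ?_⟩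
  · refine eq_of_forall_lt_iff fun j => ?_
    rw [← YoungDiagram.mem_iff_lt_rowLen, hmem, hrow, Prod.mk.injEq]
    split_ifs with h
    · subst h; omega
    · simp [h]
  · refine eq_of_forall_lt_iff fun j => ?_
    rw [← YoungDiagram.mem_iff_lt_colLen, hmem, hcol, Prod.mk.injEq]
    split_ifs with h
    · subst h; omega
    · simp [h]

namespace Fermi

variable {q : ℂ} {H : Type*} [AddCommGroup H] [Module ℂ H] {c a : ℕ × ℕ → Module.End ℂ H}
  {D : (ℕ × ℕ → ℤ) → Module.End ℂ H}

/-- The indicator function of a finite set. -/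
def ind (s : Finset (ℕ × ℕ)) (k : ℕ × ℕ) : ℤ := if k ∈ s then 1 else 0

theorem ind_insert {s : Finset (ℕ × ℕ)} {k : ℕ × ℕ} (h : k ∉ s) :
    ind (insert k s) = ind s + Pi.single k 1 := by
  funext l
  by_cases hl : l = k
  · subst hl; simp [ind, h]
  · simp [ind, hl]

theorem ind_an (S : Fermi q c a D) {s : Finset (ℕ × ℕ)} {k : ℕ × ℕ} (h : k ∉ s) {m : ℤ} {x : H}
    (hx : D (ind (insert k s)) x = q ^ m • x) : D (ind s) (a k x) = q ^ (m - 1) • a k x := by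
  have h1 := S.dg_an_apply k hx
  have h2 : ind (insert k s) k = 1 := by simp [ind]
  rw [h2] at h1
  rw [← h1, ind_insert h, ← S.dg_mul_dg, Module.End.mul_apply, ← Module.End.mul_apply (D (Pi.single _ _)),
    S.dg_single_mul_an]

theorem ind_cr (S : Fermi q c a D) {s : Finset (ℕ × ℕ)} {k : ℕ × ℕ} (h : k ∉ s) {m : ℤ} {x : H}
    (hx : D (ind (insert k s)) x = q ^ m • x) : D (ind s) (c k x) = q ^ m • c k x := by
  have h1 := LinearMap.congr_fun (S.dg_mul_cr (ind (insert k s)) k) x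
  have h2 : ind (insert k s) k = 1 := by simp [ind]
  rw [h2, LinearMap.smul_apply, Module.End.mul_apply, Module.End.mul_apply, hx, map_smul,
    ind_insert h, ← S.dg_mul_dg, Module.End.mul_apply, ← Module.End.mul_apply (D (Pi.single _ _)),
    S.dg_single_mul_cr, LinearMap.smul_apply, map_smul, zpow_one] at h1
  exact smul_right_injective _ S.ne_zero h1

theorem eq_zero_of_an_of_cr (S : Fermi q c a D) (k : ℕ × ℕ) {x : H} (h1 : a k x = 0)
    (h2 : c k x = 0) : x = 0 := by
  have := LinearMap.congr_fun (S.an_cr_self k) x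
  simpa [h1, h2] using this.symm

/-- D (ind s) is q to the power of the number of particles in s. A vector x vanishes as soon as a k
x and c k x do, and both have known particle numbers in s without k, so the bound follows by
removing sites one at a time. -/
theorem ind_bound (S : Fermi q c a D) (s : Finset (ℕ × ℕ))
    (h : ∀ n : ℕ, 0 < n → q ^ n ≠ 1) {m : ℤ} {x : H} (hx : D (ind s) x = q ^ m • x)
    (hm : m < 0 ∨ (s.card : ℤ) < m) : x = 0 := by
  induction s using Finset.induction_on generalizing m x with
  | empty =>
    have : ind ∅ = 0 := by funext; simp [ind]
    rw [this, S.dg_zero, Module.End.one_apply] at hx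
    by_contra h0
    have h1 : q ^ m = q ^ (0 : ℤ) := by
      refine smul_left_injective ℂ h0 ?_
      simp [← hx]
    have := zpow_injective_of_not_root S.ne_zero h h1
    simp at hm; omega
  | insert k s hk ih =>
    rw [Finset.card_insert_of_notMem hk] at hm
    push_cast at hm
    exact S.eq_zero_of_an_of_cr k (ih (S.ind_an hk hx) (by omega)) (ih (S.ind_cr hk hx) (by omega))

/-- If s is full, c k x would have as many particles in s without k as s has sites, which is one too
many. -/
theorem ind_full (S : Fermi q c a D) {s : Finset (ℕ × ℕ)}
    (h : ∀ n : ℕ, 0 < n → q ^ n ≠ 1) {m : ℤ} {x : H} (hx : D (ind s) x = q ^ m • x)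
    (hm : m = s.card) {k : ℕ × ℕ} (hk : k ∈ s) : c k x = 0 := by
  rw [← Finset.insert_erase hk] at hx
  refine S.ind_bound _ h (S.ind_cr (Finset.notMem_erase k s) hx) (Or.inr ?_)
  have := Finset.card_erase_lt_of_mem hk
  omega

theorem raiseRow_flip (c a : ℕ × ℕ → Module.End ℂ H) (D : (ℕ × ℕ → ℤ) → Module.End ℂ H) (M i : ℕ) :
    raiseRow (fun k => c (Equiv.prodComm ℕ ℕ k)) (fun k => a (Equiv.prodComm ℕ ℕ k))
      (fun w => D fun k => -w ((Equiv.prodComm ℕ ℕ).symm k)) M i = raiseCol c a D M i := by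
  refine Finset.sum_congr rfl fun r _ => ?_
  have : (fun k => -rowPre i r ((Equiv.prodComm ℕ ℕ).symm k)) = colPre i r := by
    funext ⟨x, y⟩
    simp only [rowPre, colPre, Equiv.prodComm_symm, Equiv.prodComm_apply, Prod.swap]
    split_ifs <;> omega
  simp only [this]
  rfl

theorem raiseCol_flip (c a : ℕ × ℕ → Module.End ℂ H) (D : (ℕ × ℕ → ℤ) → Module.End ℂ H) (M i : ℕ) :
    raiseCol (fun k => c (Equiv.prodComm ℕ ℕ k)) (fun k => a (Equiv.prodComm ℕ ℕ k))
      (fun w => D fun k => -w ((Equiv.prodComm ℕ ℕ).symm k)) M i = raiseRow c a D M i := by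
  refine Finset.sum_congr rfl fun r _ => ?_
  have : (fun k => -colPre i r ((Equiv.prodComm ℕ ℕ).symm k)) = rowPre i r := by
    funext ⟨x, y⟩
    simp only [rowPre, colPre, Equiv.prodComm_symm, Equiv.prodComm_apply, Prod.swap]
    split_ifs <;> omega
  simp only [this]
  rfl

theorem raiseCol_an_apply' (S : Fermi q c a D) {N i p s : ℕ} {x : H} (hi : i < p)
    (hs : ∀ r, s < r → r < N → a (r, p) x = 0) (hx : raiseCol c a D N i x = 0) :
    raiseCol c a D N i (a (s, p) x) = 0 := by
  have := (S.flip (Equiv.prodComm ℕ ℕ)).raiseRow_an_apply (M := N) (i := i) (p := p) (s := s)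
    (x := x) hi
  rw [raiseRow_flip] at this
  exact this hs hx

theorem raiseRow_an_apply' (S : Fermi q c a D) {N r p s : ℕ} {x : H} (hr : r + 1 < N)
    (hs : ∀ r, s < r → r < N → a (r, p) x = 0) (hx : raiseRow c a D (p + 1) r x = 0) :
    raiseRow c a D (p + 1) r (a (s, p) x) = 0 := by
  have := (S.flip (Equiv.prodComm ℕ ℕ)).raiseCol_an_apply (M := N) (r := r) (p := p) (s := s)
    (x := x) hr
  rw [raiseCol_flip] at this
  exact this hs hx

theorem rowW_eq_ind (i M : ℕ) : rowW i M = ind ((Finset.range M).image fun r => (i, r)) := by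
  funext ⟨x, y⟩
  simp only [rowW, ind, Finset.mem_image, Finset.mem_range, Prod.mk.injEq]
  congr 1
  refine propext ⟨fun h => ⟨y, h.2, h.1.symm, rfl⟩, ?_⟩
  rintro ⟨r, hr, rfl, rfl⟩; exact ⟨rfl, hr⟩

theorem colBel_eq_ind (N r : ℕ) : colBel N r = ind ((Finset.range N).image fun i => (i, r)) := by
  funext ⟨x, y⟩
  simp only [colBel, ind, Finset.mem_image, Finset.mem_range, Prod.mk.injEq]
  congr 1
  refine propext ⟨fun h => ⟨x, h.2, rfl, h.1.symm⟩, ?_⟩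
  rintro ⟨r, hr, rfl, rfl⟩; exact ⟨rfl, hr⟩

/-- A joint highest weight vector on the grid `N × M`, with its row and column weights. -/
structure JointHW (q : ℂ) (c a : ℕ × ℕ → Module.End ℂ H) (D : (ℕ × ℕ → ℤ) → Module.End ℂ H)
    (N M : ℕ) (ν κ : ℕ → ℤ) (x : H) : Prop where
  ne_zero : x ≠ 0
  supp (i r) (h : ¬(i < N ∧ r < M)) : a (i, r) x = 0
  row (i) (h : i < N) : D (rowW i M) x = q ^ ν i • x
  col (r) (h : r < M) : D (colBel N r) x = q ^ κ r • x
  raise_row (i) (h : i + 1 < N) : raiseRow c a D M i x = 0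
  raise_col (r) (h : r + 1 < M) : raiseCol c a D N r x = 0

/-! ### The weights of a joint highest weight vector form a Young diagram -/

namespace JointHW

variable {N M : ℕ} {ν κ : ℕ → ℤ} {x : H}

theorem row_bound (S : Fermi q c a D) (h : ∀ n : ℕ, 0 < n → q ^ n ≠ 1)
    (hx : JointHW q c a D N M ν κ x) {i : ℕ} (hi : i < N) : 0 ≤ ν i ∧ ν i ≤ M := by
  have := hx.row i hi
  rw [rowW_eq_ind] at this
  by_contra h0
  refine hx.ne_zero (S.ind_bound _ h this ?_)
  rw [Finset.card_image_of_injective _ (fun _ _ h => by simpa using h), Finset.card_range]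
  omega

theorem rowW_succ (i M : ℕ) : rowW i (M + 1) = rowW i M + Pi.single (i, M) 1 := by
  funext ⟨x, y⟩
  simp only [rowW, Pi.add_apply, Pi.single_apply, Prod.mk.injEq]
  split_ifs <;> omega

theorem colBel_succ (N r : ℕ) : colBel (N + 1) r = colBel N r + Pi.single (N, r) 1 := by
  funext ⟨x, y⟩
  simp only [colBel, Pi.add_apply, Pi.single_apply, Prod.mk.injEq]
  split_ifs <;> omega

theorem drop_row (S : Fermi q c a D) (hx : JointHW q c a D (N + 1) M ν κ x)
    (h0 : ∀ r, a (N, r) x = 0) : JointHW q c a D N M ν κ x where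
  ne_zero := hx.ne_zero
  supp i r h := by
    by_cases hi : i = N
    · exact hi ▸ h0 r
    · exact hx.supp i r (by omega)
  row i h := hx.row i (by omega)
  col r h := by
    have := hx.col r h
    rwa [colBel_succ, ← S.dg_mul_dg, Module.End.mul_apply, S.dg_single_of_an (h0 r)] at this
  raise_row i h := hx.raise_row i (by omega)
  raise_col r h := by
    have := hx.raise_col r h
    rw [raiseCol, Finset.sum_range_succ, ← raiseCol, LinearMap.add_apply] at this
    simpa [h0] using this

theorem drop_col (S : Fermi q c a D) (hx : JointHW q c a D N (M + 1) ν κ x)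
    (h0 : ∀ r, a (r, M) x = 0) : JointHW q c a D N M ν κ x where
  ne_zero := hx.ne_zero
  supp i r h := by
    by_cases hi : r = M
    · exact hi ▸ h0 i
    · exact hx.supp i r (by omega)
  col i h := hx.col i (by omega)
  row r h := by
    have := hx.row r h
    rwa [rowW_succ, ← S.dg_mul_dg, Module.End.mul_apply, S.dg_single_of_an (h0 r)] at this
  raise_col i h := hx.raise_col i (by omega)
  raise_row r h := by
    have := hx.raise_row r h
    rw [raiseRow, Finset.sum_range_succ, ← raiseRow, LinearMap.add_apply] at this
    simpa [h0] using this

theorem remove (S : Fermi q c a D) (hx : JointHW q c a D N M ν κ x) {i s : ℕ} (hi : i < N)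
    (hs : s < M) (h0 : a (i, s) x ≠ 0)
    (h1 : ∀ j, j + 1 < N → raiseRow c a D M j (a (i, s) x) = 0)
    (h2 : ∀ j, j + 1 < M → raiseCol c a D N j (a (i, s) x) = 0) :
    JointHW q c a D N M (fun j => ν j - if j = i then 1 else 0)
      (fun j => κ j - if j = s then 1 else 0) (a (i, s) x) where
  ne_zero := h0
  supp j r h := S.an_an_apply (hx.supp j r h)
  row j h := by
    rw [S.dg_an_apply (i, s) (hx.row j h)]
    congr 3
    simp [rowW, hs, eq_comm]
  col j h := by
    rw [S.dg_an_apply (i, s) (hx.col j h)]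
    congr 3
    simp [colBel, hi, eq_comm]
  raise_row := h1
  raise_col := h2

theorem exists_last {P : ℕ → Prop} {n : ℕ} (h : ∃ s, s ≤ n ∧ P s) :
    ∃ s, s ≤ n ∧ P s ∧ ∀ r, s < r → r < n + 1 → ¬P r := by
  classical
  obtain ⟨s, hs, hP⟩ := h
  refine ⟨Nat.findGreatest P n, Nat.findGreatest_le _, Nat.findGreatest_spec hs hP, ?_⟩
  exact fun r h1 h2 => Nat.findGreatest_is_greatest h1 (by omega)

/-- The weights of the vector are described by the Young diagram `μ`. -/
def Shape (N M : ℕ) (ν κ : ℕ → ℤ) (μ : YoungDiagram) : Prop :=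
  (∀ i r, (i, r) ∈ μ → i < N ∧ r < M) ∧ (∀ i < N, ν i = μ.rowLen i) ∧
    ∀ r < M, κ r = μ.colLen r

theorem rowLen_eq_zero {μ : YoungDiagram} (h : ∀ i r, (i, r) ∈ μ → i < N ∧ r < M) {i : ℕ}
    (hi : N ≤ i) : μ.rowLen i = 0 := by
  by_contra h0
  have := (h i 0 (YoungDiagram.mem_iff_lt_rowLen.2 (Nat.pos_of_ne_zero h0))).1
  omega

theorem colLen_eq_zero {μ : YoungDiagram} (h : ∀ i r, (i, r) ∈ μ → i < N ∧ r < M) {i : ℕ}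
    (hi : M ≤ i) : μ.colLen i = 0 := by
  by_contra h0
  have := (h 0 i (YoungDiagram.mem_iff_lt_colLen.2 (Nat.pos_of_ne_zero h0))).2
  omega

/-- Let g be the length of the last row of μ. The diagram forces the first g columns to be full, and
the last row of x has weight g + 1, so it holds exactly one more particle in the remaining columns.
These are the hypotheses of `corner` with r₀ = g. -/
theorem corner_eq (S : Fermi q c a D) (h : ∀ n : ℕ, 0 < n → q ^ n ≠ 1)
    (hx : JointHW q c a D (N + 1) (M + 1) ν κ x) (h0 : a (N, M) x ≠ 0) {μ : YoungDiagram}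
    (hμ : Shape (N + 1) (M + 1) (fun j => ν j - if j = N then 1 else 0)
      (fun j => κ j - if j = M then 1 else 0) μ) : μ.rowLen N = M ∧ μ.colLen M = N := by
  obtain ⟨m0, m1, m2⟩ := hμ
  set g := μ.rowLen N with hg
  have e1 : ν N = g + 1 := by have := m1 N (by omega); simp at this; omega
  have hgM : g ≤ M := by have := hx.row_bound S h (i := N) (by omega); push_cast at this; omega
  have hcol : ∀ r < g, κ r = N + 1 := by
    intro r hr
    have h1 := m2 r (by omega)
    simp only [if_neg (show r ≠ M by omega)] at h1
    have h2 : N < μ.colLen r := YoungDiagram.mem_iff_lt_colLen.1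
      (YoungDiagram.mem_iff_lt_rowLen.2 hr)
    have h3 : μ.colLen r ≤ N + 1 := by
      by_contra h4
      have := (m0 (N + 1) r (YoungDiagram.mem_iff_lt_colLen.2 (by omega))).1
      omega
    omega
  have hfull : ∀ i ≤ N, ∀ r < g, c (i, r) x = 0 := by
    intro i hi r hr
    have h1 := hx.col r (by omega)
    rw [colBel_eq_ind] at h1
    refine S.ind_full h h1 ?_ (Finset.mem_image.2 ⟨i, by simp; omega, rfl⟩)
    rw [Finset.card_image_of_injective _ (fun _ _ h => by simpa using h), Finset.card_range,
      hcol r hr]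
    push_cast; ring
  have hrest : ∀ r s, g ≤ r → r ≤ M → g ≤ s → s ≤ M → a (N, s) (a (N, r) x) = 0 := by
    intro r s hr hr' hs hs'
    set T := (Finset.Ico g (M + 1)).image fun r => (N, r) with hT
    have e2 : ind T = -rowW N g + rowW N (M + 1) := by
      funext ⟨x, y⟩
      have : (x, y) ∈ T ↔ x = N ∧ g ≤ y ∧ y < M + 1 := by
        rw [hT]
        simp only [Finset.mem_image, Finset.mem_Ico, Prod.mk.injEq]
        exact ⟨by rintro ⟨r, h1, rfl, rfl⟩; exact ⟨rfl, h1⟩, fun h => ⟨y, h.2, h.1.symm, rfl⟩⟩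
      simp only [ind, this, rowW, Pi.add_apply, Pi.neg_apply]
      split_ifs <;> omega
    have e3 : D (ind T) x = q ^ (1 : ℤ) • x := by
      rw [e2, ← S.dg_mul_dg, Module.End.mul_apply, hx.row N (by omega), map_smul,
        S.dg_rowW_apply (r₀ := g) g (fun s hs => hfull N le_rfl s hs) (fun s hs hs' => by omega),
        smul_smul, ← zpow_add₀ S.ne_zero, e1, min_self]
      congr 2; ring
    have hm (r) (hr : g ≤ r) (hr' : r ≤ M) : ind T (N, r) = 1 := by
      rw [ind, hT]
      exact if_pos (Finset.mem_image.2 ⟨r, by simp; omega, rfl⟩)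
    have e4 := S.dg_an_apply (N, s) (S.dg_an_apply (N, r) e3)
    rw [hm r hr hr', hm s hs hs'] at e4
    exact S.ind_bound T h e4 (Or.inl (by norm_num))
  have hk : D (colBel N M) (a (N, M) x) = q ^ (μ.colLen M : ℤ) • a (N, M) x := by
    have h1 := S.dg_an_apply (N, M) (hx.col M (by omega))
    have h2 := m2 M (by omega)
    simp only [if_true] at h2
    have h3 : colBel (N + 1) M (N, M) = 1 := by simp [colBel]
    rw [h3, h2, colBel_succ, ← S.dg_mul_dg, Module.End.mul_apply, S.dg_single_of_an] at h1
    · exact h1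
    · have := LinearMap.congr_fun (S.an_sq (N, M)) x
      exact this
  have key := S.corner hgM hfull hrest (fun i hi => hx.raise_row i (by omega))
    (fun r _ hr => hx.raise_col r (by omega)) hk
  rw [smul_eq_zero_iff_left h0, sub_eq_zero] at key
  have key := zpow_injective_of_not_root S.ne_zero h key
  -- The equation of exponents says 2 (N - μ.colLen M) = -2 (M - g). With this bound the left side
  -- is nonnegative and the right side nonpositive, so both vanish.
  have hle : μ.colLen M ≤ N := by
    by_contra h4
    have := YoungDiagram.mem_iff_lt_rowLen.1 (YoungDiagram.mem_iff_lt_colLen.2 (not_le.1 h4))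
    omega
  omega

/-- Induction on the size of the grid plus the number of particles. Empty last rows and columns are
discarded. Otherwise one particle is removed in two ways, and the two diagrams obtained by induction
determine where the missing cell goes. -/
theorem exists_shape (S : Fermi q c a D) (h : ∀ n : ℕ, 0 < n → q ^ n ≠ 1) (n : ℕ) :
    ∀ (N M : ℕ) (ν κ : ℕ → ℤ) (x : H), JointHW q c a D N M ν κ x →
      N + M + ∑ i ∈ Finset.range N, ν i ≤ (n : ℤ) → ∃ μ, Shape N M ν κ μ := by
  have one_of {x : H} (hx : x ≠ 0) {m : ℤ} (h1 : x = q ^ m • x) : m = 0 := by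
    refine zpow_injective_of_not_root S.ne_zero h (smul_left_injective ℂ hx ?_)
    simp [← h1]
  induction n with
  | zero =>
    intro N M ν κ x hx hn
    have : 0 ≤ ∑ i ∈ Finset.range N, ν i :=
      Finset.sum_nonneg fun i hi => (hx.row_bound S h (by simpa using hi)).1
    obtain ⟨rfl, rfl⟩ : N = 0 ∧ M = 0 := by omega
    exact ⟨⊥, fun i r hm => absurd hm (YoungDiagram.notMem_bot _), by omega, by omega⟩
  | succ n ih =>
    intro N M ν κ x hx hn
    have hD0 {w : ℕ × ℕ → ℤ} (hw : w = 0) : D w x = x := by rw [hw, S.dg_zero]; rfl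
    rcases N with - | p
    · refine ⟨⊥, fun i r hm => absurd hm (YoungDiagram.notMem_bot _), by omega, fun r hr => ?_⟩
      have := hx.col r hr
      rw [hD0 (by funext; simp [colBel])] at this
      rw [one_of hx.ne_zero this]
      symm
      simpa using colLen_eq_zero (N := 0) (M := 0)
        (fun i r hm => absurd hm (YoungDiagram.notMem_bot _)) (Nat.zero_le r)
    rcases M with - | t
    · refine ⟨⊥, fun i r hm => absurd hm (YoungDiagram.notMem_bot _), fun r hr => ?_, by omega⟩
      have := hx.row r hr
      rw [hD0 (by funext; simp [rowW])] at this
      rw [one_of hx.ne_zero this]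
      symm
      simpa using rowLen_eq_zero (N := 0) (M := 0)
        (fun i r hm => absurd hm (YoungDiagram.notMem_bot _)) (Nat.zero_le r)
    by_cases hp : ∀ r, a (p, r) x = 0
    · have hνp : ν p = 0 := by
        have h1 : ∀ r, D (rowW p r) x = x := by
          intro r
          induction r with
          | zero => exact hD0 (by funext; simp [rowW])
          | succ r ih =>
            rw [rowW_succ, ← S.dg_mul_dg, Module.End.mul_apply, S.dg_single_of_an (hp r), ih]
        exact one_of hx.ne_zero ((h1 _).symm.trans (hx.row p (by omega)))
      rw [Finset.sum_range_succ] at hn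
      obtain ⟨μ, m0, m1, m2⟩ := ih p (t + 1) ν κ x (hx.drop_row S hp) (by push_cast at hn ⊢; omega)
      refine ⟨μ, fun i r hm => ⟨by have := m0 i r hm; omega, (m0 i r hm).2⟩, fun i hi => ?_, m2⟩
      by_cases hip : i = p
      · rw [hip, hνp, rowLen_eq_zero m0 le_rfl]; rfl
      · exact m1 i (by omega)
    by_cases hc : ∀ i, a (i, t) x = 0
    · have hκ : κ t = 0 := by
        have h1 : ∀ r, D (colBel r t) x = x := by
          intro r
          induction r with
          | zero => exact hD0 (by funext; simp [colBel])
          | succ r ih =>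
            rw [colBel_succ, ← S.dg_mul_dg, Module.End.mul_apply, S.dg_single_of_an (hc r), ih]
        exact one_of hx.ne_zero ((h1 _).symm.trans (hx.col t (by omega)))
      obtain ⟨μ, m0, m1, m2⟩ := ih (p + 1) t ν κ x (hx.drop_col S hc) (by push_cast at hn ⊢; omega)
      refine ⟨μ, fun i r hm => ⟨(m0 i r hm).1, by have := m0 i r hm; omega⟩, m1, fun i hi => ?_⟩
      by_cases hip : i = t
      · rw [hip, hκ, colLen_eq_zero m0 le_rfl]; rfl
      · exact m2 i (by omega)
    push Not at hp hc
    -- (p, s) is the last site of the last row, and below (u, t) the last site of the last column,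
    -- whose annihilation does not kill x.
    obtain ⟨s, hs, hs0, hs1⟩ := exists_last (P := fun r => a (p, r) x ≠ 0) (n := t) (by
      obtain ⟨r, hr⟩ := hp
      exact ⟨r, by by_contra h1; exact hr (hx.supp p r (by omega)), hr⟩)
    obtain ⟨u, hu, hu0, hu1⟩ := exists_last (P := fun r => a (r, t) x ≠ 0) (n := p) (by
      obtain ⟨r, hr⟩ := hc
      exact ⟨r, by by_contra h1; exact hr (hx.supp r t (by omega)), hr⟩)
    simp only [not_not] at hs1 hu1
    have hsum (j : ℕ) (hj : j < p + 1) : ∑ i ∈ Finset.range (p + 1), (ν i - if i = j then 1 else 0) =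
        ∑ i ∈ Finset.range (p + 1), ν i - 1 := by
      rw [Finset.sum_sub_distrib, Finset.sum_ite_eq', if_pos (by simpa using hj)]
    obtain ⟨μ, m0, m1, m2⟩ := ih _ _ _ _ _ (hx.remove S (i := p) (s := s) (by omega) (by omega) hs0
      (fun j hj => S.raiseRow_an_apply (by omega) hs1 (hx.raise_row j hj))
      (fun j hj => S.raiseCol_an_apply hj hs1 (hx.raise_col j hj)))
      (by rw [hsum p (by omega)]; push_cast at hn ⊢; omega)
    obtain ⟨μ', m0', m1', m2'⟩ := ih _ _ _ _ _ (hx.remove S (i := u) (s := t) (by omega) (by omega)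
      hu0 (fun j hj => S.raiseRow_an_apply' hj hu1 (hx.raise_row j hj))
      (fun j hj => S.raiseCol_an_apply' (by omega) hu1 (hx.raise_col j hj)))
      (by rw [hsum u (by omega)]; push_cast at hn ⊢; omega)
    -- The removed site (p, s) can be added to μ. If it is the corner both removals coincide and
    -- `corner_eq` is needed; otherwise μ and μ' are compared.
    have key : μ.rowLen p = s ∧ μ.colLen s = p := by
      by_cases hst : s = t
      · subst hst
        exact hx.corner_eq S h hs0 ⟨m0, m1, m2⟩
      have hup : u ≠ p := by
        rintro rfl
        exact hu0 (hs1 t (by omega) (by omega))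
      have e1 := m1 p (by omega)
      have e2 := m1' p (by omega)
      simp only [if_true] at e1
      simp only [if_neg (Ne.symm hup)] at e2
      set g := μ.rowLen p with hg
      -- The second removal does not touch row p, so row p of μ' is one longer than that of μ and
      -- contains (p, g). Column g is then longer in μ' than in μ, and the column weights allow this
      -- only for g = s, with column s of μ of length p.
      have hmem : (p, g) ∈ μ' := YoungDiagram.mem_iff_lt_rowLen.2 (by omega)
      have hnm : ¬(p, g) ∈ μ := fun hm => by
        have := YoungDiagram.mem_iff_lt_rowLen.1 hm; omega
      have hgt := (m0' _ _ hmem).2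
      have f1 := m2 g hgt
      have f2 := m2' g hgt
      rw [YoungDiagram.mem_iff_lt_colLen] at hmem hnm
      simp only at f1 f2
      split_ifs at f1 f2 with g1 g2 <;> first | omega | (subst g1; omega)
    obtain ⟨lam, l0, l1, l2⟩ := YoungDiagram.exists_insert μ key.1 key.2
    refine ⟨lam, fun i r hm => ?_, fun i hi => ?_, fun r hr => ?_⟩
    · rcases (l0 _).1 hm with hm | hm
      · rw [Prod.mk.injEq] at hm; omega
      · exact m0 i r hm
    · have := m1 i hi
      rw [l1]; push_cast; simp only at this; split_ifs at * <;> omega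
    · have := m2 r hr
      rw [l2]; push_cast; simp only at this; split_ifs at * <;> omega

end JointHW

end Fermi

/-! ### The contravariant form -/

/-- A Fock space: a vacuum vector and a symmetric form for which creation and annihilation operators
are adjoint. -/
structure FermiForm (q : ℂ) {κ H : Type*} [DecidableEq κ] [AddCommGroup H] [Module ℂ H]
    (c a : κ → Module.End ℂ H) (D : (κ → ℤ) → Module.End ℂ H) (vac : H)
    (B : H →ₗ[ℂ] H →ₗ[ℂ] ℂ) : Prop extends Fermi q c a D where
  symm (x y) : B x y = B y x
  cr_adj (k x y) : B (c k x) y = B x (a k y)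
  dg_adj (w x y) : B (D w x) y = B x (D w y)
  vac_vac : B vac vac = 1
  an_vac (k) : a k vac = 0
  exists_supp (x) : ∃ K : Finset κ, ∀ k ∉ K, a k x = 0
  exists_expand (x) : ∃ (K : Finset κ) (z : ℂ) (y : κ → H), x = z • vac + ∑ k ∈ K, c k (y k)

namespace FermiForm

variable {q : ℂ} {κ H : Type*} [DecidableEq κ] [AddCommGroup H] [Module ℂ H]
  {c a : κ → Module.End ℂ H} {D : (κ → ℤ) → Module.End ℂ H} {vac : H} {B : H →ₗ[ℂ] H →ₗ[ℂ] ℂ}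

theorem an_adj (F : FermiForm q c a D vac B) (k : κ) (x y : H) : B (a k x) y = B x (c k y) := by
  rw [F.symm, ← F.cr_adj, F.symm]

theorem cr_an_apply_ne (F : FermiForm q c a D vac B) {k l : κ} (h : k ≠ l) (x : H) :
    a k (c l x) = -c l (a k x) := LinearMap.congr_fun (F.an_cr_ne h) x

theorem an_cr_apply (F : FermiForm q c a D vac B) (k : κ) (x : H) :
    a k (c k x) = x - c k (a k x) := LinearMap.congr_fun (F.an_cr_self k) x

theorem cr_cr_apply (F : FermiForm q c a D vac B) (k l : κ) (x : H) :
    c k (c l x) = -c l (c k x) := LinearMap.congr_fun (F.cr_cr k l) x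

theorem an_an_apply (F : FermiForm q c a D vac B) (k l : κ) (x : H) :
    a k (a l x) = -a l (a k x) := LinearMap.congr_fun (F.an_an k l) x

/-- The operator a k c k projects to vectors with k vacant. It fixes x and the vacuum, kills the
term c k (y k) and keeps the shape of the other terms, so the terms of the expansion can be removed
one by one. -/
theorem eq_vac_of_expand (F : FermiForm q c a D vac B) (K : Finset κ) : ∀ (x : H) (z : ℂ) (y : κ → H),
    (∀ k ∈ K, a k x = 0) → x = z • vac + ∑ k ∈ K, c k (y k) → x = z • vac := by
  induction K using Finset.induction_on with
  | empty => intro x z y _ h; simpa using h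
  | insert k K hk ih =>
    intro x z y h0 hx
    refine ih x z (fun l => a k (c k (y l))) (fun l hl => h0 l (Finset.mem_insert_of_mem hl)) ?_
    have h1 : a k (c k x) = x := by rw [F.an_cr_apply, h0 k (Finset.mem_insert_self k K)]; simp
    nth_rw 1 [← h1, hx]
    have h2 : a k (c k vac) = vac := by rw [F.an_cr_apply, F.an_vac]; simp
    have h3 : c k (c k (y k)) = 0 := LinearMap.congr_fun (F.cr_sq k) _
    rw [Finset.sum_insert hk, map_add, map_add, map_smul, map_smul, h2, map_add, h3, zero_add,
      map_sum, map_sum]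
    congr 1
    refine Finset.sum_congr rfl fun l hl => ?_
    have hkl : k ≠ l := by rintro rfl; exact hk hl
    rw [F.cr_cr_apply k l, map_neg, F.cr_an_apply_ne hkl, neg_neg]

theorem eq_vac (F : FermiForm q c a D vac B) {x : H} (h : ∀ k, a k x = 0) : ∃ z : ℂ, x = z • vac := by
  obtain ⟨K, z, y, hx⟩ := F.exists_expand x
  exact ⟨z, F.eq_vac_of_expand K x z y (fun k _ => h k) hx⟩

/-- Induction on a finite set of sites outside which z is empty. The vector a k z is again
orthogonal to everything and is empty at k, so it vanishes by induction; then z itself is empty at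
k. -/
theorem eq_zero_of_form (F : FermiForm q c a D vac B) {z : H} (hz : ∀ x, B x z = 0) : z = 0 := by
  obtain ⟨K, hK⟩ := F.exists_supp z
  induction K using Finset.induction_on generalizing z with
  | empty =>
    obtain ⟨s, rfl⟩ := F.eq_vac (fun k => hK k (Finset.notMem_empty k))
    have := hz vac
    rw [map_smul, F.vac_vac, smul_eq_mul, mul_one] at this
    rw [this, zero_smul]
  | insert k K hk ih =>
    refine ih hz fun l hl => ?_
    by_cases hkl : l = k
    · subst hkl
      refine ih (fun x => by rw [← F.cr_adj, hz]) fun m hm => ?_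
      by_cases h : m = l
      · subst h; exact LinearMap.congr_fun (F.an_sq m) z
      · rw [F.an_an_apply, hK m (by simp [h, hm]), map_zero, neg_zero]
    · exact hK l (by simp [hkl, hl])

theorem commute_of_adj (F : FermiForm q c a D vac B) {S T S' T' : Module.End ℂ H}
    (hS : ∀ x y, B (S' x) y = B x (S y)) (hT : ∀ x y, B (T' x) y = B x (T y))
    (h : Commute S' T') : Commute S T := by
  refine LinearMap.ext fun y => sub_eq_zero.1 (F.eq_zero_of_form fun x => ?_)
  rw [map_sub, Module.End.mul_apply, Module.End.mul_apply, ← hS, ← hT, ← hT, ← hS, sub_eq_zero]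
  exact congrArg (fun z => B z y) (LinearMap.congr_fun h.eq x).symm

/-- The normalized vector with the given set of occupied sites. -/
theorem exists_state (F : FermiForm q c a D vac B) (s : Finset κ) (P : H → Prop) (h0 : P vac)
    (h1 : ∀ k ∈ s, ∀ x, P x → P (c k x)) :
    ∃ v, P v ∧ B v v = 1 ∧ (∀ k ∈ s, c k v = 0) ∧ (∀ k ∉ s, a k v = 0) ∧
      ∀ x, (∀ k ∈ s, c k x = 0) → (∀ k ∉ s, a k x = 0) → ∃ z : ℂ, x = z • v := by
  induction s using Finset.induction_on with
  | empty =>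
    exact ⟨vac, h0, F.vac_vac, by simp, fun k _ => F.an_vac k, fun x _ h =>
      F.eq_vac fun k => h k (Finset.notMem_empty k)⟩
  | insert k s hk ih =>
    obtain ⟨v, i0, i1, i2, i3, i4⟩ := ih fun l hl => h1 l (Finset.mem_insert_of_mem hl)
    have hv : a k (c k v) = v := by rw [F.an_cr_apply, i3 k hk]; simp
    refine ⟨c k v, h1 k (Finset.mem_insert_self k s) v i0, by rw [F.cr_adj, hv, i1],
      fun l hl => ?_, fun l hl => ?_, fun x hc ha => ?_⟩
    · rcases Finset.mem_insert.1 hl with rfl | hl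
      · exact LinearMap.congr_fun (F.cr_sq l) v
      · rw [F.cr_cr_apply, i2 l hl, map_zero, neg_zero]
    · rw [Finset.mem_insert, not_or] at hl
      rw [F.cr_an_apply_ne hl.1, i3 l hl.2, map_zero, neg_zero]
    -- With k occupied, x = c k (a k x), and a k x satisfies the conditions for s.
    · obtain ⟨z, hz⟩ := i4 (a k x) (fun l hl => by
        have hlk : k ≠ l := by rintro rfl; exact hk hl
        have := F.cr_an_apply_ne hlk x
        rw [hc l (Finset.mem_insert_of_mem hl), map_zero] at this
        rw [← neg_eq_zero, ← this]) (fun l hl => by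
        by_cases h : l = k
        · subst h; exact LinearMap.congr_fun (F.an_sq l) x
        · rw [F.an_an_apply, ha l (by simp [h, hl]), map_zero, neg_zero])
      refine ⟨z, ?_⟩
      have := F.an_cr_apply k x
      rw [hc k (Finset.mem_insert_self k s), map_zero, hz, map_smul] at this
      exact sub_eq_zero.1 this.symm

end FermiForm

/-! ### Construction of the form on an exterior algebra -/

section exterior

variable {κ X : Type} [AddCommGroup X] [Module ℂ X] (b : Module.Basis κ ℂ X)

/-- The homomorphism sending a vector to its contraction, with reversed multiplication. -/
def contr [DecidableEq κ] : ExteriorAlgebra ℂ X →ₐ[ℂ] (Module.End ℂ (ExteriorAlgebra ℂ X))ᵐᵒᵖ :=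
  ExteriorAlgebra.lift ℂ ⟨(MulOpposite.opLinearEquiv ℂ).toLinearMap ∘ₗ
    (CliffordAlgebra.contractLeft (Q := (0 : QuadraticForm ℂ X))) ∘ₗ b.toDual, fun x => by
      refine MulOpposite.unop_injective (LinearMap.ext fun y => ?_)
      exact CliffordAlgebra.contractLeft_contractLeft _ _⟩

/-- The form on the exterior algebra for which the monomials in the basis are orthonormal. -/
def form [DecidableEq κ] : ExteriorAlgebra ℂ X →ₗ[ℂ] ExteriorAlgebra ℂ X →ₗ[ℂ] ℂ :=
  (LinearMap.compRight ℂ (ExteriorAlgebra.algebraMapInv (R := ℂ) (M := X)).toLinearMap) ∘ₗ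
    (MulOpposite.opLinearEquiv ℂ).symm.toLinearMap ∘ₗ (contr b).toLinearMap

theorem form_one [DecidableEq κ] (y : ExteriorAlgebra ℂ X) :
    form b 1 y = ExteriorAlgebra.algebraMapInv y := by
  change ExteriorAlgebra.algebraMapInv (MulOpposite.unop (contr b 1) y) = _
  rw [map_one]; rfl

theorem form_cr [DecidableEq κ] (k : κ) (x y : ExteriorAlgebra ℂ X) :
    form b (cr b k x) y = form b x (an b k y) := by
  change ExteriorAlgebra.algebraMapInv (MulOpposite.unop (contr b (ExteriorAlgebra.ι ℂ (b k) * x)) y)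
    = ExteriorAlgebra.algebraMapInv (MulOpposite.unop (contr b x) (an b k y))
  rw [map_mul]
  change ExteriorAlgebra.algebraMapInv (MulOpposite.unop (contr b x)
    (MulOpposite.unop (contr b (ExteriorAlgebra.ι ℂ (b k))) y)) = _
  congr 2
  rw [contr, ExteriorAlgebra.lift_ι_apply]
  change CliffordAlgebra.contractLeft (b.toDual (b k)) y = CliffordAlgebra.contractLeft _ y
  congr 2
  exact b.ext fun l => by simp [Module.Basis.toDual_apply, Finsupp.single_apply, eq_comm]

theorem algebraMapInv_cr (k : κ) (y : ExteriorAlgebra ℂ X) :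
    ExteriorAlgebra.algebraMapInv (cr b k y) = 0 := by
  rw [cr_apply, map_mul]
  simp [ExteriorAlgebra.algebraMapInv]

/-- Creation in the first argument is annihilation in the second by construction. The other
adjunction is proved by induction on x: both sides change in the same way under left multiplication
by b l, since c and a satisfy the same exchange rule on either argument. -/
theorem form_an [DecidableEq κ] (k : κ) (x y : ExteriorAlgebra ℂ X) :
    form b x (cr b k y) = form b (an b k x) y := by
  have key : form b ∘ₗ an b k = (LinearMap.lcomp ℂ ℂ (cr b k)) ∘ₗ form b := by
    refine ext_of_ι_mul b ?_ fun l x h => ?_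
    · refine LinearMap.ext fun y => ?_
      change form b (an b k 1) y = form b 1 (cr b k y)
      rw [an_one, map_zero, form_one, algebraMapInv_cr]; rfl
    · refine LinearMap.ext fun y => ?_
      have h' (y) : form b (an b k x) y = form b x (cr b k y) := LinearMap.congr_fun h y
      change form b (an b k (cr b l x)) y = form b (cr b l x) (cr b k y)
      have e1 : an b k (cr b l x) = (if k = l then x else 0) - cr b l (an b k x) := by
        have := LinearMap.congr_fun (an_cr b k l) x
        refine this.trans ?_
        split_ifs <;> rfl
      have e2 : an b l (cr b k y) = (if l = k then y else 0) - cr b k (an b l y) := by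
        have := LinearMap.congr_fun (an_cr b l k) y
        refine this.trans ?_
        split_ifs <;> rfl
      rw [form_cr, e1, e2, map_sub, map_sub, LinearMap.sub_apply, form_cr, h']
      by_cases hkl : k = l
      · rw [if_pos hkl, if_pos hkl.symm]
      · rw [if_neg hkl, if_neg (Ne.symm hkl)]; simp
  exact (LinearMap.congr_fun (LinearMap.congr_fun key x) y).symm

theorem algebraMapInv_dg (q : ℂ) (w : κ → ℤ) (y : ExteriorAlgebra ℂ X) :
    ExteriorAlgebra.algebraMapInv (dg b q w y) = ExteriorAlgebra.algebraMapInv y := by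
  have key : (ExteriorAlgebra.algebraMapInv (R := ℂ) (M := X)).toLinearMap ∘ₗ dg b q w =
      (ExteriorAlgebra.algebraMapInv (R := ℂ) (M := X)).toLinearMap := by
    refine ext_of_ι_mul b (congrArg _ (dg_one_vec b q w)) fun k x h => ?_
    change ExteriorAlgebra.algebraMapInv (dg b q w (_ * x)) =
      ExteriorAlgebra.algebraMapInv (cr b k x)
    rw [dg_ι_mul, map_smul]
    change _ • ExteriorAlgebra.algebraMapInv (cr b k _) = _
    rw [algebraMapInv_cr, algebraMapInv_cr, smul_zero]
  exact LinearMap.congr_fun key y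

theorem fermiForm [DecidableEq κ] {q : ℂ} (hq : q ≠ 0) :
    FermiForm q (cr b) (an b) (dg b q) 1 (form b) where
  toFermi := fermi b hq
  symm x y := by
    have key : form b = (form b).flip := by
      refine ext_of_ι_mul b ?_ fun k x h => ?_
      · refine ext_of_ι_mul b rfl fun k x h => ?_
        change form b 1 (cr b k x) = form b (cr b k x) 1
        rw [form_cr, an_one, map_zero, form_one, algebraMapInv_cr]
      · refine LinearMap.ext fun y => ?_
        change form b (cr b k x) y = form b y (cr b k x)
        rw [form_cr, form_an]
        exact LinearMap.congr_fun h _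
    exact LinearMap.congr_fun (LinearMap.congr_fun key x) y
  cr_adj := form_cr b
  dg_adj w x y := by
    have key : form b ∘ₗ dg b q w = (LinearMap.lcomp ℂ ℂ (dg b q w)) ∘ₗ form b := by
      refine ext_of_ι_mul b ?_ fun l x h => ?_
      · refine LinearMap.ext fun y => ?_
        change form b (dg b q w 1) y = form b 1 (dg b q w y)
        rw [dg_one_vec, form_one, form_one, algebraMapInv_dg]
      · refine LinearMap.ext fun y => ?_
        have h' (y) : form b (dg b q w x) y = form b x (dg b q w y) := LinearMap.congr_fun h y
        change form b (dg b q w (ExteriorAlgebra.ι ℂ (b l) * x)) y = form b (cr b l x) (dg b q w y)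
        rw [dg_ι_mul, map_smul, LinearMap.smul_apply]
        change _ • form b (cr b l _) y = _
        rw [form_cr, form_cr, h', ← map_smul]
        congr 1
        exact (LinearMap.congr_fun (an_mul_dg b w l) y).symm
    exact LinearMap.congr_fun (LinearMap.congr_fun key x) y
  vac_vac := by rw [form_one, map_one]
  an_vac := an_one b
  exists_supp x := by
    induction x using CliffordAlgebra.left_induction (Q := (0 : QuadraticForm ℂ X)) with
    | algebraMap r => exact ⟨∅, fun k _ => an_algebraMap b k r⟩
    | add x y hx hy =>
      obtain ⟨K, hK⟩ := hx
      obtain ⟨K', hK'⟩ := hy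
      refine ⟨K ∪ K', fun k hk => ?_⟩
      rw [Finset.mem_union, not_or] at hk
      exact (map_add (an b k) x y).trans (by rw [hK k hk.1, hK' k hk.2, add_zero])
    | ι_mul x v hx =>
      obtain ⟨K, hK⟩ := hx
      refine ⟨K ∪ (b.repr v).support, fun k hk => ?_⟩
      rw [Finset.mem_union, not_or, Finsupp.notMem_support_iff] at hk
      refine (an_ι_mul b k v x).trans ?_
      rw [hK k hk.1, hk.2]; simp
  exists_expand x := by
    induction x using CliffordAlgebra.left_induction (Q := (0 : QuadraticForm ℂ X)) with
    | algebraMap r => exact ⟨∅, r, 0, by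
        rw [Finset.sum_empty, add_zero]; exact Algebra.algebraMap_eq_smul_one r⟩
    | add x y hx hy =>
      obtain ⟨K, z, u, hK⟩ := hx
      obtain ⟨K', z', u', hK'⟩ := hy
      refine ⟨K ∪ K', z + z', fun k => (if k ∈ K then u k else 0) + (if k ∈ K' then u' k else 0), ?_⟩
      have e (L : Finset κ) (hL : L ⊆ K ∪ K') (w : κ → ExteriorAlgebra ℂ X) :
          ∑ k ∈ K ∪ K', cr b k (if k ∈ L then w k else 0) = ∑ k ∈ L, cr b k (w k) := by
        rw [← Finset.sum_subset hL]
        · exact Finset.sum_congr rfl fun k hk => by rw [if_pos hk]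
        · intro k _ hk; rw [if_neg hk, map_zero]
      simp_rw [map_add]
      rw [Finset.sum_add_distrib, e K Finset.subset_union_left, e K' Finset.subset_union_right,
        add_smul]
      refine (congrArg₂ (· + ·) hK hK').trans ?_
      exact add_add_add_comm _ _ _ _
    | ι_mul x v hx =>
      refine ⟨(b.repr v).support, 0, fun k => b.repr v k • x, ?_⟩
      rw [zero_smul, zero_add]
      have : v = ∑ k ∈ (b.repr v).support, b.repr v k • b k := (b.linearCombination_repr v).symm
      change ExteriorAlgebra.ι ℂ v * x = _
      nth_rw 1 [this]
      rw [map_sum, Finset.sum_mul]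
      refine Finset.sum_congr rfl fun k _ => ?_
      rw [map_smul, map_smul, smul_mul_assoc]; rfl

end exterior

/-! ### The two families of operators on the grid -/

/-- The transpose of `raiseRow`. -/
def lowerRow {A : Type*} [Ring A] (c a : ℕ × ℕ → A) (D : (ℕ × ℕ → ℤ) → A) (M i : ℕ) : A :=
  ∑ r ∈ Finset.range M, D (rowPre i r) * (c (i + 1, r) * a (i, r))

namespace Fermi

variable {q : ℂ} {H : Type*} [AddCommGroup H] [Module ℂ H] {c a : ℕ × ℕ → Module.End ℂ H}
  {D : (ℕ × ℕ → ℤ) → Module.End ℂ H}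

theorem lowerCol_flip (c a : ℕ × ℕ → Module.End ℂ H) (D : (ℕ × ℕ → ℤ) → Module.End ℂ H) (M i : ℕ) :
    lowerCol (fun k => c (Equiv.prodComm ℕ ℕ k)) (fun k => a (Equiv.prodComm ℕ ℕ k))
      (fun w => D fun k => -w ((Equiv.prodComm ℕ ℕ).symm k)) M i = lowerRow c a D M i := by
  refine Finset.sum_congr rfl fun r _ => ?_
  have : (fun k => -colPre i r ((Equiv.prodComm ℕ ℕ).symm k)) = rowPre i r := by
    funext ⟨x, y⟩
    simp only [rowPre, colPre, Equiv.prodComm_symm, Equiv.prodComm_apply, Prod.swap]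
    split_ifs <;> omega
  simp only [this]
  rfl

/-- The transpose of the commutation of `raiseRow` with `lowerCol`. -/
theorem commute_lowerRow_raiseCol (S : Fermi q c a D) {N M i r : ℕ} (hi : i + 1 < N)
    (hr : r + 1 < M) : Commute (lowerRow c a D M i) (raiseCol c a D N r) := by
  have := (S.flip (Equiv.prodComm ℕ ℕ)).commute_raiseRow_lowerCol hr hi
  rw [raiseRow_flip, lowerCol_flip] at this
  exact this.symm

theorem commute_dg_raiseRow (S : Fermi q c a D) {w : ℕ × ℕ → ℤ} {M i : ℕ}
    (h : ∀ r < M, w (i, r) = w (i + 1, r)) : Commute (D w) (raiseRow c a D M i) :=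
  Commute.sum_right _ _ _ fun r hr =>
    (S.commute_dg_dg _ _).mul_right (S.commute_dg_mv (h r (by simpa using hr)))

theorem commute_dg_lowerRow (S : Fermi q c a D) {w : ℕ × ℕ → ℤ} {M i : ℕ}
    (h : ∀ r < M, w (i, r) = w (i + 1, r)) : Commute (D w) (lowerRow c a D M i) :=
  Commute.sum_right _ _ _ fun r hr =>
    (S.commute_dg_dg _ _).mul_right (S.commute_dg_mv (h r (by simpa using hr)).symm)

theorem commute_dg_raiseCol (S : Fermi q c a D) {w : ℕ × ℕ → ℤ} {N r : ℕ}
    (h : ∀ i < N, w (i, r) = w (i, r + 1)) : Commute (D w) (raiseCol c a D N r) :=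
  Commute.sum_right _ _ _ fun i hi =>
    (S.commute_dg_dg _ _).mul_right (S.commute_dg_mv (h i (by simpa using hi)))

theorem commute_dg_lowerCol (S : Fermi q c a D) {w : ℕ × ℕ → ℤ} {N r : ℕ}
    (h : ∀ i < N, w (i, r) = w (i, r + 1)) : Commute (D w) (lowerCol c a D N r) :=
  Commute.sum_right _ _ _ fun i hi =>
    (S.commute_dg_dg _ _).mul_right (S.commute_dg_mv (h i (by simpa using hi)).symm)

theorem rowW_col (i M : ℕ) {r : ℕ} (hr : r + 1 < M) (j : ℕ) :
    rowW i M (j, r) = rowW i M (j, r + 1) := by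
  simp only [rowW]; congr 1; simp; omega

theorem colBel_row (N r : ℕ) {i : ℕ} (hi : i + 1 < N) (s : ℕ) :
    colBel N r (i, s) = colBel N r (i + 1, s) := by
  simp only [colBel]; congr 1; simp; omega

theorem dg_pos_of_neg (S : Fermi q c a D) {w : ℕ × ℕ → ℤ} {m : ℤ} {x : H}
    (h : D (-w) x = q ^ (-m) • x) : D w x = q ^ m • x := by
  have h1 := congrArg (D w) h
  rw [← Module.End.mul_apply, S.dg_mul_dg, add_neg_cancel, S.dg_zero, map_smul,
    Module.End.one_apply] at h1
  nth_rw 2 [h1]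
  rw [smul_smul, ← zpow_add₀ S.ne_zero, add_neg_cancel, zpow_zero, one_smul]

/-- The sites of the Young diagram `μ` are occupied in `x`, and no others. -/
def IsState (c a : ℕ × ℕ → Module.End ℂ H) (μ : YoungDiagram) (x : H) : Prop :=
  (∀ k ∈ μ, c k x = 0) ∧ ∀ k ∉ μ, a k x = 0

namespace IsState

variable {μ : YoungDiagram} {x : H} {N M : ℕ}

theorem dg_row (S : Fermi q c a D) (hx : IsState c a μ x) {i : ℕ} (hM : μ.rowLen i ≤ M) :
    D (rowW i M) x = q ^ (μ.rowLen i : ℤ) • x := by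
  refine S.dg_pos_of_neg ?_
  rw [S.dg_rowW_apply (r₀ := μ.rowLen i) M (fun s hs => hx.1 _ (YoungDiagram.mem_iff_lt_rowLen.2 hs))
    fun s hs _ => hx.2 _ fun hm => by have := YoungDiagram.mem_iff_lt_rowLen.1 hm; omega,
    min_eq_right hM]

theorem dg_col (S : Fermi q c a D) (hx : IsState c a μ x) {r : ℕ} (hN : μ.colLen r ≤ N) :
    D (colBel N r) x = q ^ (μ.colLen r : ℤ) • x := by
  have := (S.flip (Equiv.prodComm ℕ ℕ)).dg_rowW_apply (p := r) (r₀ := μ.colLen r) (y := x) N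
    (fun s hs => hx.1 _ (YoungDiagram.mem_iff_lt_colLen.2 hs))
    fun s hs _ => hx.2 _ fun hm => by
      have : s < μ.colLen r := YoungDiagram.mem_iff_lt_colLen.1 hm
      omega
  rw [min_eq_right hN, inv_zpow', neg_neg] at this
  rw [← this]
  congr 2
  funext ⟨i, s⟩
  simp [colBel, rowW]

theorem raise_row (S : Fermi q c a D) (hx : IsState c a μ x) (M i : ℕ) :
    raiseRow c a D M i x = 0 := by
  rw [raiseRow, LinearMap.sum_apply]
  refine Finset.sum_eq_zero fun r _ => ?_
  rw [Module.End.mul_apply, Module.End.mul_apply]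
  by_cases h : (i + 1, r) ∈ μ
  · rw [S.cr_an_apply (by simp) (hx.1 _ (μ.up_left_mem (Nat.le_succ i) le_rfl h)), map_zero]
  · rw [hx.2 _ h, map_zero, map_zero]

theorem raise_col (S : Fermi q c a D) (hx : IsState c a μ x) (N r : ℕ) :
    raiseCol c a D N r x = 0 := by
  rw [raiseCol, LinearMap.sum_apply]
  refine Finset.sum_eq_zero fun i _ => ?_
  rw [Module.End.mul_apply, Module.End.mul_apply]
  by_cases h : (i, r + 1) ∈ μ
  · rw [S.cr_an_apply (by simp) (hx.1 _ (μ.up_left_mem le_rfl (Nat.le_succ r) h)), map_zero]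
  · rw [hx.2 _ h, map_zero, map_zero]

end IsState

/-- Common eigenvectors of the torus come with unspecified eigenvalues. Filling or emptying one site
at a time leads down to the empty set, where the eigenvalue is 1, and each step multiplies it by a
power of q. -/
theorem dg_eigenvalue (S : Fermi q c a D) (s : Finset (ℕ × ℕ)) {θ : ℂ} {x : H} (hx0 : x ≠ 0)
    (hx : D (ind s) x = θ • x) : ∃ m : ℤ, θ = q ^ m := by
  induction s using Finset.induction_on generalizing θ x with
  | empty =>
    have : ind ∅ = 0 := by funext; simp [ind]
    rw [this, S.dg_zero, Module.End.one_apply] at hx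
    exact ⟨0, smul_left_injective ℂ hx0 (by simp [← hx])⟩
  | insert k s hk ih =>
    have hk1 : ind (insert k s) k = 1 := by simp [ind]
    by_cases h : a k x = 0
    · have h2 : c k x ≠ 0 := fun h2 => hx0 (S.eq_zero_of_an_of_cr k h h2)
      refine ih h2 ?_
      have h1 := LinearMap.congr_fun (S.dg_mul_cr (ind (insert k s)) k) x
      rw [hk1, LinearMap.smul_apply, Module.End.mul_apply, Module.End.mul_apply, hx, map_smul,
        ind_insert hk, ← S.dg_mul_dg, Module.End.mul_apply,
        ← Module.End.mul_apply (D (Pi.single _ _)), S.dg_single_mul_cr, LinearMap.smul_apply,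
        map_smul, zpow_one] at h1
      exact smul_right_injective _ S.ne_zero h1
    · obtain ⟨m, hm⟩ := ih (θ := q⁻¹ * θ) h (by
        have h1 := LinearMap.congr_fun (S.dg_mul_an (ind (insert k s)) k) x
        rw [hk1, LinearMap.smul_apply, Module.End.mul_apply, Module.End.mul_apply, hx, map_smul,
          smul_smul, zpow_neg_one] at h1
        rw [← h1, ind_insert hk, ← S.dg_mul_dg, Module.End.mul_apply,
          ← Module.End.mul_apply (D (Pi.single _ _)), S.dg_single_mul_an])
      refine ⟨m + 1, ?_⟩
      rw [zpow_add_one₀ S.ne_zero, ← hm, mul_comm q⁻¹, mul_assoc, inv_mul_cancel₀ S.ne_zero, mul_one]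

theorem ind_empty (S : Fermi q c a D) {s : Finset (ℕ × ℕ)}
    (h : ∀ n : ℕ, 0 < n → q ^ n ≠ 1) {x : H} (hx : D (ind s) x = x)
    {k : ℕ × ℕ} (hk : k ∈ s) : a k x = 0 := by
  have hx : D (ind s) x = q ^ (0 : ℤ) • x := by simpa using hx
  rw [← Finset.insert_erase hk] at hx
  exact S.ind_bound _ h (S.ind_an (Finset.notMem_erase k s) hx) (Or.inl (by norm_num))

/-- A vector whose weights are those of a Young diagram is the corresponding state. -/
theorem isState_of_weight (S : Fermi q c a D) (h : ∀ n : ℕ, 0 < n → q ^ n ≠ 1) {N M : ℕ}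
    {μ : YoungDiagram} (hμ : ∀ i r, (i, r) ∈ μ → i < N ∧ r < M) {x : H}
    (supp : ∀ i r, ¬(i < N ∧ r < M) → a (i, r) x = 0)
    (row : ∀ i < N, D (rowW i M) x = q ^ (μ.rowLen i : ℤ) • x)
    (col : ∀ r < M, D (colBel N r) x = q ^ (μ.colLen r : ℤ) • x) : IsState c a μ x := by
  have hrow (i j) : (i, j) ∈ μ ↔ j < μ.rowLen i := YoungDiagram.mem_iff_lt_rowLen
  have hcol (i j) : (i, j) ∈ μ ↔ i < μ.colLen j := YoungDiagram.mem_iff_lt_colLen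
  -- The weight of row i is already used up by the first g occupied sites, so the remaining sites T
  -- of this row contain no particle.
  have tail : ∀ i < N, ∀ g ≤ M, (∀ r < g, c (i, r) x = 0) → μ.rowLen i = g →
      ∀ r, g ≤ r → r < M → a (i, r) x = 0 := by
    intro i hi g hg hc hgi r hr hrM
    set T := (Finset.Ico g M).image fun r => (i, r) with hT
    have e2 : ind T = -rowW i g + rowW i M := by
      funext ⟨x, y⟩
      have : (x, y) ∈ T ↔ x = i ∧ g ≤ y ∧ y < M := by
        rw [hT]
        simp only [Finset.mem_image, Finset.mem_Ico, Prod.mk.injEq]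
        exact ⟨by rintro ⟨r, h1, rfl, rfl⟩; exact ⟨rfl, h1⟩, fun h => ⟨y, h.2, h.1.symm, rfl⟩⟩
      simp only [ind, this, rowW, Pi.add_apply, Pi.neg_apply]
      split_ifs <;> omega
    refine S.ind_empty (s := T) h ?_ (Finset.mem_image.2 ⟨r, by simp; omega, rfl⟩)
    rw [e2, ← S.dg_mul_dg, Module.End.mul_apply, row i hi, map_smul,
      S.dg_rowW_apply (r₀ := g) g hc (fun s hs hs' => by omega), smul_smul,
      ← zpow_add₀ S.ne_zero, hgi, min_self, add_neg_cancel, zpow_zero, one_smul]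
  have hle (i) (hi : i < N) : μ.rowLen i ≤ M := by
    by_contra h1
    have := (hμ i M ((hrow _ _).2 (by omega))).2
    omega
  -- Column by column: if the earlier columns are filled as in μ, rows of length at most j are
  -- exhausted before column j (`emp`). The whole weight of column j then sits in its top μ.colLen j
  -- sites, which are therefore full.
  have key (j : ℕ) : ∀ i, (i, j) ∈ μ → c (i, j) x = 0 := by
    induction j using Nat.strong_induction_on with
    | _ j ih =>
      intro i hi
      have hjM := (hμ i j hi).2
      have emp : ∀ n ≥ μ.colLen j, n < N → a (n, j) x = 0 := by
        intro n hn hnN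
        have hg : μ.rowLen n ≤ j := by
          by_contra h1
          have := (hcol _ _).1 ((hrow n j).2 (by omega)); omega
        exact tail n hnN _ (hle n hnN) (fun r hr => ih r (by omega) n ((hrow _ _).2 hr)) rfl j hg hjM
      have hcN : μ.colLen j ≤ N := by
        by_contra h1
        have := (hμ N j ((hcol _ _).2 (by omega))).1
        omega
      have full : ∀ n, n ≤ N → μ.colLen j ≤ n → D (colBel n j) x = q ^ (μ.colLen j : ℤ) • x := by
        intro n hn
        induction hn using Nat.decreasingInduction with
        | self => exact fun _ => col j hjM
        | of_succ n hn ih' =>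
          intro hn'
          have := ih' (by omega)
          rwa [JointHW.colBel_succ, ← S.dg_mul_dg, Module.End.mul_apply,
            S.dg_single_of_an (emp n hn' (by omega))] at this
      have := full _ hcN le_rfl
      rw [colBel_eq_ind] at this
      refine S.ind_full h this ?_ (Finset.mem_image.2 ⟨i, by simpa using (hcol _ _).1 hi, rfl⟩)
      rw [Finset.card_image_of_injective _ (fun _ _ h => by simpa using h), Finset.card_range]
  refine ⟨fun k hk => key k.2 k.1 hk, fun k hk => ?_⟩
  obtain ⟨i, r⟩ := k
  by_cases hb : i < N ∧ r < M
  · exact tail i hb.1 _ (hle i hb.1) (fun r hr => key _ _ ((hrow _ _).2 hr)) rfl r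
      (by rw [hrow] at hk; omega) hb.2
  · exact supp i r hb

theorem exists_isState (S : Fermi q c a D) (h : ∀ n : ℕ, 0 < n → q ^ n ≠ 1) {N M : ℕ} {x : H}
    (hx : x ≠ 0) (supp : ∀ i r, ¬(i < N ∧ r < M) → a (i, r) x = 0)
    (row : ∀ i < N, ∃ θ : ℂ, D (rowW i M) x = θ • x)
    (col : ∀ r < M, ∃ θ : ℂ, D (colBel N r) x = θ • x)
    (raise_row : ∀ i, i + 1 < N → raiseRow c a D M i x = 0)
    (raise_col : ∀ r, r + 1 < M → raiseCol c a D N r x = 0) :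
    ∃ μ : YoungDiagram, (∀ i r, (i, r) ∈ μ → i < N ∧ r < M) ∧ IsState c a μ x := by
  have row' : ∀ i < N, ∃ m : ℤ, D (rowW i M) x = q ^ m • x := by
    intro i hi
    obtain ⟨θ, hθ⟩ := row i hi
    obtain ⟨m, rfl⟩ := S.dg_eigenvalue _ hx ((rowW_eq_ind i M) ▸ hθ)
    exact ⟨m, hθ⟩
  have col' : ∀ r < M, ∃ m : ℤ, D (colBel N r) x = q ^ m • x := by
    intro i hi
    obtain ⟨θ, hθ⟩ := col i hi
    obtain ⟨m, rfl⟩ := S.dg_eigenvalue _ hx ((colBel_eq_ind N i) ▸ hθ)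
    exact ⟨m, hθ⟩
  choose! ν hν using row'
  choose! κ hκ using col'
  have J : JointHW q c a D N M ν κ x := ⟨hx, supp, hν, hκ, raise_row, raise_col⟩
  obtain ⟨μ, m0, m1, m2⟩ := J.exists_shape S h (N + M + ∑ i ∈ Finset.range N, ν i).toNat _ _ _ _ _
    (Int.self_le_toNat _)
  exact ⟨μ, m0, S.isState_of_weight h m0 supp (fun i hi => m1 i hi ▸ hν i hi)
    fun r hr => m2 r hr ▸ hκ r hr⟩

end Fermi

namespace FermiForm

variable {q : ℂ} {H : Type*} [AddCommGroup H] [Module ℂ H]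
  {c a : ℕ × ℕ → Module.End ℂ H} {D : (ℕ × ℕ → ℤ) → Module.End ℂ H} {vac : H}
  {B : H →ₗ[ℂ] H →ₗ[ℂ] ℂ}

theorem mv_adj (F : FermiForm q c a D vac B) {w : ℕ × ℕ → ℤ} {k l : ℕ × ℕ} (h : w k = w l)
    (x y : H) : B ((D w * (c k * a l)) x) y = B x ((D w * (c l * a k)) y) := by
  rw [(F.commute_dg_mv h).eq]
  simp only [Module.End.mul_apply]
  rw [F.cr_adj, F.an_adj, F.dg_adj]

theorem raiseRow_adj (F : FermiForm q c a D vac B) (M i : ℕ) (x y : H) :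
    B (raiseRow c a D M i x) y = B x (lowerRow c a D M i y) := by
  simp only [raiseRow, lowerRow, LinearMap.sum_apply, map_sum]
  exact Finset.sum_congr rfl fun r _ => F.mv_adj (by simp [rowPre]) x y

theorem raiseCol_adj (F : FermiForm q c a D vac B) (N r : ℕ) (x y : H) :
    B (raiseCol c a D N r x) y = B x (lowerCol c a D N r y) := by
  simp only [raiseCol, lowerCol, LinearMap.sum_apply, map_sum]
  exact Finset.sum_congr rfl fun i _ => F.mv_adj (by simp [colPre]) x y

/-- Adjoint to the commutation of the two raising operators; the form is nondegenerate. -/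
theorem commute_lowerRow_lowerCol (F : FermiForm q c a D vac B) {N M i r : ℕ} (hi : i + 1 < N)
    (hr : r + 1 < M) : Commute (lowerRow c a D M i) (lowerCol c a D N r) :=
  F.commute_of_adj (F.raiseRow_adj M i) (F.raiseCol_adj N r) (F.commute_raiseRow_raiseCol hi hr)

end FermiForm

/-! ### Iterated coproducts on the Fock space -/

/-- The weight `ε_k - ε_l`. -/
def rootW (k l x : ℕ) : ℤ := (if x = k then 1 else 0) - (if x = l then 1 else 0)

/-- The weight `w` on the factors before `r`. -/
def preW (w : ℕ → ℤ) (r : ℕ) (x : ℕ × ℕ) : ℤ := if x.2 < r then w x.1 else 0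

/-- The weight `w` on the factors after `r` and before `m`. -/
def sufW (w : ℕ → ℤ) (m r : ℕ) (x : ℕ × ℕ) : ℤ := if r < x.2 ∧ x.2 < m then w x.1 else 0

section

variable {A : Type*} [Ring A] (c a : ℕ × ℕ → A) (D : (ℕ × ℕ → ℤ) → A)

/-- The iterate of `x ↦ x ⊗ 1 + w ⊗ x` for `x = c k * a l`. -/
def lineOp (w : ℕ → ℤ) (k l m : ℕ) : A :=
  ∑ r ∈ Finset.range m, D (preW w r) * (c (k, r) * a (l, r))

/-- The iterate of `x ↦ x ⊗ w + 1 ⊗ x` for `x = c k * a l`. -/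
def lineOp' (w : ℕ → ℤ) (k l m : ℕ) : A :=
  ∑ r ∈ Finset.range m, D (sufW w m r) * (c (k, r) * a (l, r))

end

namespace Fermi

variable {q : ℂ} {H : Type*} [AddCommGroup H] [Module ℂ H] {c a : ℕ × ℕ → Module.End ℂ H}
  {D : (ℕ × ℕ → ℤ) → Module.End ℂ H}

theorem lineOp_apply (c a : ℕ × ℕ → Module.End ℂ H) (D : (ℕ × ℕ → ℤ) → Module.End ℂ H)
    (w : ℕ → ℤ) (k l m : ℕ) (x : H) :
    lineOp c a D w k l m x = ∑ r ∈ Finset.range m, D (preW w r) (c (k, r) (a (l, r) x)) := by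
  rw [lineOp, LinearMap.sum_apply]; rfl

theorem lineOp'_apply (c a : ℕ × ℕ → Module.End ℂ H) (D : (ℕ × ℕ → ℤ) → Module.End ℂ H)
    (w : ℕ → ℤ) (k l m : ℕ) (x : H) :
    lineOp' c a D w k l m x = ∑ r ∈ Finset.range m, D (sufW w m r) (c (k, r) (a (l, r) x)) := by
  rw [lineOp', LinearMap.sum_apply]; rfl

/-- Diagonal factors on the later columns become factors on the earlier ones after multiplication by
the total weight. The discrepancy at the two sites of the hop costs one factor q, as in `colOp_eq`.
-/
theorem lineOp'_eq (S : Fermi q c a D) {k l : ℕ} (h : k ≠ l) (m : ℕ) :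
    lineOp' c a D (rootW k l) k l m =
      q⁻¹ • (D (preW (rootW k l) m) * lineOp c a D (rootW l k) k l m) := by
  rw [lineOp, lineOp', Finset.mul_sum, Finset.smul_sum]
  refine Finset.sum_congr rfl fun r hr => ?_
  have hr : r < m := by simpa using hr
  have e : preW (rootW k l) m + preW (rootW l k) r =
      sufW (rootW k l) m r + Pi.single (l, r) (-1) + Pi.single (k, r) 1 := by
    funext ⟨x, y⟩
    simp only [preW, sufW, rootW, Pi.add_apply, Pi.single_apply, Prod.mk.injEq]
    split_ifs <;> omega
  rw [← mul_assoc (D (preW _ m)), S.dg_mul_dg, e, ← S.dg_mul_dg, mul_assoc (D (_ + _)),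
    ← mul_assoc (D (Pi.single _ 1)),
    S.dg_single_mul_cr, zpow_one, smul_mul_assoc, mul_smul_comm, inv_smul_smul₀ S.ne_zero,
    ← S.dg_mul_dg, mul_assoc, ← mul_assoc (D (Pi.single _ _)),
    (S.commute_dg_cr (by simp [h])).eq, mul_assoc (c _), S.dg_single_mul_an]

end Fermi

/-! ### Leibniz rules -/

section exterior

variable {κ X : Type} [AddCommGroup X] [Module ℂ X] (b : Module.Basis κ ℂ X) (q : ℂ)

/-- Contraction is an odd derivation; the sign is carried by the automorphism induced by -1. -/
theorem an_mul (k : κ) (x y : ExteriorAlgebra ℂ X) :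
    an b k (x * y) = an b k x * y + ExteriorAlgebra.map (-LinearMap.id) x * an b k y := by
  have key : an b k ∘ₗ LinearMap.mulRight ℂ y = LinearMap.mulRight ℂ y ∘ₗ an b k +
      LinearMap.mulRight ℂ (an b k y) ∘ₗ (ExteriorAlgebra.map (-LinearMap.id)).toLinearMap := by
    refine ext_of_ι_mul b ?_ fun l x h => ?_
    · change an b k (1 * y) = an b k 1 * y + ExteriorAlgebra.map (-LinearMap.id) 1 * an b k y
      rw [an_one, map_one, one_mul, one_mul, zero_mul, zero_add]
    · have h : an b k (x * y) =
        an b k x * y + ExteriorAlgebra.map (-LinearMap.id) x * an b k y := h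
      change an b k (ExteriorAlgebra.ι ℂ (b l) * x * y) = an b k (ExteriorAlgebra.ι ℂ (b l) * x) * y
        + ExteriorAlgebra.map (-LinearMap.id) (ExteriorAlgebra.ι ℂ (b l) * x) * an b k y
      rw [mul_assoc, an_ι_mul, an_ι_mul, h, map_mul, ExteriorAlgebra.map_apply_ι,
        LinearMap.neg_apply, LinearMap.id_apply, map_neg, sub_mul, mul_add, smul_mul_assoc, neg_mul,
        neg_mul, mul_assoc, mul_assoc]
      abel
  exact LinearMap.congr_fun key x

/-- The signs from c k and a l cancel, so a hop is an ordinary derivation. This is why the coproduct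
needs no graded correction. -/
theorem cr_an_mul (k l : κ) (x y : ExteriorAlgebra ℂ X) :
    cr b k (an b l (x * y)) = cr b k (an b l x) * y + x * cr b k (an b l y) := by
  have e : cr b k (ExteriorAlgebra.map (-LinearMap.id) x * an b l y) = x * cr b k (an b l y) := by
    rw [cr_apply, cr_apply, ← mul_assoc, ι_mul_eq, ← AlgHom.comp_apply,
      ExteriorAlgebra.map_comp_map, LinearMap.comp_neg, LinearMap.neg_comp, LinearMap.comp_id,
      neg_neg, ExteriorAlgebra.map_id, AlgHom.id_apply, mul_assoc]
  rw [an_mul]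
  refine (map_add (cr b k) _ _).trans ?_
  rw [e, cr_apply b k (an b l x), mul_assoc, ← cr_apply]

theorem dg_mul (w : κ → ℤ) (x y : ExteriorAlgebra ℂ X) :
    dg b q w (x * y) = dg b q w x * dg b q w y := map_mul (ExteriorAlgebra.map _) x y

end exterior

theorem create_eq {n : ℕ} (i : Fin n) : create i = cr (Pi.basisFun ℂ (Fin n)) i := by
  rw [create, cr, Pi.basisFun_apply]; rfl

theorem annih_eq {n : ℕ} (i : Fin n) : annih i = an (Pi.basisFun ℂ (Fin n)) i := by
  rw [annih, an]
  congr 1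

section fock

variable {n : ℕ} {q : ℂ} (hq : q ≠ 0) (hq2 : q ^ 2 ≠ 1)

theorem fockRep_e (i : Fin (n - 1)) (x : Fock n) : fockRep n hq hq2 (Uq.e q i) x =
    cr (Pi.basisFun ℂ (Fin n)) (lo i) (an (Pi.basisFun ℂ (Fin n)) (hi i) x) := by
  rw [fockRep, Uq.lift_e, create_eq, annih_eq]; rfl

theorem fockRep_f (i : Fin (n - 1)) (x : Fock n) : fockRep n hq hq2 (Uq.f q i) x =
    cr (Pi.basisFun ℂ (Fin n)) (hi i) (an (Pi.basisFun ℂ (Fin n)) (lo i) x) := by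
  rw [fockRep, Uq.lift_f, create_eq, annih_eq]; rfl

theorem dg_single_eq {q z : ℂ} (m : ℤ) (h : q ^ m = z) {n : ℕ} (i : Fin n) (x : Fock n) :
    (z • (create i * annih i) + annih i * create i) x =
      dg (Pi.basisFun ℂ (Fin n)) q (Pi.single i m) x := by
  rw [dg_single, create_eq, annih_eq, an_cr_self, ← h]
  change q ^ m • cr _ i (an _ i x) + (x - cr _ i (an _ i x)) =
    x + (q ^ m - 1) • cr _ i (an _ i x)
  module

theorem fockRep_t (i : Fin n) (x : Fock n) : fockRep n hq hq2 (Uq.t q i) x =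
    dg (Pi.basisFun ℂ (Fin n)) q (Pi.single i 1) x := by
  rw [fockRep, Uq.lift_t]; exact dg_single_eq 1 (zpow_one q) i x

theorem fockRep_tinv (i : Fin n) (x : Fock n) : fockRep n hq hq2 (Uq.tinv q i) x =
    dg (Pi.basisFun ℂ (Fin n)) q (Pi.single i (-1)) x := by
  rw [fockRep, Uq.lift_tinv]; exact dg_single_eq (-1) (zpow_neg_one q) i x

theorem dg_dg_apply {κ X : Type} [AddCommGroup X] [Module ℂ X] (b : Module.Basis κ ℂ X) (hq : q ≠ 0)
    (w w' : κ → ℤ) (x : ExteriorAlgebra ℂ X) : dg b q w (dg b q w' x) = dg b q (w + w') x :=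
  LinearMap.congr_fun (dg_mul_dg b hq w w') x

end fock

/-! ### Tensor powers of Fock spaces inside the grid -/

section wedge

variable {X : Type} [AddCommGroup X] [Module ℂ X] (b : Module.Basis (ℕ × ℕ) ℂ X) (n : ℕ)

/-- The inclusion of `ℂⁿ` as the `r`-th factor. -/
def factor (r : ℕ) : Vec n →ₗ[ℂ] X := (Pi.basisFun ℂ (Fin n)).constr ℂ fun i => b (i.1, r)

theorem factor_basis (r : ℕ) (i : Fin n) : factor b n r (Pi.basisFun ℂ (Fin n) i) = b (i.1, r) :=
  Module.Basis.constr_basis _ _ _ _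

/-- The map from the tensor power given by the inclusions of all factors. -/
def wedge (m : ℕ) : (⨂[ℂ]^m (Fock n)) →ₗ[ℂ] ExteriorAlgebra ℂ X :=
  wedgeMap fun r : Fin m => factor b n r

variable {n}

/-- Appending a tensor factor becomes right multiplication by its image, which turns the recursive
definition of `tensorRep` into an induction on products. -/
theorem wedge_snoc (m : ℕ) (z : ⨂[ℂ]^m (Fock n)) (ζ : Fock n) :
    wedge b n (m + 1) (snocEquiv (Fock n) m (z ⊗ₜ ζ)) =
      wedge b n m z * ExteriorAlgebra.map (factor b n m) ζ := by
  induction z using PiTensorProduct.induction_on with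
  | smul_tprod s ω =>
    rw [map_smul, smul_mul_assoc, ← TensorProduct.smul_tmul', map_smul, map_smul]
    congr 1
    have : snocEquiv (Fock n) m (PiTensorProduct.tprod ℂ ω ⊗ₜ ζ) =
        PiTensorProduct.tprod ℂ (Fin.append ω fun _ : Fin 1 => ζ) := by
      rw [snocEquiv, LinearEquiv.trans_apply, TensorProduct.congr_tmul]
      have h2 : (PiTensorProduct.subsingletonEquiv (R := ℂ) (s := fun _ => Fock n)
          (0 : Fin 1)).symm ζ = PiTensorProduct.tprod ℂ fun _ => ζ := by
        rw [LinearEquiv.symm_apply_eq, PiTensorProduct.subsingletonEquiv_apply_tprod]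
      rw [h2]
      exact TensorPower.tprod_mul_tprod ℂ ω _
    rw [this, wedge, wedge, wedgeMap_tprod, wedgeMap_tprod, List.ofFn_succ', List.concat_eq_append,
      List.prod_append, List.prod_singleton]
    congr 2
    · congr 2
      funext r
      exact congrArg _ (Fin.append_left ω _ r)
    · exact Fin.append_right ω (fun _ : Fin 1 => ζ) 0
  | add x y hx hy => rw [TensorProduct.add_tmul, map_add, map_add, hx, hy, map_add, add_mul]

theorem wedge_zero (z : ⨂[ℂ]^0 (Fock n)) : ∃ s : ℂ, wedge b n 0 z = s • 1 := by
  induction z using PiTensorProduct.induction_on with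
  | smul_tprod s ω => exact ⟨s, by rw [map_smul, wedge, wedgeMap_tprod]; simp⟩
  | add x y hx hy =>
    obtain ⟨s, hs⟩ := hx
    obtain ⟨t, ht⟩ := hy
    exact ⟨s + t, by rw [map_add, hs, ht, add_smul]⟩

theorem snoc_induction {m : ℕ} {P : (⨂[ℂ]^(m + 1) (Fock n)) → Prop}
    (h : ∀ z ζ, P (snocEquiv (Fock n) m (z ⊗ₜ ζ))) (hadd : ∀ x y, P x → P y → P (x + y)) (z) :
    P z := by
  obtain ⟨t, rfl⟩ := (snocEquiv (Fock n) m).surjective z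
  induction t using TensorProduct.induction_on with
  | zero => simpa using h 0 0
  | tmul z ζ => exact h z ζ
  | add x y hx hy => rw [map_add]; exact hadd _ _ hx hy

theorem an_map_factor_ne {i s r : ℕ} (h : s ≠ r) (ζ : Fock n) :
    an b (i, s) (ExteriorAlgebra.map (factor b n r) ζ) = 0 := by
  have key : an b (i, s) ∘ₗ (ExteriorAlgebra.map (factor b n r)).toLinearMap = 0 := by
    refine ext_of_ι_mul (Pi.basisFun ℂ (Fin n)) ?_ fun l x hx => ?_
    · change an b (i, s) (ExteriorAlgebra.map (factor b n r) 1) = 0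
      rw [map_one, an_one]
    · have hx : an b (i, s) (ExteriorAlgebra.map (factor b n r) x) = 0 := hx
      change an b (i, s) (ExteriorAlgebra.map (factor b n r) (_ * x)) = 0
      rw [map_mul, ExteriorAlgebra.map_apply_ι, an_ι_mul, hx, mul_zero, sub_zero, factor_basis,
        Module.Basis.repr_self, Finsupp.single_apply, if_neg (by simp [Ne.symm h]), zero_smul]
  exact LinearMap.congr_fun key ζ

theorem an_map_factor (r : ℕ) (i : Fin n) (ζ : Fock n) :
    an b (i.1, r) (ExteriorAlgebra.map (factor b n r) ζ) =
      ExteriorAlgebra.map (factor b n r) (an (Pi.basisFun ℂ (Fin n)) i ζ) := by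
  have key : an b (i.1, r) ∘ₗ (ExteriorAlgebra.map (factor b n r)).toLinearMap =
      (ExteriorAlgebra.map (factor b n r)).toLinearMap ∘ₗ an (Pi.basisFun ℂ (Fin n)) i := by
    refine ext_of_ι_mul (Pi.basisFun ℂ (Fin n)) ?_ fun l x hx => ?_
    · change an b (i.1, r) (ExteriorAlgebra.map (factor b n r) 1) =
        ExteriorAlgebra.map (factor b n r) (an _ i 1)
      rw [map_one, an_one, an_one, map_zero]
    · have hx : an b (i.1, r) (ExteriorAlgebra.map (factor b n r) x) =
        ExteriorAlgebra.map (factor b n r) (an _ i x) := hx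
      change an b (i.1, r) (ExteriorAlgebra.map (factor b n r) (_ * x)) =
        ExteriorAlgebra.map (factor b n r) (an _ i (_ * x))
      rw [map_mul, ExteriorAlgebra.map_apply_ι, an_ι_mul, an_ι_mul, hx, map_sub, map_smul, map_mul,
        ExteriorAlgebra.map_apply_ι, factor_basis, Module.Basis.repr_self, Module.Basis.repr_self]
      congr 2
      simp [Finsupp.single_apply, Fin.ext_iff]
  exact LinearMap.congr_fun key ζ

theorem cr_map_factor (r : ℕ) (i : Fin n) (ζ : Fock n) :
    cr b (i.1, r) (ExteriorAlgebra.map (factor b n r) ζ) =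
      ExteriorAlgebra.map (factor b n r) (cr (Pi.basisFun ℂ (Fin n)) i ζ) := by
  rw [cr_apply, cr_apply, map_mul, ExteriorAlgebra.map_apply_ι, factor_basis]

theorem dg_map_factor (q : ℂ) (w : ℕ × ℕ → ℤ) (w' : Fin n → ℤ) (r : ℕ)
    (h : ∀ i : Fin n, w (i.1, r) = w' i) (ζ : Fock n) :
    dg b q w (ExteriorAlgebra.map (factor b n r) ζ) =
      ExteriorAlgebra.map (factor b n r) (dg (Pi.basisFun ℂ (Fin n)) q w' ζ) := by
  have key : dg b q w ∘ₗ (ExteriorAlgebra.map (factor b n r)).toLinearMap =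
      (ExteriorAlgebra.map (factor b n r)).toLinearMap ∘ₗ dg (Pi.basisFun ℂ (Fin n)) q w' := by
    refine ext_of_ι_mul (Pi.basisFun ℂ (Fin n)) ?_ fun l x hx => ?_
    · change dg b q w (ExteriorAlgebra.map (factor b n r) 1) =
        ExteriorAlgebra.map (factor b n r) (dg _ q w' 1)
      rw [map_one, dg_one_vec, dg_one_vec, map_one]
    · have hx : dg b q w (ExteriorAlgebra.map (factor b n r) x) =
        ExteriorAlgebra.map (factor b n r) (dg _ q w' x) := hx
      change dg b q w (ExteriorAlgebra.map (factor b n r) (_ * x)) =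
        ExteriorAlgebra.map (factor b n r) (dg _ q w' (_ * x))
      rw [map_mul, ExteriorAlgebra.map_apply_ι, factor_basis, dg_ι_mul, dg_ι_mul, hx, map_smul,
        map_mul, ExteriorAlgebra.map_apply_ι, factor_basis, h]
  exact LinearMap.congr_fun key ζ

theorem dg_zero_apply {κ : Type} (b : Module.Basis κ ℂ X) (q : ℂ) (x : ExteriorAlgebra ℂ X) :
    dg b q 0 x = x := LinearMap.congr_fun (dg_zero b) x

theorem an_wedge {i r m : ℕ} (h : m ≤ r) (z : ⨂[ℂ]^m (Fock n)) : an b (i, r) (wedge b n m z) = 0 := by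
  induction m with
  | zero =>
    obtain ⟨s, hs⟩ := wedge_zero b z
    rw [hs, map_smul, an_one, smul_zero]
  | succ m ih =>
    induction z using snoc_induction with
    | h z ζ =>
      rw [wedge_snoc, an_mul, ih (by omega), an_map_factor_ne b (by omega), zero_mul, mul_zero,
        add_zero]
    | hadd x y hx hy =>
      rw [map_add]; exact (map_add (an b (i, r)) _ _).trans (by rw [hx, hy, add_zero])

theorem dg_wedge (q : ℂ) {w w' : ℕ × ℕ → ℤ} {m : ℕ} (h : ∀ i r, r < m → w (i, r) = w' (i, r))
    (z : ⨂[ℂ]^m (Fock n)) : dg b q w (wedge b n m z) = dg b q w' (wedge b n m z) := by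
  induction m with
  | zero =>
    obtain ⟨s, hs⟩ := wedge_zero b z
    rw [hs, map_smul, map_smul, dg_one_vec, dg_one_vec]
  | succ m ih =>
    induction z using snoc_induction with
    | h z ζ =>
      rw [wedge_snoc, dg_mul, dg_mul, ih (fun i r hr => h i r (by omega)),
        dg_map_factor b q w (fun i => w (i.1, m)) m (fun _ => rfl),
        dg_map_factor b q w' (fun i => w (i.1, m)) m (fun i => (h _ _ (by omega)).symm)]
    | hadd x y hx hy => rw [map_add, map_add, map_add, hx, hy]

/-- By the Leibniz rule each hop acts on one side of the product: for r < m the last factor has no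
particle in column r, and for r = m the earlier factors have none in column m. The result has the
shape of x ⊗ 1 + g ⊗ x. -/
theorem lineOp_wedge_snoc (q : ℂ) (w : ℕ → ℤ) (k l : Fin n) {m : ℕ} (z : ⨂[ℂ]^m (Fock n))
    (ζ : Fock n) : lineOp (cr b) (an b) (dg b q) w k l (m + 1)
        (wedge b n (m + 1) (snocEquiv (Fock n) m (z ⊗ₜ ζ))) =
      lineOp (cr b) (an b) (dg b q) w k l m (wedge b n m z) *
          ExteriorAlgebra.map (factor b n m) ζ +
        dg b q (preW w m) (wedge b n m z) * ExteriorAlgebra.map (factor b n m)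
          (cr (Pi.basisFun ℂ (Fin n)) k (an (Pi.basisFun ℂ (Fin n)) l ζ)) := by
  rw [wedge_snoc, Fermi.lineOp_apply, Finset.sum_range_succ, Fermi.lineOp_apply, Finset.sum_mul]
  congr 1
  · refine Finset.sum_congr rfl fun r hr => ?_
    have hr : r < m := by simpa using hr
    rw [cr_an_mul, an_map_factor_ne b (by omega), map_zero, mul_zero, add_zero, dg_mul,
      dg_map_factor b q (preW w r) 0 m (fun i => by simp [preW]; omega), dg_zero_apply]
  · rw [cr_an_mul, an_wedge b le_rfl, map_zero, zero_mul, zero_add, an_map_factor, cr_map_factor,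
      dg_mul, dg_map_factor b q (preW w m) 0 m (fun i => by simp [preW]), dg_zero_apply]

theorem lineOp'_wedge_snoc {q : ℂ} (hq : q ≠ 0) (w : ℕ → ℤ) (w' : Fin n → ℤ) (hw : ∀ i : Fin n, w i = w' i)
    (k l : Fin n) {m : ℕ} (z : ⨂[ℂ]^m (Fock n))
    (ζ : Fock n) : lineOp' (cr b) (an b) (dg b q) w k l (m + 1)
        (wedge b n (m + 1) (snocEquiv (Fock n) m (z ⊗ₜ ζ))) =
      lineOp' (cr b) (an b) (dg b q) w k l m (wedge b n m z) *
          ExteriorAlgebra.map (factor b n m) (dg (Pi.basisFun ℂ (Fin n)) q w' ζ) +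
        wedge b n m z * ExteriorAlgebra.map (factor b n m)
          (cr (Pi.basisFun ℂ (Fin n)) k (an (Pi.basisFun ℂ (Fin n)) l ζ)) := by
  rw [wedge_snoc, Fermi.lineOp'_apply, Finset.sum_range_succ, Fermi.lineOp'_apply, Finset.sum_mul]
  congr 1
  · refine Finset.sum_congr rfl fun r hr => ?_
    have hr : r < m := by simpa using hr
    rw [cr_an_mul, an_map_factor_ne b (by omega), map_zero, mul_zero, add_zero, dg_mul,
      dg_map_factor b q (sufW w (m + 1) r) w' m (fun i => by simp [sufW, hr, hw])]
    congr 1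
    -- The suffix weights for m and m + 1 differ only in column m, which is invisible on the earlier
    -- factors. To compare them there, the diagonal operator is moved past the hop; its weight at
    -- column r is zero.
    have hc (w : ℕ × ℕ → ℤ) (h1 : w (k, r) = w (l, r)) :
        dg b q w (cr b (k, r) (an b (l, r) (wedge b n m z))) =
          cr b (k, r) (an b (l, r) (dg b q w (wedge b n m z))) :=
      LinearMap.congr_fun ((fermi b hq).commute_dg_mv h1).eq _
    rw [hc _ (by simp [sufW]), hc _ (by simp [sufW]), dg_wedge b q (w' := sufW w m r)
      (fun i s hs => by simp [sufW, hs, Nat.lt_succ_of_lt hs])]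
  · have h0 : sufW w (m + 1) m = 0 := by funext x; simp [sufW]
    rw [cr_an_mul, an_wedge b le_rfl, map_zero, zero_mul, zero_add, an_map_factor, cr_map_factor,
      h0, dg_zero_apply]

theorem preW_wedge_snoc (q : ℂ) (w : ℕ → ℤ) (w' : Fin n → ℤ) (hw : ∀ i : Fin n, w i = w' i)
    {m : ℕ} (z : ⨂[ℂ]^m (Fock n)) (ζ : Fock n) :
    dg b q (preW w (m + 1)) (wedge b n (m + 1) (snocEquiv (Fock n) m (z ⊗ₜ ζ))) =
      dg b q (preW w m) (wedge b n m z) *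
        ExteriorAlgebra.map (factor b n m) (dg (Pi.basisFun ℂ (Fin n)) q w' ζ) := by
  rw [wedge_snoc, dg_mul, dg_map_factor b q (preW w (m + 1)) w' m (fun i => by simp [preW, hw]),
    dg_wedge b q (w' := preW w m) (fun i s hs => by simp [preW, hs, Nat.lt_succ_of_lt hs])]

end wedge

/-! ### The action of the generators on a tensor power -/

section tensorRep

variable {n : ℕ} {q : ℂ} (hq : q ≠ 0) (hq2 : q ^ 2 ≠ 1)

/-- The action of `u` through `Δ`, if `Δ u` is a sum of two pure tensors. -/
theorem tensorRep_succ {Δ : Uq n q →ₐ[ℂ] Uq n q ⊗[ℂ] Uq n q} {X : Type} [AddCommGroup X] [Module ℂ X]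
    (ρ : Uq n q →ₐ[ℂ] Module.End ℂ X) {u u₁ u₂ u₃ u₄ : Uq n q}
    (h : Δ u = u₁ ⊗ₜ u₂ + u₃ ⊗ₜ u₄) (m : ℕ) (z : ⨂[ℂ]^m X) (ζ : X) :
    tensorRep Δ ρ (m + 1) u (snocEquiv X m (z ⊗ₜ ζ)) =
      snocEquiv X m (tensorRep Δ ρ m u₁ z ⊗ₜ ρ u₂ ζ) +
        snocEquiv X m (tensorRep Δ ρ m u₃ z ⊗ₜ ρ u₄ ζ) := by
  change snocEquiv X m (Module.endTensorEndAlgHom (R := ℂ) (S := ℂ) (A := ℂ)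
    (Algebra.TensorProduct.map (tensorRep Δ ρ m) ρ (Δ u))
      ((snocEquiv X m).symm (snocEquiv X m (z ⊗ₜ ζ)))) = _
  rw [LinearEquiv.symm_apply_apply, h, map_add, map_add, LinearMap.add_apply, map_add,
    Algebra.TensorProduct.map_tmul, Algebra.TensorProduct.map_tmul]
  rfl

theorem tensorRep_succ_tmul {Δ : Uq n q →ₐ[ℂ] Uq n q ⊗[ℂ] Uq n q} {X : Type} [AddCommGroup X]
    [Module ℂ X] (ρ : Uq n q →ₐ[ℂ] Module.End ℂ X) {u u₁ u₂ : Uq n q}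
    (h : Δ u = u₁ ⊗ₜ u₂) (m : ℕ) (z : ⨂[ℂ]^m X) (ζ : X) :
    tensorRep Δ ρ (m + 1) u (snocEquiv X m (z ⊗ₜ ζ)) =
      snocEquiv X m (tensorRep Δ ρ m u₁ z ⊗ₜ ρ u₂ ζ) := by
  rw [tensorRep_succ (u₁ := u₁) (u₂ := u₂) (u₃ := 0) (u₄ := 0) ρ (by rw [h]; simp)]; simp

theorem tensorRep_zero (Δ : Uq n q →ₐ[ℂ] Uq n q ⊗[ℂ] Uq n q) {X : Type} [AddCommGroup X]
    [Module ℂ X] (ρ : Uq n q →ₐ[ℂ] Module.End ℂ X) (u : Uq n q) (z : ⨂[ℂ]^0 X) :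
    tensorRep Δ ρ 0 u z = Uq.counit n q u • z := by
  change algebraMap ℂ (Module.End ℂ (⨂[ℂ]^0 X)) (Uq.counit n q u) z = _
  rw [Module.algebraMap_end_apply]

theorem comul_e (i : Fin (n - 1)) :
    Uq.comul n hq (Uq.e q i) = Uq.e q i ⊗ₜ 1 + Uq.k q i ⊗ₜ Uq.e q i := Uq.lift_e _ _ _ _ _ i

theorem comul_f (i : Fin (n - 1)) :
    Uq.comul n hq (Uq.f q i) = Uq.f q i ⊗ₜ Uq.kinv q i + 1 ⊗ₜ Uq.f q i := Uq.lift_f _ _ _ _ _ i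

theorem comul_t (i : Fin n) : Uq.comul n hq (Uq.t q i) = Uq.t q i ⊗ₜ Uq.t q i :=
  Uq.lift_t _ _ _ _ _ i

theorem comul_tinv (i : Fin n) : Uq.comul n hq (Uq.tinv q i) = Uq.tinv q i ⊗ₜ Uq.tinv q i :=
  Uq.lift_tinv _ _ _ _ _ i

theorem comulOp_apply (u : Uq n q) :
    Uq.comulOp n hq u = Algebra.TensorProduct.comm ℂ _ _ (Uq.comul n hq u) := rfl

theorem comulOp_e (i : Fin (n - 1)) :
    Uq.comulOp n hq (Uq.e q i) = Uq.e q i ⊗ₜ Uq.k q i + 1 ⊗ₜ Uq.e q i := by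
  rw [comulOp_apply, comul_e, map_add, Algebra.TensorProduct.comm_tmul,
    Algebra.TensorProduct.comm_tmul, add_comm]

theorem comulOp_f (i : Fin (n - 1)) :
    Uq.comulOp n hq (Uq.f q i) = Uq.f q i ⊗ₜ 1 + Uq.kinv q i ⊗ₜ Uq.f q i := by
  rw [comulOp_apply, comul_f, map_add, Algebra.TensorProduct.comm_tmul,
    Algebra.TensorProduct.comm_tmul, add_comm]

theorem comulOp_t (i : Fin n) : Uq.comulOp n hq (Uq.t q i) = Uq.t q i ⊗ₜ Uq.t q i := by
  rw [comulOp_apply, comul_t, Algebra.TensorProduct.comm_tmul]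

theorem comulOp_tinv (i : Fin n) :
    Uq.comulOp n hq (Uq.tinv q i) = Uq.tinv q i ⊗ₜ Uq.tinv q i := by
  rw [comulOp_apply, comul_tinv, Algebra.TensorProduct.comm_tmul]

variable {X : Type} [AddCommGroup X] [Module ℂ X] (b : Module.Basis (ℕ × ℕ) ℂ X)
  {Δ : Uq n q →ₐ[ℂ] Uq n q ⊗[ℂ] Uq n q}

theorem tensorRep_grouplike {u : Uq n q} (h : Δ u = u ⊗ₜ u) (h0 : Uq.counit n q u = 1) (w : ℕ → ℤ)
    (w' : Fin n → ℤ) (hw : ∀ i : Fin n, w i = w' i)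
    (hu : ∀ ζ, fockRep n hq hq2 u ζ = dg (Pi.basisFun ℂ (Fin n)) q w' ζ) (m : ℕ)
    (z : ⨂[ℂ]^m (Fock n)) : wedge b n m (tensorRep Δ (fockRep n hq hq2) m u z) =
      dg b q (preW w m) (wedge b n m z) := by
  induction m with
  | zero =>
    rw [tensorRep_zero, h0, one_smul]
    have : preW w 0 = 0 := by funext x; simp [preW]
    rw [this, dg_zero_apply]
  | succ m ih =>
    induction z using snoc_induction with
    | h z ζ =>
      rw [tensorRep_succ_tmul _ h, wedge_snoc, ih, hu, preW_wedge_snoc b q w w' hw]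
    | hadd x y hx hy => rw [map_add, map_add, hx, hy, map_add, map_add]

theorem tensorRep_skew {u g : Uq n q} (h : Δ u = u ⊗ₜ 1 + g ⊗ₜ u) (h0 : Uq.counit n q u = 0)
    (w : ℕ → ℤ) (k l : Fin n) (hg : ∀ m (z : ⨂[ℂ]^m (Fock n)),
      wedge b n m (tensorRep Δ (fockRep n hq hq2) m g z) = dg b q (preW w m) (wedge b n m z))
    (hu : ∀ ζ, fockRep n hq hq2 u ζ = cr (Pi.basisFun ℂ (Fin n)) k (an (Pi.basisFun ℂ (Fin n)) l ζ))
    (m : ℕ) (z : ⨂[ℂ]^m (Fock n)) : wedge b n m (tensorRep Δ (fockRep n hq hq2) m u z) =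
      lineOp (cr b) (an b) (dg b q) w k l m (wedge b n m z) := by
  induction m with
  | zero =>
    rw [tensorRep_zero, h0, zero_smul, Fermi.lineOp_apply]; simp
  | succ m ih =>
    induction z using snoc_induction with
    | h z ζ =>
      rw [tensorRep_succ _ h, map_add, wedge_snoc, wedge_snoc, ih, hu, hg, lineOp_wedge_snoc, map_one]
      rfl
    | hadd x y hx hy =>
      rw [map_add, map_add, hx, hy, map_add]
      exact (map_add (lineOp (cr b) (an b) (dg b q) w k l (m + 1)) _ _).symm

theorem tensorRep_skew' {u g : Uq n q} (h : Δ u = u ⊗ₜ g + 1 ⊗ₜ u) (h0 : Uq.counit n q u = 0)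
    (w : ℕ → ℤ) (w' : Fin n → ℤ) (hw : ∀ i : Fin n, w i = w' i) (k l : Fin n)
    (hg : ∀ ζ, fockRep n hq hq2 g ζ = dg (Pi.basisFun ℂ (Fin n)) q w' ζ)
    (hu : ∀ ζ, fockRep n hq hq2 u ζ = cr (Pi.basisFun ℂ (Fin n)) k (an (Pi.basisFun ℂ (Fin n)) l ζ))
    (m : ℕ) (z : ⨂[ℂ]^m (Fock n)) : wedge b n m (tensorRep Δ (fockRep n hq hq2) m u z) =
      lineOp' (cr b) (an b) (dg b q) w k l m (wedge b n m z) := by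
  induction m with
  | zero =>
    rw [tensorRep_zero, h0, zero_smul, Fermi.lineOp'_apply]; simp
  | succ m ih =>
    induction z using snoc_induction with
    | h z ζ =>
      rw [tensorRep_succ _ h, map_add, wedge_snoc, wedge_snoc, ih, hu, hg,
        lineOp'_wedge_snoc b hq w w' hw, map_one]
      rfl
    | hadd x y hx hy =>
      rw [map_add, map_add, hx, hy, map_add]
      exact (map_add (lineOp' (cr b) (an b) (dg b q) w k l (m + 1)) _ _).symm

theorem counit_e (i : Fin (n - 1)) : Uq.counit n q (Uq.e q i) = 0 := Uq.lift_e _ _ _ _ _ i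
theorem counit_f (i : Fin (n - 1)) : Uq.counit n q (Uq.f q i) = 0 := Uq.lift_f _ _ _ _ _ i
theorem counit_t (i : Fin n) : Uq.counit n q (Uq.t q i) = 1 := Uq.lift_t _ _ _ _ _ i
theorem counit_tinv (i : Fin n) : Uq.counit n q (Uq.tinv q i) = 1 := Uq.lift_tinv _ _ _ _ _ i

/-- The weight of `t_i`. -/
def unitW (i x : ℕ) : ℤ := if x = i then 1 else 0

theorem unitW_eq (i x : Fin n) : unitW i x = (Pi.single i 1 : Fin n → ℤ) x := by
  simp [unitW, Pi.single_apply, Fin.ext_iff]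

theorem neg_unitW_eq (i x : Fin n) : (-unitW i) x = (Pi.single i (-1) : Fin n → ℤ) x := by
  simp only [unitW, Pi.single_apply, Fin.ext_iff, Pi.neg_apply]; split_ifs <;> simp

theorem rootW_eq (i j x : Fin n) :
    rootW i j x = (Pi.single i 1 + Pi.single j (-1) : Fin n → ℤ) x := by
  simp only [rootW, Pi.add_apply, Pi.single_apply, Fin.ext_iff]; split_ifs <;> simp

theorem fockRep_t_tinv (i j : Fin n) (ζ : Fock n) : fockRep n hq hq2 (Uq.t q i * Uq.tinv q j) ζ =
    dg (Pi.basisFun ℂ (Fin n)) q (Pi.single i 1 + Pi.single j (-1)) ζ := by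
  rw [map_mul]
  change fockRep n hq hq2 (Uq.t q i) (fockRep n hq hq2 (Uq.tinv q j) ζ) = _
  rw [fockRep_t, fockRep_tinv, dg_dg_apply _ hq]

theorem tensorRep_t (h : ∀ i, Δ (Uq.t q i) = Uq.t q i ⊗ₜ Uq.t q i) (i : Fin n) (m : ℕ)
    (z : ⨂[ℂ]^m (Fock n)) :
    wedge b n m (tensorRep Δ (fockRep n hq hq2) m (Uq.t q i) z) =
      dg b q (preW (unitW i) m) (wedge b n m z) :=
  tensorRep_grouplike hq hq2 b (h i) (counit_t i) _ _ (unitW_eq i) (fockRep_t hq hq2 i) m z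

theorem tensorRep_tinv (h : ∀ i, Δ (Uq.tinv q i) = Uq.tinv q i ⊗ₜ Uq.tinv q i) (i : Fin n) (m : ℕ)
    (z : ⨂[ℂ]^m (Fock n)) :
    wedge b n m (tensorRep Δ (fockRep n hq hq2) m (Uq.tinv q i) z) =
      dg b q (preW (-unitW i) m) (wedge b n m z) :=
  tensorRep_grouplike hq hq2 b (h i) (counit_tinv i) _ _ (neg_unitW_eq i) (fockRep_tinv hq hq2 i) m z

theorem tensorRep_t_tinv (h : ∀ i, Δ (Uq.t q i) = Uq.t q i ⊗ₜ Uq.t q i)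
    (h' : ∀ i, Δ (Uq.tinv q i) = Uq.tinv q i ⊗ₜ Uq.tinv q i) (i j : Fin n) (m : ℕ)
    (z : ⨂[ℂ]^m (Fock n)) :
    wedge b n m (tensorRep Δ (fockRep n hq hq2) m (Uq.t q i * Uq.tinv q j) z) =
      dg b q (preW (rootW i j) m) (wedge b n m z) :=
  tensorRep_grouplike hq hq2 b
    (by rw [map_mul, h, h', Algebra.TensorProduct.tmul_mul_tmul])
    (by rw [map_mul, counit_t, counit_tinv, one_mul]) _ _ (rootW_eq i j)
    (fockRep_t_tinv hq hq2 i j) m z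

theorem tensorRep_comul_e (i : Fin (n - 1)) (m : ℕ) (z : ⨂[ℂ]^m (Fock n)) :
    wedge b n m (tensorRep (Uq.comul n hq) (fockRep n hq hq2) m (Uq.e q i) z) =
      lineOp (cr b) (an b) (dg b q) (rootW i (i + 1)) i (i + 1) m (wedge b n m z) :=
  tensorRep_skew hq hq2 b (comul_e hq i) (counit_e i) (rootW i (i + 1)) (lo i) (hi i)
    (tensorRep_t_tinv hq hq2 b (comul_t hq) (comul_tinv hq) (lo i) (hi i)) (fockRep_e hq hq2 i) m z

theorem tensorRep_comul_f (i : Fin (n - 1)) (m : ℕ) (z : ⨂[ℂ]^m (Fock n)) :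
    wedge b n m (tensorRep (Uq.comul n hq) (fockRep n hq hq2) m (Uq.f q i) z) =
      lineOp' (cr b) (an b) (dg b q) (rootW (i + 1) i) (i + 1) i m (wedge b n m z) :=
  tensorRep_skew' hq hq2 b (comul_f hq i) (counit_f i) (rootW (i + 1) i) _ (rootW_eq (hi i) (lo i))
    (hi i) (lo i) (fockRep_t_tinv hq hq2 (hi i) (lo i)) (fockRep_f hq hq2 i) m z

theorem tensorRep_comulOp_e (i : Fin (n - 1)) (m : ℕ) (z : ⨂[ℂ]^m (Fock n)) :
    wedge b n m (tensorRep (Uq.comulOp n hq) (fockRep n hq hq2) m (Uq.e q i) z) =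
      lineOp' (cr b) (an b) (dg b q) (rootW i (i + 1)) i (i + 1) m (wedge b n m z) :=
  tensorRep_skew' hq hq2 b (comulOp_e hq i) (counit_e i) (rootW i (i + 1)) _
    (rootW_eq (lo i) (hi i)) (lo i) (hi i) (fockRep_t_tinv hq hq2 (lo i) (hi i))
    (fockRep_e hq hq2 i) m z

theorem tensorRep_comulOp_f (i : Fin (n - 1)) (m : ℕ) (z : ⨂[ℂ]^m (Fock n)) :
    wedge b n m (tensorRep (Uq.comulOp n hq) (fockRep n hq hq2) m (Uq.f q i) z) =
      lineOp (cr b) (an b) (dg b q) (rootW (i + 1) i) (i + 1) i m (wedge b n m z) :=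
  tensorRep_skew hq hq2 b (comulOp_f hq i) (counit_f i) (rootW (i + 1) i) (hi i) (lo i)
    (tensorRep_t_tinv hq hq2 b (comulOp_t hq) (comulOp_tinv hq) (hi i) (lo i))
    (fockRep_f hq hq2 i) m z

end tensorRep

/-! ### Commuting actions on the grid and their abstract properties -/

theorem Uq.mem_of_generators {n : ℕ} {q : ℂ} (S : Subalgebra ℂ (Uq n q)) (he : ∀ i, Uq.e q i ∈ S)
    (hf : ∀ i, Uq.f q i ∈ S) (ht : ∀ i, Uq.t q i ∈ S) (ht' : ∀ i, Uq.tinv q i ∈ S) (u : Uq n q) :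
    u ∈ S := by
  obtain ⟨x, rfl⟩ := RingQuot.mkAlgHom_surjective ℂ (Rel n q) u
  change Uq.mk n q x ∈ S
  induction x using FreeAlgebra.induction with
  | grade0 r => exact (AlgHom.commutes (Uq.mk n q) r).symm ▸ S.algebraMap_mem r
  | grade1 g =>
    cases g with
    | e i => exact he i
    | f i => exact hf i
    | t i => exact ht i
    | tinv i => exact ht' i
  | mul x y hx hy => rw [map_mul]; exact S.mul_mem hx hy
  | add x y hx hy => rw [map_add]; exact S.add_mem hx hy

theorem rowPre_eq (i r : ℕ) : preW (rootW i (i + 1)) r = rowPre i r := rfl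

/-- Two commuting representations with a contravariant form and a family of joint highest weight
vectors. -/
structure HowePair {N M : ℕ} {q : ℂ} {H : Type} [AddCommGroup H] [Module ℂ H]
    (ρ : Uq N q →ₐ[ℂ] Module.End ℂ H) (σ : Uq M q →ₐ[ℂ] Module.End ℂ H)
    (B : H →ₗ[ℂ] H →ₗ[ℂ] ℂ) {Λ : Type} (α : Λ → Fin N → ℤ) (β : Λ → Fin M → ℤ) (v : Λ → H) :
    Prop where
  comm (a b) : Commute (ρ a) (σ b)
  symm (x y) : B x y = B y x
  adj_left (a) : ∃ a', ∀ x y, B (ρ a x) y = B x (ρ a' y)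
  adj_right (b) : ∃ b', ∀ x y, B (σ b x) y = B x (σ b' y)
  form_self (l) : B (v l) (v l) = 1
  form_ne (l m) (h : l ≠ m) : B (v l) (v m) = 0
  form_f_left (l i x) : B (v l) (ρ (Uq.f q i) x) = 0
  form_f_right (l i x) : B (v l) (σ (Uq.f q i) x) = 0
  e_left (l i) : ρ (Uq.e q i) (v l) = 0
  e_right (l i) : σ (Uq.e q i) (v l) = 0
  t_left (l i) : ρ (Uq.t q i) (v l) = q ^ α l i • v l
  t_right (l i) : σ (Uq.t q i) (v l) = q ^ β l i • v l
  inj_left (l m) (h : α l = α m) : l = m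
  inj_right (l m) (h : β l = β m) : l = m
  unique (x) (he : ∀ i, ρ (Uq.e q i) x = 0) (he' : ∀ i, σ (Uq.e q i) x = 0)
    (ht : ∀ i, ∃ θ : ℂ, ρ (Uq.t q i) x = θ • x) (ht' : ∀ i, ∃ θ : ℂ, σ (Uq.t q i) x = θ • x) :
    x = 0 ∨ ∃ l, ∃ z : ℂ, x = z • v l

/-- Two representations given by the operators on the grid, through an embedding `Φ`. -/
structure GridPair {N M : ℕ} {q : ℂ} {H₁ H : Type} [AddCommGroup H₁] [Module ℂ H₁] [AddCommGroup H]
    [Module ℂ H] (ρ : Uq N q →ₐ[ℂ] Module.End ℂ H₁) (σ : Uq M q →ₐ[ℂ] Module.End ℂ H₁)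
    (Φ : H₁ →ₗ[ℂ] H) (c a : ℕ × ℕ → Module.End ℂ H) (D : (ℕ × ℕ → ℤ) → Module.End ℂ H) (vac : H) :
    Prop where
  injective : Function.Injective Φ
  supp (i r x) (h : ¬(i < N ∧ r < M)) : a (i, r) (Φ x) = 0
  vac_mem : vac ∈ LinearMap.range Φ
  cr_mem (i r) (hi : i < N) (hr : r < M) (x) (hx : x ∈ LinearMap.range Φ) :
    c (i, r) x ∈ LinearMap.range Φ
  e_left (i x) : Φ (ρ (Uq.e q i) x) = raiseRow c a D M i (Φ x)
  f_left (i x) : Φ (ρ (Uq.f q i) x) = q⁻¹ • D (-rowPre i M) (lowerRow c a D M i (Φ x))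
  t_left (i x) : Φ (ρ (Uq.t q i) x) = D (rowW i M) (Φ x)
  tinv_left (i x) : Φ (ρ (Uq.tinv q i) x) = D (-rowW i M) (Φ x)
  e_right (i x) : Φ (σ (Uq.e q i) x) = q⁻¹ • D (-colPre i N) (raiseCol c a D N i (Φ x))
  f_right (i x) : Φ (σ (Uq.f q i) x) = lowerCol c a D N i (Φ x)
  t_right (i x) : Φ (σ (Uq.t q i) x) = D (colBel N i) (Φ x)
  tinv_right (i x) : Φ (σ (Uq.tinv q i) x) = D (-colBel N i) (Φ x)

namespace GridPair

variable {N M : ℕ} {q : ℂ} {H₁ H : Type} [AddCommGroup H₁] [Module ℂ H₁] [AddCommGroup H]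
    [Module ℂ H] {ρ : Uq N q →ₐ[ℂ] Module.End ℂ H₁} {σ : Uq M q →ₐ[ℂ] Module.End ℂ H₁}
    {Φ : H₁ →ₗ[ℂ] H} {c a : ℕ × ℕ → Module.End ℂ H} {D : (ℕ × ℕ → ℤ) → Module.End ℂ H} {vac : H}
    {B : H →ₗ[ℂ] H →ₗ[ℂ] ℂ}

theorem commute_of_intertwine (G : GridPair ρ σ Φ c a D vac) {S T : Module.End ℂ H₁}
    {S' T' : Module.End ℂ H} (hS : ∀ x, Φ (S x) = S' (Φ x)) (hT : ∀ x, Φ (T x) = T' (Φ x))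
    (h : Commute S' T') : Commute S T :=
  LinearMap.ext fun x => G.injective <| by
    rw [Module.End.mul_apply, Module.End.mul_apply, hS, hT, hT, hS]
    exact LinearMap.congr_fun h.eq _

/-- It suffices to treat the sixteen kinds of pairs of generators. Row totals are constant along
rows and column totals along columns, so diagonal factors commute with the operators of the other
algebra, and the hops commute by the lemmas on `raiseRow`, `lowerRow`, `raiseCol` and `lowerCol`. -/
theorem commute (G : GridPair ρ σ Φ c a D vac) (F : FermiForm q c a D vac B) (u : Uq N q)
    (w : Uq M q) : Commute (ρ u) (σ w) := by
  have S := F.toFermi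
  have dl : ∀ (i : Fin N) (w : ℕ × ℕ → ℤ), w = rowW i M ∨ w = -rowW i M → ∀ r, r + 1 < M → ∀ j,
      w (j, r) = w (j, r + 1) := by
    rintro i w (rfl | rfl) r hr j
    · exact Fermi.rowW_col i M hr j
    · exact congrArg (- ·) (Fermi.rowW_col i M hr j)
  have dr : ∀ (r : Fin M) (w : ℕ × ℕ → ℤ), w = colBel N r ∨ w = -colBel N r → ∀ i, i + 1 < N → ∀ s,
      w (i, s) = w (i + 1, s) := by
    rintro i w (rfl | rfl) r hr j
    · exact Fermi.colBel_row N i hr j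
    · exact congrArg (- ·) (Fermi.colBel_row N i hr j)
  have kl (i : ℕ) : ∀ r, r + 1 < M → ∀ j, (-rowPre i M) (j, r) = (-rowPre i M) (j, r + 1) := by
    intro r hr j
    simp only [rowPre, Pi.neg_apply]; split_ifs <;> omega
  have kr (i : ℕ) : ∀ r, r + 1 < N → ∀ j, (-colPre i N) (r, j) = (-colPre i N) (r + 1, j) := by
    intro r hr j
    simp only [colPre, Pi.neg_apply]; split_ifs <;> omega
  have hiN (i : Fin (N - 1)) : i.1 + 1 < N := by omega
  have hiM (i : Fin (M - 1)) : i.1 + 1 < M := by omega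
  have fl (i : Fin (N - 1)) (x) : Φ (ρ (Uq.f q i) x) =
    (q⁻¹ • (D (-rowPre i M) * lowerRow c a D M i)) (Φ x) := G.f_left i x
  have er (i : Fin (M - 1)) (x) : Φ (σ (Uq.e q i) x) =
    (q⁻¹ • (D (-colPre i N) * raiseCol c a D N i)) (Φ x) := G.e_right i x
  have key (T : Module.End ℂ H₁) (h1 : ∀ i, Commute (ρ (Uq.e q i)) T)
      (h2 : ∀ i, Commute (ρ (Uq.f q i)) T) (h3 : ∀ i, Commute (ρ (Uq.t q i)) T)
      (h4 : ∀ i, Commute (ρ (Uq.tinv q i)) T) : Commute (ρ u) T := by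
    have := Uq.mem_of_generators ((Subalgebra.centralizer ℂ {T}).comap ρ)
      (fun i => Subalgebra.mem_centralizer_iff ℂ |>.2 fun g hg => by
        rw [Set.mem_singleton_iff.1 hg]; exact (h1 i).eq.symm)
      (fun i => Subalgebra.mem_centralizer_iff ℂ |>.2 fun g hg => by
        rw [Set.mem_singleton_iff.1 hg]; exact (h2 i).eq.symm)
      (fun i => Subalgebra.mem_centralizer_iff ℂ |>.2 fun g hg => by
        rw [Set.mem_singleton_iff.1 hg]; exact (h3 i).eq.symm)
      (fun i => Subalgebra.mem_centralizer_iff ℂ |>.2 fun g hg => by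
        rw [Set.mem_singleton_iff.1 hg]; exact (h4 i).eq.symm) u
    exact ((Subalgebra.mem_centralizer_iff ℂ).1 this T rfl).symm
  have key' (T : Module.End ℂ H₁) (h1 : ∀ i, Commute T (σ (Uq.e q i)))
      (h2 : ∀ i, Commute T (σ (Uq.f q i))) (h3 : ∀ i, Commute T (σ (Uq.t q i)))
      (h4 : ∀ i, Commute T (σ (Uq.tinv q i))) : Commute T (σ w) := by
    have := Uq.mem_of_generators ((Subalgebra.centralizer ℂ {T}).comap σ)
      (fun i => Subalgebra.mem_centralizer_iff ℂ |>.2 fun g hg => by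
        rw [Set.mem_singleton_iff.1 hg]; exact (h1 i).eq)
      (fun i => Subalgebra.mem_centralizer_iff ℂ |>.2 fun g hg => by
        rw [Set.mem_singleton_iff.1 hg]; exact (h2 i).eq)
      (fun i => Subalgebra.mem_centralizer_iff ℂ |>.2 fun g hg => by
        rw [Set.mem_singleton_iff.1 hg]; exact (h3 i).eq)
      (fun i => Subalgebra.mem_centralizer_iff ℂ |>.2 fun g hg => by
        rw [Set.mem_singleton_iff.1 hg]; exact (h4 i).eq) w
    exact (Subalgebra.mem_centralizer_iff ℂ).1 this T rfl
  refine key _ (fun i => ?_) (fun i => ?_) (fun i => ?_) (fun i => ?_)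
  · refine key' _ (fun r => ?_) (fun r => ?_) (fun r => ?_) (fun r => ?_)
    · exact G.commute_of_intertwine (G.e_left i) (er r)
        (((S.commute_dg_raiseRow fun s _ => kr r i (hiN i) s).symm.mul_right
          (S.commute_raiseRow_raiseCol (hiN i) (hiM r))).smul_right _)
    · exact G.commute_of_intertwine (G.e_left i) (G.f_right r)
        (S.commute_raiseRow_lowerCol (hiN i) (hiM r))
    · exact G.commute_of_intertwine (G.e_left i) (G.t_right r)
        (S.commute_dg_raiseRow fun s _ => dr r _ (Or.inl rfl) i (hiN i) s).symm
    · exact G.commute_of_intertwine (G.e_left i) (G.tinv_right r)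
        (S.commute_dg_raiseRow fun s _ => dr r _ (Or.inr rfl) i (hiN i) s).symm
  · have hl (T : Module.End ℂ H) (h1 : Commute (D (-rowPre i M)) T)
      (h2 : Commute (lowerRow c a D M i) T) :
      Commute (q⁻¹ • (D (-rowPre i M) * lowerRow c a D M i)) T := (h1.mul_left h2).smul_left _
    refine key' _ (fun r => ?_) (fun r => ?_) (fun r => ?_) (fun r => ?_)
    · exact G.commute_of_intertwine (fl i) (er r) (hl _
        (((S.commute_dg_dg _ _).mul_right (S.commute_dg_raiseCol fun s _ => kl i r (hiM r) s)).smul_right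
          _)
        (((S.commute_dg_lowerRow fun s _ => kr r i (hiN i) s).symm.mul_right
          (S.commute_lowerRow_raiseCol (hiN i) (hiM r))).smul_right _))
    · exact G.commute_of_intertwine (fl i) (G.f_right r) (hl _
        (S.commute_dg_lowerCol fun s _ => kl i r (hiM r) s)
        (F.commute_lowerRow_lowerCol (hiN i) (hiM r)))
    · exact G.commute_of_intertwine (fl i) (G.t_right r) (hl _ (S.commute_dg_dg _ _)
        (S.commute_dg_lowerRow fun s _ => dr r _ (Or.inl rfl) i (hiN i) s).symm)
    · exact G.commute_of_intertwine (fl i) (G.tinv_right r) (hl _ (S.commute_dg_dg _ _)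
        (S.commute_dg_lowerRow fun s _ => dr r _ (Or.inr rfl) i (hiN i) s).symm)
  · refine key' _ (fun r => ?_) (fun r => ?_) (fun r => ?_) (fun r => ?_)
    · exact G.commute_of_intertwine (G.t_left i) (er r) (((S.commute_dg_dg _ _).mul_right
        (S.commute_dg_raiseCol fun s _ => dl i _ (Or.inl rfl) r (hiM r) s)).smul_right _)
    · exact G.commute_of_intertwine (G.t_left i) (G.f_right r)
        (S.commute_dg_lowerCol fun s _ => dl i _ (Or.inl rfl) r (hiM r) s)
    · exact G.commute_of_intertwine (G.t_left i) (G.t_right r) (S.commute_dg_dg _ _)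
    · exact G.commute_of_intertwine (G.t_left i) (G.tinv_right r) (S.commute_dg_dg _ _)
  · refine key' _ (fun r => ?_) (fun r => ?_) (fun r => ?_) (fun r => ?_)
    · exact G.commute_of_intertwine (G.tinv_left i) (er r) (((S.commute_dg_dg _ _).mul_right
        (S.commute_dg_raiseCol fun s _ => dl i _ (Or.inr rfl) r (hiM r) s)).smul_right _)
    · exact G.commute_of_intertwine (G.tinv_left i) (G.f_right r)
        (S.commute_dg_lowerCol fun s _ => dl i _ (Or.inr rfl) r (hiM r) s)
    · exact G.commute_of_intertwine (G.tinv_left i) (G.t_right r) (S.commute_dg_dg _ _)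
    · exact G.commute_of_intertwine (G.tinv_left i) (G.tinv_right r) (S.commute_dg_dg _ _)

/-- The elements having an adjoint form a subalgebra, adjunction reversing products, so generators
are enough. -/
theorem exists_adj {n : ℕ} {H : Type} [AddCommGroup H] [Module ℂ H] {B : H →ₗ[ℂ] H →ₗ[ℂ] ℂ}
    (ρ : Uq n q →ₐ[ℂ] Module.End ℂ H) (he : ∀ i, ∃ a', ∀ x y, B (ρ (Uq.e q i) x) y = B x (ρ a' y))
    (hf : ∀ i, ∃ a', ∀ x y, B (ρ (Uq.f q i) x) y = B x (ρ a' y))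
    (ht : ∀ i, ∃ a', ∀ x y, B (ρ (Uq.t q i) x) y = B x (ρ a' y))
    (ht' : ∀ i, ∃ a', ∀ x y, B (ρ (Uq.tinv q i) x) y = B x (ρ a' y)) (a : Uq n q) :
    ∃ a', ∀ x y, B (ρ a x) y = B x (ρ a' y) := by
  let S : Subalgebra ℂ (Uq n q) :=
    { carrier := {a | ∃ a', ∀ x y, B (ρ a x) y = B x (ρ a' y)}
      mul_mem' := by
        rintro a b ⟨a', ha⟩ ⟨b', hb⟩
        exact ⟨b' * a', fun x y => by
          rw [map_mul, map_mul, Module.End.mul_apply, Module.End.mul_apply, ha, hb]⟩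
      add_mem' := by
        rintro a b ⟨a', ha⟩ ⟨b', hb⟩
        exact ⟨a' + b', fun x y => by
          rw [map_add, map_add, LinearMap.add_apply, LinearMap.add_apply, map_add, map_add,
            LinearMap.add_apply, ha, hb]⟩
      algebraMap_mem' := fun r => ⟨algebraMap ℂ _ r, fun x y => by
        rw [AlgHom.commutes, Module.algebraMap_end_apply, Module.algebraMap_end_apply, map_smul,
          map_smul, LinearMap.smul_apply]⟩ }
  exact Uq.mem_of_generators S he hf ht ht' a

end GridPair

theorem rowLen_inj {N M : ℕ} (l m : BoxDiagram N M) (h : rowWeight N l.1 = rowWeight N m.1) : l = m := by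
  refine Subtype.ext (YoungDiagram.ext (Finset.ext fun k => ?_))
  obtain ⟨i, r⟩ := k
  rw [YoungDiagram.mem_cells, YoungDiagram.mem_cells]
  by_cases hi : i < N
  · have := congrFun h ⟨i, hi⟩
    simp only [rowWeight, Nat.cast_inj] at this
    rw [YoungDiagram.mem_iff_lt_rowLen, YoungDiagram.mem_iff_lt_rowLen, this]
  · have aux (l : BoxDiagram N M) : (i, r) ∉ l.1 := fun hm => by
      have := YoungDiagram.mem_iff_lt_colLen.1 (l.1.up_left_mem le_rfl (Nat.zero_le r) hm)
      have := l.2.1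
      omega
    simp only [aux]

theorem box_mem {N M : ℕ} (l : BoxDiagram N M) {i r : ℕ} (h : (i, r) ∈ l.1) : i < N ∧ r < M := by
  have h1 := YoungDiagram.mem_iff_lt_colLen.1 (l.1.up_left_mem le_rfl (Nat.zero_le r) h)
  have h2 := YoungDiagram.mem_iff_lt_rowLen.1 (l.1.up_left_mem (Nat.zero_le i) le_rfl h)
  have := l.2
  omega

theorem box_of_mem {N M : ℕ} {μ : YoungDiagram} (h : ∀ i r, (i, r) ∈ μ → i < N ∧ r < M) :
    μ.colLen 0 ≤ N ∧ μ.rowLen 0 ≤ M := by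
  constructor
  · by_contra h1
    have := h N 0 (YoungDiagram.mem_iff_lt_colLen.2 (by omega)); omega
  · by_contra h1
    have := h 0 M (YoungDiagram.mem_iff_lt_rowLen.2 (by omega)); omega

theorem tinv_apply {n : ℕ} {q : ℂ} {H : Type} [AddCommGroup H] [Module ℂ H]
    (ρ : Uq n q →ₐ[ℂ] Module.End ℂ H) {i : Fin n} {v : H} {θ : ℂ}
    (h : ρ (Uq.t q i) v = θ • v) : ρ (Uq.tinv q i) v = θ⁻¹ • v := by
  have h1 : ρ (Uq.tinv q i * Uq.t q i) v = v := by rw [Uq.satisfies.tinv_t, map_one]; rfl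
  rw [map_mul, Module.End.mul_apply, h, map_smul] at h1
  by_cases h0 : θ = 0
  · subst h0
    rw [zero_smul] at h1
    rw [← h1, smul_zero, map_zero]
  · rw [← h1, smul_smul, inv_mul_cancel₀ h0, one_smul, h1]

theorem exists_kinv_apply {n : ℕ} {q : ℂ} {H : Type} [AddCommGroup H] [Module ℂ H]
    (ρ : Uq n q →ₐ[ℂ] Module.End ℂ H) {v : H} {θ : Fin n → ℂ}
    (h : ∀ i, ρ (Uq.t q i) v = θ i • v) (i : Fin (n - 1)) : ∃ z : ℂ, ρ (Uq.kinv q i) v = z • v :=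
  ⟨(θ (lo i))⁻¹ * θ (hi i), by
    rw [Uq.kinv, map_mul, Module.End.mul_apply, tinv_apply ρ (h (lo i)), map_smul, h, smul_smul]⟩

namespace GridPair

variable {N M : ℕ} {q : ℂ} {H₁ H : Type} [AddCommGroup H₁] [Module ℂ H₁] [AddCommGroup H]
    [Module ℂ H] {ρ : Uq N q →ₐ[ℂ] Module.End ℂ H₁} {σ : Uq M q →ₐ[ℂ] Module.End ℂ H₁}
    {Φ : H₁ →ₗ[ℂ] H} {c a : ℕ × ℕ → Module.End ℂ H} {D : (ℕ × ℕ → ℤ) → Module.End ℂ H} {vac : H}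
    {B : H →ₗ[ℂ] H →ₗ[ℂ] ℂ}

theorem dg_dg (F : FermiForm q c a D vac B) {u w v : ℕ × ℕ → ℤ} (h : u + w = v) (x : H) :
    D u (D w x) = D v x := by
  rw [← h, ← F.dg_mul_dg]; rfl

theorem dg_neg_dg (F : FermiForm q c a D vac B) (w : ℕ × ℕ → ℤ) (x : H) : D w (D (-w) x) = x := by
  rw [dg_dg F (add_neg_cancel w), F.dg_zero]; rfl

theorem k_left (G : GridPair ρ σ Φ c a D vac) (F : FermiForm q c a D vac B) (i : Fin (N - 1)) (x) :
    Φ (ρ (Uq.k q i) x) = D (rowPre i M) (Φ x) := by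
  rw [Uq.k, map_mul, Module.End.mul_apply, G.t_left, G.tinv_left, dg_dg F]
  funext ⟨j, r⟩
  simp only [Pi.add_apply, Pi.neg_apply, rowW, rowPre, lo, hi]
  split_ifs <;> omega

theorem kinv_left (G : GridPair ρ σ Φ c a D vac) (F : FermiForm q c a D vac B) (i : Fin (N - 1)) (x) :
    Φ (ρ (Uq.kinv q i) x) = D (-rowPre i M) (Φ x) := by
  rw [Uq.kinv, map_mul, Module.End.mul_apply, G.t_left, G.tinv_left, dg_dg F]
  funext ⟨j, r⟩
  simp only [Pi.add_apply, Pi.neg_apply, rowW, rowPre, lo, hi]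
  split_ifs <;> omega

theorem k_right (G : GridPair ρ σ Φ c a D vac) (F : FermiForm q c a D vac B) (i : Fin (M - 1)) (x) :
    Φ (σ (Uq.k q i) x) = D (-colPre i N) (Φ x) := by
  rw [Uq.k, map_mul, Module.End.mul_apply, G.t_right, G.tinv_right, dg_dg F]
  funext ⟨j, r⟩
  simp only [Pi.add_apply, Pi.neg_apply, colBel, colPre, lo, hi]
  split_ifs <;> omega

theorem kinv_right (G : GridPair ρ σ Φ c a D vac) (F : FermiForm q c a D vac B) (i : Fin (M - 1)) (x) :
    Φ (σ (Uq.kinv q i) x) = D (colPre i N) (Φ x) := by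
  rw [Uq.kinv, map_mul, Module.End.mul_apply, G.t_right, G.tinv_right, dg_dg F]
  funext ⟨j, r⟩
  simp only [Pi.add_apply, Pi.neg_apply, colBel, colPre, lo, hi]
  split_ifs <;> omega

/-- The bare sums `raiseRow` and `lowerRow` are adjoint to each other. The factor q⁻¹ k_i⁻¹ by which
f_i differs from `lowerRow` is moved to the other side. -/
theorem f_left_adj (G : GridPair ρ σ Φ c a D vac) (F : FermiForm q c a D vac B) (i x y) :
    B (Φ (ρ (Uq.f q i) x)) (Φ y) = B (Φ x) (Φ (ρ (q⁻¹ • (Uq.e q i * Uq.kinv q i)) y)) := by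
  rw [map_smul, map_mul, LinearMap.smul_apply, Module.End.mul_apply, map_smul, G.e_left,
    G.kinv_left F, G.f_left, map_smul, LinearMap.smul_apply, map_smul, F.dg_adj, F.symm,
    ← F.raiseRow_adj, F.symm]

theorem f_right_adj (G : GridPair ρ σ Φ c a D vac) (F : FermiForm q c a D vac B) (i x y) :
    B (Φ (σ (Uq.f q i) x)) (Φ y) = B (Φ x) (Φ (σ (q • (Uq.kinv q i * Uq.e q i)) y)) := by
  rw [map_smul, map_mul, LinearMap.smul_apply, Module.End.mul_apply, map_smul, G.kinv_right F,
    G.e_right, map_smul, map_smul, map_smul, smul_smul, mul_inv_cancel₀ F.ne_zero, one_smul,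
    dg_neg_dg F, G.f_right,
    F.symm, ← F.raiseCol_adj, F.symm]

theorem e_left_adj (G : GridPair ρ σ Φ c a D vac) (F : FermiForm q c a D vac B) (i x y) :
    B (Φ (ρ (Uq.e q i) x)) (Φ y) = B (Φ x) (Φ (ρ (q • (Uq.k q i * Uq.f q i)) y)) := by
  rw [map_smul, map_mul, LinearMap.smul_apply, Module.End.mul_apply, map_smul, G.e_left,
    G.k_left F, G.f_left, map_smul, map_smul, map_smul, smul_smul, mul_inv_cancel₀ F.ne_zero,
    one_smul, dg_neg_dg F, F.raiseRow_adj]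

theorem e_right_adj (G : GridPair ρ σ Φ c a D vac) (F : FermiForm q c a D vac B) (i x y) :
    B (Φ (σ (Uq.e q i) x)) (Φ y) = B (Φ x) (Φ (σ (q⁻¹ • (Uq.f q i * Uq.k q i)) y)) := by
  rw [map_smul, map_mul, LinearMap.smul_apply, Module.End.mul_apply, map_smul, G.f_right,
    G.k_right F, G.e_right, map_smul, LinearMap.smul_apply, map_smul, F.dg_adj,
    F.raiseCol_adj]

/-- The vectors are the states of the diagrams in the box. They are highest weight vectors by
inspection; the converse, the `unique` field, comes from `exists_isState` and the uniqueness of the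
state with given occupied sites. -/
theorem exists_howePair (G : GridPair ρ σ Φ c a D vac) (F : FermiForm q c a D vac B)
    (h : ∀ n : ℕ, 0 < n → q ^ n ≠ 1) : ∃ v : BoxDiagram N M → H₁,
      HowePair ρ σ (B.compl₁₂ Φ Φ) (fun l => rowWeight N l.1) (fun l => rowWeight M l.1.transpose) v := by
  have S := F.toFermi
  -- The state is built from the vacuum by creating the cells of the diagram. These lie in the box,
  -- so the state stays in the range of Φ.
  have hs (l : BoxDiagram N M) := F.exists_state l.1.cells (fun x => x ∈ LinearMap.range Φ) G.vac_mem
    fun k hk x hx => G.cr_mem k.1 k.2 (box_mem l hk).1 (box_mem l hk).2 x hx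
  choose w hw hww hwc hwa huniq using hs
  choose v hv using fun l => LinearMap.mem_range.1 (hw l)
  have st (l) : Fermi.IsState c a l.1 (Φ (v l)) := by
    rw [hv]; exact ⟨fun k hk => hwc l k hk, fun k hk => hwa l k hk⟩
  have el (l i) : ρ (Uq.e q i) (v l) = 0 := G.injective <| by
    rw [G.e_left, (st l).raise_row S, map_zero]
  have er (l i) : σ (Uq.e q i) (v l) = 0 := G.injective <| by
    rw [G.e_right, (st l).raise_col S, map_zero, smul_zero, map_zero]
  have tl (l : BoxDiagram N M) (i : Fin N) :
      ρ (Uq.t q i) (v l) = q ^ (rowWeight N l.1 i) • v l := G.injective <| by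
    rw [G.t_left, (st l).dg_row S ((l.1.rowLen_anti _ _ (Nat.zero_le i)).trans l.2.2), map_smul]; rfl
  have tr (l : BoxDiagram N M) (i : Fin M) :
      σ (Uq.t q i) (v l) = q ^ (rowWeight M l.1.transpose i) • v l := G.injective <| by
    rw [G.t_right, (st l).dg_col S ((l.1.colLen_anti _ _ (Nat.zero_le i)).trans l.2.1), map_smul,
      rowWeight, YoungDiagram.rowLen_transpose]
  refine ⟨v, G.commute F, fun x y => F.symm _ _, ?_, ?_, fun l => ?_, fun l m hlm => ?_, fun l i x => ?_, fun l i x => ?_,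
    el, er, tl, tr, rowLen_inj, fun l m hlm => ?_, fun x he he' ht ht' => ?_⟩
  · refine exists_adj ρ (fun i => ⟨_, G.e_left_adj F i⟩) (fun i => ⟨_, G.f_left_adj F i⟩)
      (fun i => ⟨Uq.t q i, fun x y => ?_⟩) (fun i => ⟨Uq.tinv q i, fun x y => ?_⟩)
    · simp only [LinearMap.compl₁₂_apply, G.t_left, F.dg_adj]
    · simp only [LinearMap.compl₁₂_apply, G.tinv_left, F.dg_adj]
  · refine exists_adj σ (fun i => ⟨_, G.e_right_adj F i⟩) (fun i => ⟨_, G.f_right_adj F i⟩)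
      (fun i => ⟨Uq.t q i, fun x y => ?_⟩) (fun i => ⟨Uq.tinv q i, fun x y => ?_⟩)
    · simp only [LinearMap.compl₁₂_apply, G.t_right, F.dg_adj]
    · simp only [LinearMap.compl₁₂_apply, G.tinv_right, F.dg_adj]
  · rw [LinearMap.compl₁₂_apply, hv, hww]
  -- The torus is self-adjoint, so a nonzero pairing would force equal weights and hence equal
  -- diagrams.
  · by_contra h0
    refine hlm (rowLen_inj l m (funext fun i => zpow_injective_of_not_root F.ne_zero h ?_))
    have h1 := F.dg_adj (rowW i M) (Φ (v l)) (Φ (v m))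
    rw [← G.t_left, ← G.t_left, tl, tl, map_smul, map_smul, map_smul, map_smul,
      LinearMap.smul_apply] at h1
    exact mul_right_cancel₀ h0 h1
  -- The adjoint of f is a multiple of e k⁻¹, where k⁻¹ acts on the weight vector by a scalar and e
  -- kills it.
  · obtain ⟨z, hz⟩ := exists_kinv_apply ρ (tl l) i
    rw [LinearMap.compl₁₂_apply, F.symm, G.f_left_adj F, map_smul, map_mul, LinearMap.smul_apply,
      Module.End.mul_apply, hz, map_smul (ρ _), el, smul_zero, smul_zero, map_zero, map_zero]
  · rw [LinearMap.compl₁₂_apply, F.symm, G.f_right_adj F, map_smul, map_mul, LinearMap.smul_apply,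
      Module.End.mul_apply, er, map_zero, smul_zero, map_zero, map_zero]
  · have := rowLen_inj (N := M) (M := N) ⟨l.1.transpose, by simpa using l.2.symm⟩
      ⟨m.1.transpose, by simpa using m.2.symm⟩ hlm
    exact Subtype.ext (YoungDiagram.transpose_eq_iff.1 (congrArg Subtype.val this))
  · by_cases hx : x = 0
    · exact Or.inl hx
    right
    have hx' : Φ x ≠ 0 := fun h0 => hx (G.injective (h0.trans (map_zero Φ).symm))
    obtain ⟨μ, hμ, hst⟩ := S.exists_isState h hx' (fun i r hir => G.supp i r x hir)
      (fun i hi => by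
        obtain ⟨θ, hθ⟩ := ht ⟨i, hi⟩
        exact ⟨θ, by rw [← map_smul, ← hθ, G.t_left]⟩)
      (fun i hi => by
        obtain ⟨θ, hθ⟩ := ht' ⟨i, hi⟩
        exact ⟨θ, by rw [← map_smul, ← hθ, G.t_right]⟩)
      (fun i hi => by
        have := G.e_left ⟨i, by omega⟩ x
        rw [he, map_zero] at this
        exact this.symm)
      (fun i hi => by
        have := G.e_right ⟨i, by omega⟩ x
        rw [he', map_zero] at this
        have h2 := congrArg (D (colPre i N)) this.symm
        rw [map_smul, map_zero, dg_neg_dg F] at h2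
        exact (smul_eq_zero.1 h2).resolve_left (inv_ne_zero F.ne_zero))
    obtain ⟨z, hz⟩ := huniq ⟨μ, box_of_mem hμ⟩ (Φ x) (fun k hk => hst.1 k hk) (fun k hk => hst.2 k hk)
    exact ⟨⟨μ, box_of_mem hμ⟩, z, G.injective (by rw [hz, map_smul, hv])⟩

end GridPair

/-! ### The two actions in terms of the operators on the grid -/

section lines

variable {A : Type*} [Ring A] (c a : ℕ × ℕ → A) (D : (ℕ × ℕ → ℤ) → A)

theorem lineOp_lowerRow (M i : ℕ) : lineOp c a D (rootW i (i + 1)) (i + 1) i M = lowerRow c a D M i := rfl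

theorem preW_neg (w : ℕ → ℤ) (r : ℕ) : preW (-w) r = -preW w r := by
  funext x; simp only [preW, Pi.neg_apply]; split_ifs <;> simp

theorem rootW_symm (k l : ℕ) : rootW k l = -rootW l k := by
  funext x; simp only [rootW, Pi.neg_apply]; split_ifs <;> simp

theorem preW_unitW (i M : ℕ) : preW (unitW i) M = rowW i M := by
  funext x; simp only [preW, unitW, rowW]; split_ifs <;> simp_all

theorem preW_unitW_swap (N r : ℕ) : preW (unitW r) N ∘ Prod.swap = colBel N r := by
  funext x; simp only [preW, unitW, colBel, Function.comp_apply, Prod.fst_swap, Prod.snd_swap]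
  split_ifs <;> simp_all

theorem lineOp_raiseCol (N r : ℕ) : lineOp (fun k => c k.swap) (fun k => a k.swap)
    (fun w => D (w ∘ Prod.swap)) (rootW (r + 1) r) r (r + 1) N = raiseCol c a D N r := rfl

theorem lineOp_lowerCol (N r : ℕ) : lineOp (fun k => c k.swap) (fun k => a k.swap)
    (fun w => D (w ∘ Prod.swap)) (rootW (r + 1) r) (r + 1) r N = lowerCol c a D N r := rfl

end lines

theorem lineOp'_apply_eq {H : Type*} [AddCommGroup H] [Module ℂ H] {q : ℂ}
    {c a : ℕ × ℕ → Module.End ℂ H} {D : (ℕ × ℕ → ℤ) → Module.End ℂ H} (S : Fermi q c a D) {k l : ℕ}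
    (h : k ≠ l) (m : ℕ) (x : H) : lineOp' c a D (rootW k l) k l m x =
      q⁻¹ • D (preW (rootW k l) m) (lineOp c a D (rootW l k) k l m x) := by
  rw [S.lineOp'_eq h]; rfl

section swap

variable {X : Type} [AddCommGroup X] [Module ℂ X] (b : Module.Basis (ℕ × ℕ) ℂ X)

theorem cr_swap : cr (b.reindex (Equiv.prodComm ℕ ℕ)) = fun k => cr b k.swap := by
  funext k
  simp only [cr, Module.Basis.reindex_apply]; rfl

theorem an_swap : an (b.reindex (Equiv.prodComm ℕ ℕ)) = fun k => an b k.swap := by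
  funext k
  have : (b.reindex (Equiv.prodComm ℕ ℕ)).coord k = b.coord k.swap := by
    ext x
    rw [Module.Basis.coord_apply, Module.Basis.repr_reindex_apply]; rfl
  simp only [an, this]

theorem dg_swap (q : ℂ) :
    dg (b.reindex (Equiv.prodComm ℕ ℕ)) q = fun w => dg b q (w ∘ Prod.swap) := by
  funext w
  have : (b.reindex (Equiv.prodComm ℕ ℕ)).constr ℂ
      (fun k => q ^ w k • (b.reindex (Equiv.prodComm ℕ ℕ)) k) =
      b.constr ℂ fun k => q ^ (w ∘ Prod.swap) k • b k := by
    refine (b.reindex (Equiv.prodComm ℕ ℕ)).ext fun k => ?_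
    rw [Module.Basis.constr_basis, Module.Basis.reindex_apply, Module.Basis.constr_basis]; rfl
  simp only [dg, this]

end swap

/-- The basis of the one-particle space of the grid. -/
abbrev gridBasis : Module.Basis (ℕ × ℕ) ℂ (ℕ × ℕ →₀ ℂ) := Finsupp.basisSingleOne

/-- The same basis with the two coordinates interchanged. -/
abbrev gridBasis' : Module.Basis (ℕ × ℕ) ℂ (ℕ × ℕ →₀ ℂ) := gridBasis.reindex (Equiv.prodComm ℕ ℕ)

/-- The embedding of `V ⊗ W` into the one-particle space of the grid. -/
def gridEmb (N M : ℕ) : Vec N ⊗[ℂ] Vec M →ₗ[ℂ] (ℕ × ℕ →₀ ℂ) :=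
  ((Pi.basisFun ℂ (Fin N)).tensorProduct (Pi.basisFun ℂ (Fin M))).constr ℂ
    fun k => gridBasis (k.1.1, k.2.1)

theorem gridEmb_std {N M : ℕ} (i : Fin N) (r : Fin M) :
    gridEmb N M (stdVec i ⊗ₜ stdVec r) = gridBasis (i.1, r.1) := by
  have := ((Pi.basisFun ℂ (Fin N)).tensorProduct (Pi.basisFun ℂ (Fin M))).constr_basis ℂ
    (fun k => gridBasis (k.1.1, k.2.1)) (i, r)
  rw [Module.Basis.tensorProduct_apply, Pi.basisFun_apply, Pi.basisFun_apply] at this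
  exact this

theorem exists_leftInverse_gridEmb (N M : ℕ) : ∃ g, g ∘ₗ gridEmb N M = LinearMap.id := by
  refine ⟨gridBasis.constr ℂ fun k => if h : k.1 < N ∧ k.2 < M then
    stdVec ⟨k.1, h.1⟩ ⊗ₜ stdVec ⟨k.2, h.2⟩ else 0, ?_⟩
  refine ((Pi.basisFun ℂ (Fin N)).tensorProduct (Pi.basisFun ℂ (Fin M))).ext fun k => ?_
  rw [Module.Basis.tensorProduct_apply, Pi.basisFun_apply, Pi.basisFun_apply, LinearMap.comp_apply]
  refine (congrArg _ (gridEmb_std k.1 k.2)).trans ?_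
  rw [Module.Basis.constr_basis, dif_pos ⟨k.1.2, k.2.2⟩]
  rfl

/-- The induced embedding of exterior algebras. -/
def gridMap (N M : ℕ) : Ext N M →ₗ[ℂ] ExteriorAlgebra ℂ (ℕ × ℕ →₀ ℂ) :=
  (ExteriorAlgebra.map (gridEmb N M)).toLinearMap

theorem gridMap_injective (N M : ℕ) : Function.Injective (gridMap N M) :=
  ExteriorAlgebra.map_injective (exists_leftInverse_gridEmb N M)

theorem map_wedgeMap {n m : ℕ} {X Y : Type} [AddCommGroup X] [Module ℂ X] [AddCommGroup Y] [Module ℂ Y]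
    (g : X →ₗ[ℂ] Y) (j : Fin m → Vec n →ₗ[ℂ] X) (z : ⨂[ℂ]^m (Fock n)) :
    ExteriorAlgebra.map g (wedgeMap j z) = wedgeMap (fun r => g ∘ₗ j r) z := by
  induction z using PiTensorProduct.induction_on with
  | smul_tprod s ω =>
    rw [map_smul, map_smul, map_smul, wedgeMap_tprod, wedgeMap_tprod, map_list_prod, List.map_ofFn]
    congr 3
    funext r
    simp only [Function.comp_apply, ← ExteriorAlgebra.map_comp_map, AlgHom.comp_apply]
  | add x y hx hy => rw [map_add, map_add, map_add, hx, hy]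

theorem gridMap_equivV {N M : ℕ} (z : ⨂[ℂ]^M (Fock N)) :
    gridMap N M (equivV N M z) = wedge gridBasis N M z := by
  refine (map_wedgeMap (gridEmb N M) (inclV N) z).trans ?_
  have : (fun r => gridEmb N M ∘ₗ inclV N r) = fun r : Fin M => factor gridBasis N r := by
    funext r
    refine (Pi.basisFun ℂ (Fin N)).ext fun i => ?_
    rw [factor_basis, Pi.basisFun_apply]
    exact gridEmb_std i r
  rw [this]; rfl

theorem gridMap_equivW {N M : ℕ} (z : ⨂[ℂ]^N (Fock M)) :
    gridMap N M (equivW N M z) = wedge gridBasis' M N z := by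
  refine (map_wedgeMap (gridEmb N M) (inclW M) z).trans ?_
  have : (fun i => gridEmb N M ∘ₗ inclW M i) = fun i : Fin N => factor gridBasis' M i := by
    funext i
    refine (Pi.basisFun ℂ (Fin M)).ext fun r => ?_
    rw [factor_basis, Pi.basisFun_apply, Module.Basis.reindex_apply]
    exact gridEmb_std i r
  rw [this]; rfl

section act

variable {N M : ℕ} {q : ℂ} (hq : q ≠ 0) (hq2 : q ^ 2 ≠ 1)

theorem gridMap_actN {u : Uq N q} {T : Module.End ℂ (ExteriorAlgebra ℂ (ℕ × ℕ →₀ ℂ))}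
    (h : ∀ z, wedge gridBasis N M (tensorRep (Uq.comul N hq) (fockRep N hq hq2) M u z) =
      T (wedge gridBasis N M z)) (x : Ext N M) :
    gridMap N M (actN N M hq hq2 u x) = T (gridMap N M x) := by
  obtain ⟨z, rfl⟩ := (equivV N M).surjective x
  have : actN N M hq hq2 u (equivV N M z) =
      equivV N M (tensorRep (Uq.comul N hq) (fockRep N hq hq2) M u z) :=
    congrArg (fun y => equivV N M (tensorRep (Uq.comul N hq) (fockRep N hq hq2) M u y))
      ((equivV N M).symm_apply_apply z)
  rw [this, gridMap_equivV, gridMap_equivV, h]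

theorem gridMap_actM {u : Uq M q} {T : Module.End ℂ (ExteriorAlgebra ℂ (ℕ × ℕ →₀ ℂ))}
    (h : ∀ z, wedge gridBasis' M N (tensorRep (Uq.comulOp M hq) (fockRep M hq hq2) N u z) =
      T (wedge gridBasis' M N z)) (x : Ext N M) :
    gridMap N M (actM N M hq hq2 u x) = T (gridMap N M x) := by
  obtain ⟨z, rfl⟩ := (equivW N M).surjective x
  have : actM N M hq hq2 u (equivW N M z) =
      equivW N M (tensorRep (Uq.comulOp M hq) (fockRep M hq hq2) N u z) :=
    congrArg (fun y => equivW N M (tensorRep (Uq.comulOp M hq) (fockRep M hq hq2) N u y))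
      ((equivW N M).symm_apply_apply z)
  rw [this, gridMap_equivW, gridMap_equivW, h]

theorem gridPair : GridPair (actN N M hq hq2) (actM N M hq hq2) (gridMap N M) (cr gridBasis)
    (an gridBasis) (dg gridBasis q) 1 where
  injective := gridMap_injective N M
  -- A site outside the box in the row direction is empty by the description of x as a tensor power
  -- of ⋀ W, in the column direction by the description with ⋀ V.
  supp i r x h := by
    by_cases hr : r < M
    · obtain ⟨z, rfl⟩ := (equivW N M).surjective x
      rw [gridMap_equivW]
      have := an_wedge gridBasis' (i := r) (r := i) (m := N) (by omega) z
      rw [an_swap] at this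
      exact this
    · obtain ⟨z, rfl⟩ := (equivV N M).surjective x
      rw [gridMap_equivV]
      exact an_wedge gridBasis (by omega) z
  vac_mem := ⟨1, map_one (ExteriorAlgebra.map (gridEmb N M))⟩
  cr_mem i r hi hr x hx := by
    obtain ⟨y, rfl⟩ := hx
    refine ⟨ExteriorAlgebra.ι ℂ (stdVec ⟨i, hi⟩ ⊗ₜ stdVec ⟨r, hr⟩) * y, ?_⟩
    refine (map_mul (ExteriorAlgebra.map (gridEmb N M)) _ _).trans ?_
    rw [ExteriorAlgebra.map_apply_ι, gridEmb_std]; rfl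
  e_left i := gridMap_actN hq hq2 (tensorRep_comul_e hq hq2 gridBasis i M)
  f_left i := gridMap_actN hq hq2
    (T := q⁻¹ • (dg gridBasis q (-rowPre i M) ∘ₗ lowerRow (cr gridBasis) (an gridBasis) (dg gridBasis q) M i))
    fun z => by
      refine (tensorRep_comul_f hq hq2 gridBasis i M z).trans ?_
      refine (lineOp'_apply_eq (fermi gridBasis hq) (Nat.succ_ne_self i) M _).trans ?_
      rw [lineOp_lowerRow, rootW_symm, preW_neg, rowPre_eq]; rfl
  t_left i := gridMap_actN hq hq2 fun z => by
    rw [tensorRep_t hq hq2 gridBasis (comul_t hq), preW_unitW]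
  tinv_left i := gridMap_actN hq hq2 fun z => by
    rw [tensorRep_tinv hq hq2 gridBasis (comul_tinv hq), preW_neg, preW_unitW]
  e_right i := gridMap_actM hq hq2
    (T := q⁻¹ • (dg gridBasis q (-colPre i N) ∘ₗ raiseCol (cr gridBasis) (an gridBasis) (dg gridBasis q) N i))
    fun z => by
      refine (tensorRep_comulOp_e hq hq2 gridBasis' i N z).trans ?_
      refine (lineOp'_apply_eq (fermi gridBasis' hq) (Nat.succ_ne_self i).symm N _).trans ?_
      rw [cr_swap, an_swap, dg_swap, lineOp_raiseCol, rootW_symm, preW_neg]; rfl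
  f_right i := gridMap_actM hq hq2 fun z => by
    refine (tensorRep_comulOp_f hq hq2 gridBasis' i N z).trans ?_
    rw [cr_swap, an_swap, dg_swap, lineOp_lowerCol]
  t_right i := gridMap_actM hq hq2 fun z => by
    rw [tensorRep_t hq hq2 gridBasis' (comulOp_t hq), dg_swap, ← preW_unitW_swap]
  tinv_right i := gridMap_actM hq hq2 fun z => by
    rw [tensorRep_tinv hq hq2 gridBasis' (comulOp_tinv hq), dg_swap, preW_neg, ← preW_unitW_swap]; rfl

end act

/-! ### Density and simple representations -/

section density

variable {A H : Type} [Ring A] [Algebra ℂ A] [AddCommGroup H] [Module ℂ H]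

/-- The density theorem for a representation generated, under its commutant, by simple invariant
subspaces. -/
theorem mem_range_of_commute [FiniteDimensional ℂ H] (ρ : A →ₐ[ℂ] Module.End ℂ H) {ι : Type}
    (Q : ι → Submodule ℂ H) (hQ : ∀ i a, ∀ x ∈ Q i, ρ a x ∈ Q i)
    (hs : ∀ i (P : Submodule ℂ H), P ≤ Q i → (∀ a, ∀ x ∈ P, ρ a x ∈ P) → P = ⊥ ∨ P = Q i)
    (hspan : ∀ P : Submodule ℂ H, (∀ i, ∀ T : Module.End ℂ H, (∀ a, Commute T (ρ a)) →
      ∀ x ∈ Q i, T x ∈ P) → P = ⊤)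
    (h : Module.End ℂ H) (hh : ∀ g : Module.End ℂ H, (∀ a, Commute g (ρ a)) → Commute h g) :
    h ∈ ρ.range := by
  let _ : Module A H := Module.compHom H ρ.toRingHom
  have hsmul (a : A) (x : H) : a • x = ρ a x := rfl
  have : IsScalarTower ℂ A H := ⟨fun c a x => by rw [hsmul, hsmul, map_smul]; rfl⟩
  let Q' (i : ι) : Submodule A H := { Q i with smul_mem' := fun a x hx => hQ i a x hx }
  have semi (i) : IsSemisimpleModule A (Q' i) := by
    by_cases h0 : Q i = ⊥
    · have : Subsingleton (Q' i) := ⟨fun x y => Subtype.ext <| by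
        have hx : x.1 ∈ Q i := x.2
        have hy : y.1 ∈ Q i := y.2
        rw [h0, Submodule.mem_bot] at hx hy
        rw [hx, hy]⟩
      exact (isSemisimpleModule_iff _ _).2
        ⟨fun P => ⟨⊥, disjoint_bot_right, codisjoint_iff.2 (Subsingleton.elim _ _)⟩⟩
    · have : IsSimpleModule A (Q' i) := by
        rw [isSimpleModule_iff_isAtom]
        refine ⟨fun hb => h0 ?_, fun P hP => ?_⟩
        · refine (Submodule.eq_bot_iff _).2 fun x hx => ?_
          have : x ∈ Q' i := hx
          rwa [hb, Submodule.mem_bot] at this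
        · rcases hs i (P.restrictScalars ℂ) hP.le (fun a x hx => P.smul_mem a hx) with h1 | h1
          · exact (Submodule.restrictScalars_eq_bot_iff ℂ A H).1 h1
          · exact absurd (fun x hx => by
              have : x ∈ Q i := hx
              rw [← h1] at this; exact this) (not_le_of_gt hP)
      infer_instance
  -- The images of the simple subspaces under the commutant. Each is a quotient of a semisimple
  -- module and by `hspan` they sum to everything, so H is a semisimple A-module.
  let R : ι × {T : Module.End ℂ H // ∀ a, Commute T (ρ a)} → Submodule A H := fun p =>
    LinearMap.range (({ p.2.1 with
      map_smul' := fun a x => LinearMap.congr_fun (p.2.2 a).eq x } : H →ₗ[A] H) ∘ₗ (Q' p.1).subtype)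
  have hR : ⨆ p, R p = ⊤ := by
    refine (Submodule.restrictScalars_eq_top_iff ℂ A H).1 (hspan _ fun i T hT x hx => ?_)
    exact Submodule.mem_iSup_of_mem (p := R) ⟨i, T, hT⟩ ⟨⟨x, hx⟩, rfl⟩
  have : IsSemisimpleModule A H :=
    isSemisimpleModule_of_isSemisimpleModule_submodule' (fun p => by
      have := semi p.1; exact .range _) hR
  let h' : Module.End (Module.End A H) H :=
    { h with
      map_smul' := fun g x => LinearMap.congr_fun
        (hh (g.restrictScalars ℂ) fun a => LinearMap.ext fun y => g.map_smul a y).eq x }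
  -- Density gives agreement with some ρ a on any finite set; a finite spanning set over ℂ makes it
  -- agreement everywhere.
  obtain ⟨s, hs⟩ := Module.Finite.fg_top (R := ℂ) (M := H)
  obtain ⟨a, ha⟩ := jacobson_density h' s
  refine ⟨a, LinearMap.ext fun x => ?_⟩
  have hx : x ∈ Submodule.span ℂ (s : Set H) := hs ▸ Submodule.mem_top
  exact LinearMap.eqOn_span (f := ρ a) (g := h) (fun y hy => (ha y hy).symm) hx

theorem exists_inf_eigenspace {P : Submodule ℂ H} [FiniteDimensional ℂ H] (hP : P ≠ ⊥)
    (T : Module.End ℂ H) (hT : ∀ x ∈ P, T x ∈ P) : ∃ θ : ℂ, P ⊓ Module.End.eigenspace T θ ≠ ⊥ := by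
  have : Nontrivial P := Submodule.nontrivial_iff_ne_bot.2 hP
  obtain ⟨θ, hθ⟩ := Module.End.exists_eigenvalue (T.restrict hT)
  obtain ⟨x, hx, hx0⟩ := hθ.exists_hasEigenvector
  refine ⟨θ, fun h => hx0 (Subtype.ext ?_)⟩
  have : x.1 ∈ P ⊓ Module.End.eigenspace T θ :=
    ⟨x.2, Module.End.mem_eigenspace_iff.2 (congrArg Subtype.val (Module.End.mem_eigenspace_iff.1 hx))⟩
  rwa [h, Submodule.mem_bot] at this

theorem exists_common_eigenvector [FiniteDimensional ℂ H] (L : List (Module.End ℂ H))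
    (hL : ∀ S ∈ L, ∀ T ∈ L, Commute S T) : ∀ P : Submodule ℂ H, P ≠ ⊥ →
    (∀ T ∈ L, ∀ x ∈ P, T x ∈ P) → ∃ x ∈ P, x ≠ 0 ∧ ∀ T ∈ L, ∃ θ : ℂ, T x = θ • x := by
  induction L with
  | nil =>
    intro P hP _
    obtain ⟨x, hx, hx0⟩ := P.ne_bot_iff.1 hP
    exact ⟨x, hx, hx0, by simp⟩
  | cons S L ih =>
    intro P hP hT
    obtain ⟨θ, hθ⟩ := exists_inf_eigenspace hP S (hT S (by simp))
    obtain ⟨x, ⟨hx, hxS⟩, hx0, hx'⟩ := ih (fun S hS T hT => hL S (by simp [hS]) T (by simp [hT])) _ hθ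
      fun T hTL x hx => ⟨hT T (by simp [hTL]) x hx.1, Module.End.mem_eigenspace_iff.2 <| by
        have := LinearMap.congr_fun (hL S (by simp) T (by simp [hTL])).eq x
        rw [Module.End.mul_apply, Module.End.mul_apply, Module.End.mem_eigenspace_iff.1 hx.2,
          map_smul] at this
        exact this⟩
    refine ⟨x, hx, hx0, fun T hT => ?_⟩
    rcases List.mem_cons.1 hT with rfl | hT
    · exact ⟨θ, Module.End.mem_eigenspace_iff.1 hxS⟩
    · exact hx' T hT

/-- Burnside's theorem. -/
theorem IsSimpleAction.surjective [FiniteDimensional ℂ H] {ρ : A →ₐ[ℂ] Module.End ℂ H}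
    (h : IsSimpleAction ρ) : Function.Surjective ρ := by
  have := h.1
  refine fun T => mem_range_of_commute ρ (fun _ : Unit => ⊤) (by simp)
    (fun _ P _ hP => h.2 P hP) (fun P hP => ?_) T fun g hg => ?_
  · exact eq_top_iff.2 fun x _ => hP () 1 (fun a => Commute.one_left _) x trivial
  -- Schur's lemma: an eigenspace of g is invariant, so g is a scalar and commutes with T.
  · obtain ⟨θ, hθ⟩ := exists_inf_eigenspace (P := (⊤ : Submodule ℂ H)) top_ne_bot g (by simp)
    rw [top_inf_eq] at hθ
    have := (h.2 (Module.End.eigenspace g θ) fun a x hx => Module.End.mem_eigenspace_iff.2 <| by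
      have := LinearMap.congr_fun (hg a).eq x
      rw [Module.End.mul_apply, Module.End.mul_apply, Module.End.mem_eigenspace_iff.1 hx,
        map_smul] at this
      exact this).resolve_left hθ
    refine LinearMap.ext fun x => ?_
    have hg' (y) : g y = θ • y := Module.End.mem_eigenspace_iff.1 (this ▸ Submodule.mem_top)
    rw [Module.End.mul_apply, Module.End.mul_apply, hg', hg', map_smul]

/-- By Burnside's theorem an invariant subspace is stable under every S ⊗ T. Rank one operators turn
any nonzero element into a pure tensor, and that into all pure tensors. -/
theorem isSimpleAction_tensor {A' H' : Type} [Ring A'] [Algebra ℂ A'] [AddCommGroup H'] [Module ℂ H']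
    [FiniteDimensional ℂ H] [FiniteDimensional ℂ H'] {ρ : A →ₐ[ℂ] Module.End ℂ H}
    {ρ' : A' →ₐ[ℂ] Module.End ℂ H'} (h : IsSimpleAction ρ) (h' : IsSimpleAction ρ') :
    IsSimpleAction ((Module.endTensorEndAlgHom (R := ℂ) (S := ℂ) (A := ℂ)).comp
      (Algebra.TensorProduct.map ρ ρ')) := by
  have := h.1
  have := h'.1
  let b := Module.finBasis ℂ H
  let b' := Module.finBasis ℂ H'
  refine ⟨?_, fun P hP => or_iff_not_imp_left.2 fun h0 => ?_⟩
  · have := b.index_nonempty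
    have := b'.index_nonempty
    exact (b.tensorProduct b').repr.toEquiv.nontrivial
  · obtain ⟨z, hz, hz0⟩ := P.ne_bot_iff.1 h0
    have hP' (S : Module.End ℂ H) (T : Module.End ℂ H') (x) (hx : x ∈ P) : TensorProduct.map S T x ∈ P := by
      obtain ⟨a, rfl⟩ := h.surjective S
      obtain ⟨a', rfl⟩ := h'.surjective T
      exact hP (a ⊗ₜ a') x hx
    -- Expand z in a basis of H with coefficients in H'; some coefficient y is nonzero, and a rank
    -- one operator on H isolates it.
    obtain ⟨i, hi⟩ : ∃ i, TensorProduct.equivFinsuppOfBasisLeft (N := H') b z i ≠ 0 := by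
      by_contra! hc
      exact hz0 ((TensorProduct.equivFinsuppOfBasisLeft (N := H') b).map_eq_zero_iff.1 (Finsupp.ext hc))
    set y := TensorProduct.equivFinsuppOfBasisLeft (N := H') b z i with hy
    have h1 (x : H) : x ⊗ₜ y ∈ P := by
      have : TensorProduct.map ((b.coord i).smulRight x) LinearMap.id z = x ⊗ₜ[ℂ] y := by
        rw [hy]
        clear hy hi hz hz0
        clear_value b
        clear y
        induction z using TensorProduct.induction_on with
        | zero => simp
        | tmul u w => simp [TensorProduct.smul_tmul]
        | add u w hu hw => rw [map_add, hu, hw, map_add, Finsupp.add_apply, TensorProduct.tmul_add]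
      rw [← this]
      exact hP' _ _ z hz
    obtain ⟨φ, hφ⟩ := Module.Projective.exists_dual_eq_one ℂ hi
    rw [eq_top_iff, ← TensorProduct.span_tmul_eq_top, Submodule.span_le]
    rintro _ ⟨x, w, rfl⟩
    have := hP' LinearMap.id (φ.smulRight w) _ (h1 x)
    rw [TensorProduct.map_tmul] at this
    simpa [hφ] using this

end density

/-! ### Highest weight vectors -/

section skew

variable {A : Type*} [Ring A] [Algebra ℂ A] {q : ℂ}

theorem pow_skew {a x : A} {m : ℤ} (h : a * x = q ^ m • (x * a)) (k : ℕ) :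
    a ^ k * x = q ^ (k * m) • (x * a ^ k) := by
  induction k with
  | zero => simp
  | succ k ih =>
    rw [pow_succ', mul_assoc, ih, mul_smul_comm, ← mul_assoc, h, smul_mul_assoc, smul_smul, mul_assoc]
    by_cases hq : q = 0
    · subst hq
      rcases eq_or_ne m 0 with rfl | hm
      · simp
      · rw [zero_zpow m hm, mul_zero, zero_zpow _ (mul_ne_zero (by omega) hm)]
    · rw [← zpow_add₀ hq]; congr 2; push_cast; ring

theorem list_prod_skew (hq : q ≠ 0) {ι : Type*} {a : ι → A} {x : A} {m : ι → ℤ}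
    (h : ∀ i, a i * x = q ^ m i • (x * a i)) (L : List ι) :
    (L.map a).prod * x = q ^ (L.map m).sum • (x * (L.map a).prod) := by
  induction L with
  | nil => simp
  | cons i L ih =>
    rw [List.map_cons, List.map_cons, List.prod_cons, List.sum_cons, zpow_add₀ hq]
    exact skew_mul (h i) ih

end skew

namespace Uq

variable {n : ℕ} {q : ℂ}

variable (n q) in
/-- An element of the torus for which all simple roots have the same weight. -/
def height : Uq n q := ((List.finRange n).map fun i => t q i ^ (i.1 + 1)).prod

/-- The root ε_j - ε_{j+1} pairs with the exponents as (j + 1) - (j + 2) = -1, independently of j.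
Hence every e_j lowers and every f_j raises the exponent of `height` by one. -/
theorem sum_pair (j : Fin (n - 1)) :
    ((List.finRange n).map fun i => ((i.1 + 1 : ℕ) : ℤ) * pair i j).sum = -1 := by
  rw [← Fin.sum_univ_def]
  simp only [pair, mul_sub, Finset.sum_sub_distrib, mul_ite, mul_one, mul_zero]
  rw [Finset.sum_ite_eq' Finset.univ (lo j), Finset.sum_ite_eq' Finset.univ (hi j)]
  simp [lo, hi]

theorem height_e (hq : q ≠ 0) (j : Fin (n - 1)) : height n q * e q j = q⁻¹ • (e q j * height n q) := by
  have := list_prod_skew hq (fun i : Fin n => pow_skew (skew_of_conj (satisfies.tinv_t i)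
    (satisfies.t_e i j)) (i.1 + 1)) (List.finRange n)
  rwa [sum_pair, zpow_neg_one] at this

theorem height_f (hq : q ≠ 0) (j : Fin (n - 1)) : height n q * f q j = q • (f q j * height n q) := by
  have := list_prod_skew hq (fun i : Fin n => pow_skew (skew_of_conj (satisfies.tinv_t i)
    (satisfies.t_f i j)) (i.1 + 1)) (List.finRange n)
  have h2 : ((List.finRange n).map fun i => ((i.1 + 1 : ℕ) : ℤ) * -pair i j).sum = 1 := by
    rw [← Fin.sum_univ_def]
    simp only [mul_neg, Finset.sum_neg_distrib]
    rw [Fin.sum_univ_def, sum_pair, neg_neg]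
  rwa [h2, zpow_one] at this

theorem isUnit_t (i : Fin n) : IsUnit (t q i) :=
  ⟨⟨t q i, tinv q i, satisfies.t_tinv i, satisfies.tinv_t i⟩, rfl⟩

theorem isUnit_height : IsUnit (height n q) :=
  List.prod_isUnit fun x hx => by
    obtain ⟨i, _, rfl⟩ := List.mem_map.1 hx
    exact (isUnit_t i).pow _

variable {H : Type} [AddCommGroup H] [Module ℂ H] (ρ : Uq n q →ₐ[ℂ] Module.End ℂ H)

theorem pow_apply {θ : ℂ} {x : H} {a : Uq n q} (h : ρ a x = θ • x) (k : ℕ) :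
    ρ (a ^ k) x = θ ^ k • x := by
  induction k with
  | zero => simp
  | succ k ih => rw [pow_succ', map_mul, Module.End.mul_apply, ih, map_smul, h, smul_smul, pow_succ]

theorem list_prod_apply {ι : Type*} {a : ι → Uq n q} {θ : ι → ℂ} {x : H}
    (h : ∀ i, ρ (a i) x = θ i • x) (L : List ι) : ρ (L.map a).prod x = (L.map θ).prod • x := by
  induction L with
  | nil => simp
  | cons i L ih =>
    rw [List.map_cons, List.map_cons, List.prod_cons, List.prod_cons, map_mul, Module.End.mul_apply,
      ih, map_smul, h, smul_smul, mul_comm]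

theorem list_prod_mem {P : Submodule ℂ H} {L : List (Uq n q)} (h : ∀ a ∈ L, ∀ x ∈ P, ρ a x ∈ P) :
    ∀ x ∈ P, ρ L.prod x ∈ P := by
  induction L with
  | nil => simp
  | cons a L ih =>
    intro x hx
    rw [List.prod_cons, map_mul]
    exact h a (by simp) _ (ih (fun b hb => h b (by simp [hb])) x hx)

theorem exists_height_apply {θ : Fin n → ℂ} {x : H} (h : ∀ i, ρ (t q i) x = θ i • x) :
    ∃ z : ℂ, ρ (height n q) x = z • x :=
  ⟨_, list_prod_apply ρ (θ := fun i => θ i ^ (i.1 + 1)) (fun i => pow_apply ρ (h i) (i.1 + 1)) _⟩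

theorem height_mem {P : Submodule ℂ H} (h : ∀ i, ∀ x ∈ P, ρ (t q i) x ∈ P) :
    ∀ x ∈ P, ρ (height n q) x ∈ P :=
  list_prod_mem ρ fun a ha => by
    obtain ⟨i, _, rfl⟩ := List.mem_map.1 ha
    have := list_prod_mem ρ (P := P) (L := List.replicate (i.1 + 1) (t q i)) fun b hb => by
      rw [List.eq_of_mem_replicate hb]; exact h i
    rwa [List.prod_replicate] at this

theorem height_ne_zero {x : H} (hx : x ≠ 0) : ρ (height n q) x ≠ 0 := by
  intro h
  obtain ⟨u, hu⟩ := isUnit_height (n := n) (q := q)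
  refine hx ?_
  have := congrArg (ρ (↑u⁻¹)) h
  rwa [map_zero, ← Module.End.mul_apply, ← map_mul, ← hu, Units.inv_mul, map_one] at this

theorem height_e_apply (hq : q ≠ 0) {x : H} {z : ℂ} (h : ρ (height n q) x = z • x) (j : Fin (n - 1)) :
    ρ (height n q) (ρ (e q j) x) = (q⁻¹ * z) • ρ (e q j) x := by
  rw [← Module.End.mul_apply, ← map_mul, height_e hq, map_smul, map_mul, LinearMap.smul_apply,
    Module.End.mul_apply, h, map_smul, smul_smul]

theorem height_f_apply (hq : q ≠ 0) {x : H} {z : ℂ} (h : ρ (height n q) x = z • x) (j : Fin (n - 1)) :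
    ρ (height n q) (ρ (f q j) x) = (q * z) • ρ (f q j) x := by
  rw [← Module.End.mul_apply, ← map_mul, height_f hq, map_smul, map_mul, LinearMap.smul_apply,
    Module.End.mul_apply, h, map_smul, smul_smul]

/-- The vectors killed by all `e_i`. -/
def killed : Submodule ℂ H := ⨅ i, LinearMap.ker (ρ (e q i))

theorem mem_killed {x : H} : x ∈ killed ρ ↔ ∀ i, ρ (e q i) x = 0 := by simp [killed]

/-- A nonzero invariant subspace contains a nonzero vector killed by all `e_i`. -/
theorem inf_killed_ne_bot [FiniteDimensional ℂ H] (hq : q ≠ 0) (hroot : ∀ n : ℕ, 0 < n → q ^ n ≠ 1)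
    {P : Submodule ℂ H} (hP : P ≠ ⊥) (he : ∀ i, ∀ x ∈ P, ρ (e q i) x ∈ P)
    (ht : ∀ i, ∀ x ∈ P, ρ (t q i) x ∈ P) : P ⊓ killed ρ ≠ ⊥ := by
  intro hbot
  obtain ⟨θ, hθ⟩ := exists_inf_eigenspace hP _ (height_mem ρ ht)
  obtain ⟨x, hx, hx0⟩ := Submodule.ne_bot_iff _ |>.1 hθ
  have hx' := Module.End.mem_eigenspace_iff.1 hx.2
  have hθ0 : θ ≠ 0 := by
    rintro rfl
    exact height_ne_zero ρ hx0 (by rw [hx', zero_smul])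
  -- If no nonzero vector of P were killed, some e_i could be applied again and again, giving
  -- infinitely many eigenvalues q^(-k) θ of `height` in finite dimension.
  have key (k : ℕ) : ∃ x ∈ P, x ≠ 0 ∧ ρ (height n q) x = (q⁻¹ ^ k * θ) • x := by
    induction k with
    | zero => exact ⟨x, hx.1, hx0, by rw [hx', pow_zero, one_mul]⟩
    | succ k ih =>
      obtain ⟨y, hy, hy0, hyk⟩ := ih
      have : ∃ i, ρ (e q i) y ≠ 0 := by
        by_contra! hc
        have : y ∈ P ⊓ killed ρ := ⟨hy, (mem_killed ρ).2 hc⟩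
        rw [hbot, Submodule.mem_bot] at this
        exact hy0 this
      obtain ⟨i, hi⟩ := this
      exact ⟨_, he i y hy, hi, by rw [height_e_apply ρ hq hyk, pow_succ', mul_assoc]⟩
  have inj : Function.Injective fun k : ℕ => q⁻¹ ^ k * θ := fun k l hkl => by
    have h1 := mul_right_cancel₀ hθ0 hkl
    have := zpow_injective_of_not_root hq hroot (a := -(k : ℤ)) (b := -(l : ℤ)) (by
      simpa [zpow_neg] using h1)
    omega
  refine (Set.infinite_of_injective_forall_mem (s := {z | (ρ (height n q)).HasEigenvalue z}) inj
    fun k => ?_) (Module.End.finite_hasEigenvalue _)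
  obtain ⟨y, _, hy0, hyk⟩ := key k
  exact Module.End.hasEigenvalue_of_hasEigenvector ⟨Module.End.mem_eigenspace_iff.2 hyk, hy0⟩

/-- The vector obtained by applying a word in the `f_i`. -/
def word (v : H) : List (Fin (n - 1)) → H
  | [] => v
  | i :: l => ρ (f q i) (word v l)

theorem t_f_apply {x : H} {z : ℂ} {i : Fin n} (h : ρ (t q i) x = z • x) (j : Fin (n - 1)) :
    ρ (t q i) (ρ (f q j) x) = (q ^ (-pair i j) * z) • ρ (f q j) x := by
  rw [← Module.End.mul_apply, ← map_mul, skew_of_conj (satisfies.tinv_t i) (satisfies.t_f i j),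
    map_smul, map_mul, LinearMap.smul_apply, Module.End.mul_apply, h, map_smul, smul_smul]

section word

variable {ρ} {v : H} {θ : Fin n → ℂ}

theorem word_t (hv : ∀ i, ρ (t q i) v = θ i • v) (l : List (Fin (n - 1))) (i : Fin n) : ∃ z : ℂ, ρ (t q i) (word ρ v l) = z • word ρ v l := by
  induction l with
  | nil => exact ⟨_, hv i⟩
  | cons j l ih =>
    obtain ⟨z, hz⟩ := ih
    exact ⟨_, t_f_apply ρ hz j⟩

theorem word_height (hq : q ≠ 0) {z : ℂ} (hz : ρ (height n q) v = z • v) (l : List (Fin (n - 1))) :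
    ρ (height n q) (word ρ v l) = (q ^ l.length * z) • word ρ v l := by
  induction l with
  | nil => rw [List.length_nil, pow_zero, one_mul]; exact hz
  | cons j l ih =>
    rw [word, height_f_apply ρ hq ih, List.length_cons, pow_succ', mul_assoc]

theorem word_e (hv : ∀ i, ρ (t q i) v = θ i • v) 
    (he : ∀ i, ρ (e q i) v = 0) (l : List (Fin (n - 1))) (i : Fin (n - 1)) :
    ρ (e q i) (word ρ v l) ∈ Submodule.span ℂ (Set.range (word ρ v)) := by
  induction l with
  | nil => rw [word, he]; exact zero_mem _
  | cons j l ih =>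
    have hf (x) (hx : x ∈ Submodule.span ℂ (Set.range (word ρ v))) :
        ρ (f q j) x ∈ Submodule.span ℂ (Set.range (word ρ v)) := by
      induction hx using Submodule.span_induction with
      | mem x hx =>
        obtain ⟨l, rfl⟩ := hx
        exact Submodule.subset_span ⟨j :: l, rfl⟩
      | zero => rw [map_zero]; exact zero_mem _
      | add x y _ _ hx hy => rw [map_add]; exact add_mem hx hy
      | smul c x _ hx => rw [map_smul]; exact Submodule.smul_mem _ c hx
    have h1 : ρ (e q i) (word ρ v (j :: l)) = ρ (f q j) (ρ (e q i) (word ρ v l)) +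
        ρ (e q i * f q j - f q j * e q i) (word ρ v l) := by
      rw [map_sub, map_mul, map_mul, LinearMap.sub_apply, Module.End.mul_apply, Module.End.mul_apply,
        add_sub_cancel]; rfl
    rw [h1, e_f]
    refine add_mem (hf _ ih) ?_
    choose z hz using word_t hv l
    split_ifs
    · rw [map_smul, map_sub, k, kinv, map_mul, map_mul, LinearMap.smul_apply, LinearMap.sub_apply,
        Module.End.mul_apply, Module.End.mul_apply, tinv_apply ρ (hz _), tinv_apply ρ (hz _), map_smul,
        map_smul, hz, hz, smul_smul, smul_smul, ← sub_smul, smul_smul]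
      exact Submodule.smul_mem _ _ (Submodule.subset_span ⟨l, rfl⟩)
    · rw [map_zero]; exact zero_mem _

/-- The span of the words is stable under the f_i by construction, under the torus because words are
weight vectors, and under the e_i by commuting e_i to the right until it meets v. -/
theorem apply_mem_span_word (hv : ∀ i, ρ (t q i) v = θ i • v) 
    (he : ∀ i, ρ (e q i) v = 0) (a : Uq n q) :
    ρ a v ∈ Submodule.span ℂ (Set.range (word ρ v)) := by
  set W := Submodule.span ℂ (Set.range (word ρ v)) with hW
  let S : Subalgebra ℂ (Uq n q) :=
    { carrier := {a | ∀ x ∈ W, ρ a x ∈ W}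
      mul_mem' := fun {a b} ha hb x hx => by rw [map_mul]; exact ha _ (hb x hx)
      add_mem' := fun {a b} ha hb x hx => by rw [map_add]; exact add_mem (ha x hx) (hb x hx)
      algebraMap_mem' := fun r x hx => by
        rw [AlgHom.commutes, Module.algebraMap_end_apply]; exact Submodule.smul_mem _ _ hx }
  have hS (a : Uq n q) (h : ∀ l, ρ a (word ρ v l) ∈ W) : a ∈ S := fun x hx => by
    induction hx using Submodule.span_induction with
    | mem x hx => obtain ⟨l, rfl⟩ := hx; exact h l
    | zero => rw [map_zero]; exact zero_mem _
    | add x y _ _ hx hy => rw [map_add]; exact add_mem hx hy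
    | smul c x _ hx => rw [map_smul]; exact Submodule.smul_mem _ c hx
  refine mem_of_generators S (fun i => hS _ fun l => word_e hv he l i)
    (fun i => hS _ fun l => Submodule.subset_span ⟨i :: l, rfl⟩) (fun i => hS _ fun l => ?_)
    (fun i => hS _ fun l => ?_) a v (Submodule.subset_span ⟨[], rfl⟩)
  · obtain ⟨z, hz⟩ := word_t hv l i
    rw [hz]; exact Submodule.smul_mem _ _ (Submodule.subset_span ⟨l, rfl⟩)
  · obtain ⟨z, hz⟩ := word_t hv l i
    rw [tinv_apply ρ hz]; exact Submodule.smul_mem _ _ (Submodule.subset_span ⟨l, rfl⟩)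

end word

end Uq

/-! ### Double centralizers and the decomposition -/

/-- A dimension count: even for a degenerate form, the orthogonal complement of U has dimension at
least dim H - dim U, so it meets every W larger than U. This serves as the substitute for complete
reducibility. -/
theorem eq_of_inf_orthogonal {H : Type} [AddCommGroup H] [Module ℂ H] [FiniteDimensional ℂ H]
    {B : LinearMap.BilinForm ℂ H} {U W : Submodule ℂ H} (hUW : U ≤ W) (h : W ⊓ B.orthogonal U = ⊥) :
    U = W := by
  refine Submodule.eq_of_le_of_finrank_le hUW ?_
  have h1 := LinearMap.BilinForm.finrank_add_finrank_orthogonal' (B := B) U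
  have h2 := Submodule.finrank_sup_add_finrank_inf_eq W (B.orthogonal U)
  rw [h, finrank_bot] at h2
  have h3 := Submodule.finrank_le (W ⊔ B.orthogonal U)
  omega

namespace Uq

variable {n : ℕ} {q : ℂ} {H : Type} [AddCommGroup H] [Module ℂ H] (ρ : Uq n q →ₐ[ℂ] Module.End ℂ H)

theorem t_mem_killed (hq : q ≠ 0) {x : H} (hx : x ∈ killed ρ) (i : Fin n) :
    ρ (t q i) x ∈ killed ρ := by
  refine (mem_killed ρ).2 fun j => ?_
  have h := LinearMap.congr_fun (congrArg ρ (skew_of_conj (satisfies.tinv_t i)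
    (satisfies.t_e (q := q) i j))) x
  rw [map_smul, map_mul, map_mul, LinearMap.smul_apply, Module.End.mul_apply, Module.End.mul_apply,
    (mem_killed ρ).1 hx, map_zero] at h
  exact (smul_eq_zero.1 h.symm).resolve_left (zpow_ne_zero _ hq)

/-- The vectors of highest weight `μ`. -/
def hwSpace (μ : Fin n → ℤ) : Submodule ℂ H :=
  killed ρ ⊓ ⨅ i, Module.End.eigenspace (ρ (t q i)) (q ^ μ i)

theorem mem_hwSpace {μ : Fin n → ℤ} {x : H} : x ∈ hwSpace ρ μ ↔
    (∀ i, ρ (e q i) x = 0) ∧ ∀ i, ρ (t q i) x = q ^ μ i • x := by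
  simp [hwSpace, mem_killed]

/-- The invariant subspace generated by a vector. -/
def orbit (v : H) : Submodule ℂ H := LinearMap.range (LinearMap.applyₗ v ∘ₗ ρ.toLinearMap)

theorem mem_orbit {v x : H} : x ∈ orbit ρ v ↔ ∃ a, ρ a v = x := Iff.rfl

theorem apply_mem_orbit {v x : H} (hx : x ∈ orbit ρ v) (a : Uq n q) : ρ a x ∈ orbit ρ v := by
  obtain ⟨b, rfl⟩ := hx
  exact ⟨a * b, LinearMap.congr_fun (map_mul ρ a b) v⟩

end Uq

open Uq

namespace HowePair

variable {N M : ℕ} {q : ℂ} {H : Type} [AddCommGroup H] [Module ℂ H]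
  {ρ : Uq N q →ₐ[ℂ] Module.End ℂ H} {σ : Uq M q →ₐ[ℂ] Module.End ℂ H} {B : H →ₗ[ℂ] H →ₗ[ℂ] ℂ}
  {Λ : Type} {α : Λ → Fin N → ℤ} {β : Λ → Fin M → ℤ} {v : Λ → H}

theorem swap (P : HowePair ρ σ B α β v) : HowePair σ ρ B β α v where
  comm a b := (P.comm b a).symm
  symm := P.symm
  adj_left := P.adj_right
  adj_right := P.adj_left
  form_self := P.form_self
  form_ne := P.form_ne
  form_f_left := P.form_f_right
  form_f_right := P.form_f_left
  e_left := P.e_right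
  e_right := P.e_left
  t_left := P.t_right
  t_right := P.t_left
  inj_left := P.inj_right
  inj_right := P.inj_left
  unique x h1 h2 h3 h4 := P.unique x h2 h1 h4 h3

theorem comm_apply (P : HowePair ρ σ B α β v) (a b x) : ρ a (σ b x) = σ b (ρ a x) :=
  LinearMap.congr_fun (P.comm a b).eq x

theorem ne_zero (P : HowePair ρ σ B α β v) (l) : v l ≠ 0 := fun h => by
  have := P.form_self l
  rw [h, map_zero] at this
  exact zero_ne_one this

theorem smul_right_mem (P : HowePair ρ σ B α β v) {μ : Fin M → ℤ} {x : H} (hx : x ∈ hwSpace σ μ) (a) :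
    ρ a x ∈ hwSpace σ μ := by
  rw [mem_hwSpace] at hx ⊢
  refine ⟨fun i => ?_, fun i => ?_⟩
  · rw [← P.comm_apply, hx.1, map_zero]
  · rw [← P.comm_apply, hx.2, map_smul]

theorem mem_hwSpace_right (P : HowePair ρ σ B α β v) (l) : v l ∈ hwSpace σ (β l) :=
  (mem_hwSpace σ).2 ⟨P.e_right l, P.t_right l⟩

theorem orbit_le (P : HowePair ρ σ B α β v) (l) : orbit ρ (v l) ≤ hwSpace σ (β l) := by
  rintro _ ⟨a, rfl⟩
  exact P.smul_right_mem (P.mem_hwSpace_right l) a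

/-- ρ a (v m) is a multiple of v m plus vectors in the images of the f_i. After commuting σ b past
the f_i, those vectors are orthogonal to v l. -/
theorem form_apply_left (P : HowePair ρ σ B α β v) (l m) (a b) :
    ∃ c : ℂ, B (v l) (ρ a (σ b (v m))) = c * B (v l) (σ b (v m)) := by
  have h := apply_mem_span_word (ρ := ρ) (P.t_left m) (P.e_left m) a
  have key : ∀ x ∈ Submodule.span ℂ (Set.range (word ρ (v m))),
      ∃ c : ℂ, B (v l) (σ b x) = c * B (v l) (σ b (v m)) := by
    intro x hx
    induction hx using Submodule.span_induction with
    | mem x hx =>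
      obtain ⟨w, rfl⟩ := hx
      cases w with
      | nil => exact ⟨1, (one_mul _).symm⟩
      | cons i w => exact ⟨0, by rw [word, ← P.comm_apply, P.form_f_left, zero_mul]⟩
    | zero => exact ⟨0, by simp⟩
    | add x y _ _ hx hy =>
      obtain ⟨c, hc⟩ := hx
      obtain ⟨d, hd⟩ := hy
      exact ⟨c + d, by rw [map_add, map_add, hc, hd, add_mul]⟩
    | smul z x _ hx =>
      obtain ⟨c, hc⟩ := hx
      exact ⟨z * c, by rw [map_smul, map_smul, hc, smul_eq_mul, mul_assoc]⟩
  obtain ⟨c, hc⟩ := key _ h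
  exact ⟨c, by rw [P.comm_apply, hc]⟩

/-- Remove a first and then, with the two algebras exchanged, b; what remains is a multiple of B (v
l) (v m). -/
theorem form_apply (P : HowePair ρ σ B α β v) {l m} (h : l ≠ m) (a b) :
    B (v l) (ρ a (σ b (v m))) = 0 := by
  obtain ⟨c, hc⟩ := P.form_apply_left l m a b
  obtain ⟨d, hd⟩ := P.swap.form_apply_left l m b 1
  rw [map_one, Module.End.one_apply, P.form_ne l m h, mul_zero] at hd
  rw [hc, hd, mul_zero]

theorem orthogonal (P : HowePair ρ σ B α β v) {l m} (h : l ≠ m) (a b a' b') :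
    B (ρ a (σ b (v l))) (ρ a' (σ b' (v m))) = 0 := by
  obtain ⟨c, hc⟩ := P.adj_left a
  obtain ⟨d, hd⟩ := P.adj_right b
  rw [hc, hd, ← Module.End.mul_apply (ρ c), ← map_mul, ← P.comm_apply, ← Module.End.mul_apply (σ d),
    ← map_mul, P.form_apply h]

theorem apply_mem_orthogonal (P : HowePair ρ σ B α β v) {U : Submodule ℂ H} {a : Uq N q}
    (hU : ∀ a, ∀ x ∈ U, ρ a x ∈ U) {x : H} (hx : x ∈ LinearMap.BilinForm.orthogonal B U) :
    ρ a x ∈ LinearMap.BilinForm.orthogonal B U := by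
  obtain ⟨a', ha⟩ := P.adj_left a
  rw [LinearMap.BilinForm.mem_orthogonal_iff] at hx ⊢
  intro y hy
  have := hx _ (hU a' y hy)
  rw [P.symm, ha, P.symm, this]

theorem form_self_of_mem (P : HowePair ρ σ B α β v) {U : Submodule ℂ H} {l} (h : v l ∈ U)
    (h' : v l ∈ LinearMap.BilinForm.orthogonal B U) : False := by
  have := (LinearMap.BilinForm.mem_orthogonal_iff.1 h') _ h
  rw [P.form_self] at this
  exact one_ne_zero this

variable [FiniteDimensional ℂ H]

/-- A nonzero biinvariant subspace contains a joint highest weight vector. -/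
theorem exists_mem (P : HowePair ρ σ B α β v) (hq : q ≠ 0) (hroot : ∀ n : ℕ, 0 < n → q ^ n ≠ 1)
    {U : Submodule ℂ H} (hU : U ≠ ⊥) (hρ : ∀ a, ∀ x ∈ U, ρ a x ∈ U) (he : ∀ i, ∀ x ∈ U, σ (e q i) x ∈ U)
    (ht : ∀ i, ∀ x ∈ U, σ (t q i) x ∈ U) : ∃ l, v l ∈ U := by
  have kρ (b) (x) (hx : x ∈ killed ρ) : σ b x ∈ killed ρ :=
    (mem_killed ρ).2 fun i => by rw [P.comm_apply, (mem_killed ρ).1 hx, map_zero]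
  have kσ (b) (x) (hx : x ∈ killed σ) : ρ b x ∈ killed σ :=
    (mem_killed σ).2 fun i => by rw [← P.comm_apply, (mem_killed σ).1 hx, map_zero]
  have h1 := inf_killed_ne_bot ρ hq hroot hU (fun i => hρ _) fun i => hρ _
  have h2 := inf_killed_ne_bot σ hq hroot h1 (fun i x hx => ⟨he i x hx.1, kρ _ x hx.2⟩)
    fun i x hx => ⟨ht i x hx.1, kρ _ x hx.2⟩
  obtain ⟨x, ⟨⟨hxU, hxρ⟩, hxσ⟩, hx0, hx⟩ := exists_common_eigenvector
    (List.ofFn (fun i => ρ (t q i)) ++ List.ofFn fun i => σ (t q i)) (by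
      simp only [List.mem_append, List.mem_ofFn]
      rintro _ (⟨i, rfl⟩ | ⟨i, rfl⟩) _ (⟨j, rfl⟩ | ⟨j, rfl⟩)
      · exact (satisfies.commute_t i j).map ρ
      · exact P.comm _ _
      · exact (P.comm _ _).symm
      · exact (satisfies.commute_t i j).map σ) _ h2 (by
      simp only [List.mem_append, List.mem_ofFn]
      rintro _ (⟨i, rfl⟩ | ⟨i, rfl⟩) x ⟨⟨hx, hx'⟩, hx''⟩
      · exact ⟨⟨hρ _ x hx, t_mem_killed ρ hq hx' i⟩, kσ _ x hx''⟩
      · exact ⟨⟨ht i x hx, kρ _ x hx'⟩, t_mem_killed σ hq hx'' i⟩)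
  simp only [List.mem_append, List.mem_ofFn] at hx
  obtain ⟨l, z, rfl⟩ := (P.unique x ((mem_killed ρ).1 hxρ) ((mem_killed σ).1 hxσ)
    (fun i => hx _ (Or.inl ⟨i, rfl⟩)) fun i => hx _ (Or.inr ⟨i, rfl⟩)).resolve_left hx0
  exact ⟨l, (Submodule.smul_mem_iff U (left_ne_zero_of_smul hx0)).1 hxU⟩

/-- Inside a highest weight space of σ the operators σ e_i vanish and σ t_i are scalars, so U is
stable under what `exists_mem` requires. The joint highest weight vector found there has the same
σ-weight as v l, hence is v l. -/
theorem mem_of_le_hwSpace (P : HowePair ρ σ B α β v) (hq : q ≠ 0)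
    (hroot : ∀ n : ℕ, 0 < n → q ^ n ≠ 1) {U : Submodule ℂ H} (hU : U ≠ ⊥)
    (hρ : ∀ a, ∀ x ∈ U, ρ a x ∈ U) {l} (hl : U ≤ hwSpace σ (β l)) : v l ∈ U := by
  have hx (x) (hx : x ∈ U) := (mem_hwSpace σ).1 (hl hx)
  obtain ⟨m, hm⟩ := P.exists_mem hq hroot hU hρ
    (fun i x h => by rw [(hx x h).1]; exact zero_mem _)
    fun i x h => by rw [(hx x h).2]; exact Submodule.smul_mem _ _ h
  have : m = l := P.inj_right m l <| funext fun i => by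
    have h1 := (hx _ hm).2 i
    rw [P.t_right] at h1
    exact zpow_injective_of_not_root hq hroot (smul_left_injective ℂ (P.ne_zero m) h1)
  exact this ▸ hm

/-- Otherwise the orthogonal complement of the orbit inside the highest weight space is nonzero and
invariant, so it contains v l, which contradicts B (v l) (v l) = 1. -/
theorem orbit_eq_hwSpace (P : HowePair ρ σ B α β v) (hq : q ≠ 0)
    (hroot : ∀ n : ℕ, 0 < n → q ^ n ≠ 1) (l) : orbit ρ (v l) = hwSpace σ (β l) := by
  refine eq_of_inf_orthogonal (B := B) (P.orbit_le l) ?_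
  by_contra h
  have := P.mem_of_le_hwSpace hq hroot h (fun a x hx => ⟨P.smul_right_mem hx.1 a,
    P.apply_mem_orthogonal (fun a x hx => apply_mem_orbit ρ hx a) hx.2⟩) inf_le_left
  exact P.form_self_of_mem (U := orbit ρ (v l)) ((mem_orbit ρ).2 ⟨1, by rw [map_one]; rfl⟩) this.2

theorem orbit_simple (P : HowePair ρ σ B α β v) (hq : q ≠ 0)
    (hroot : ∀ n : ℕ, 0 < n → q ^ n ≠ 1) {l} {U : Submodule ℂ H} (hU : U ≠ ⊥)
    (hρ : ∀ a, ∀ x ∈ U, ρ a x ∈ U) (hl : U ≤ orbit ρ (v l)) : U = orbit ρ (v l) := by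
  refine le_antisymm hl ?_
  rintro _ ⟨a, rfl⟩
  exact hρ a _ (P.mem_of_le_hwSpace hq hroot hU hρ (hl.trans (P.orbit_le l)))

/-- The span L of all ρ a σ b (v l) is stable under both algebras, and so is its orthogonal
complement. If the latter were nonzero it would contain some v l, which also lies in L. -/
theorem eq_top (P : HowePair ρ σ B α β v) (hq : q ≠ 0) (hroot : ∀ n : ℕ, 0 < n → q ^ n ≠ 1)
    {U : Submodule ℂ H} (hU : ∀ a b l, ρ a (σ b (v l)) ∈ U) : U = ⊤ := by
  let L := Submodule.span ℂ {x | ∃ a b l, x = ρ a (σ b (v l))}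
  have hρ (a) (x) (hx : x ∈ L) : ρ a x ∈ L := by
    induction hx using Submodule.span_induction with
    | mem x hx =>
      obtain ⟨a', b, l, rfl⟩ := hx
      exact Submodule.subset_span ⟨a * a', b, l, by rw [map_mul]; rfl⟩
    | zero => rw [map_zero]; exact zero_mem _
    | add x y _ _ hx hy => rw [map_add]; exact add_mem hx hy
    | smul c x _ hx => rw [map_smul]; exact Submodule.smul_mem _ c hx
  have hσ (b) (x) (hx : x ∈ L) : σ b x ∈ L := by
    induction hx using Submodule.span_induction with
    | mem x hx =>
      obtain ⟨a', b', l, rfl⟩ := hx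
      exact Submodule.subset_span ⟨a', b * b', l, by rw [← P.comm_apply, map_mul]; rfl⟩
    | zero => rw [map_zero]; exact zero_mem _
    | add x y _ _ hx hy => rw [map_add]; exact add_mem hx hy
    | smul c x _ hx => rw [map_smul]; exact Submodule.smul_mem _ c hx
  have hL : L = ⊤ := by
    refine eq_of_inf_orthogonal (B := B) le_top ?_
    rw [top_inf_eq]
    by_contra h
    obtain ⟨l, hl⟩ := P.exists_mem hq hroot h (fun a x hx => P.apply_mem_orthogonal hρ hx)
      (fun i x hx => P.swap.apply_mem_orthogonal hσ hx) fun i x hx => P.swap.apply_mem_orthogonal hσ hx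
    exact P.form_self_of_mem (U := L) (Submodule.subset_span ⟨1, 1, l, by simp⟩) hl
  rw [eq_top_iff, ← hL, Submodule.span_le]
  rintro _ ⟨a, b, l, rfl⟩
  exact hU a b l

/-- The form is nondegenerate. -/
theorem eq_zero_of_form (P : HowePair ρ σ B α β v) (hq : q ≠ 0) (hroot : ∀ n : ℕ, 0 < n → q ^ n ≠ 1)
    {x : H} (hx : ∀ a b l, B x (ρ a (σ b (v l))) = 0) : x = 0 := by
  have h0 : ∀ y, B x y = 0 := by
    have := P.eq_top hq hroot (U := LinearMap.ker (B x)) hx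
    exact fun y => LinearMap.mem_ker.1 (this ▸ Submodule.mem_top)
  by_contra hx0
  -- The radical of the form is stable under both algebras; if nonzero it would contain some v l,
  -- although B (v l) (v l) = 1.
  let K := LinearMap.BilinForm.orthogonal B ⊤
  have hK : K ≠ ⊥ := K.ne_bot_iff.2 ⟨x, LinearMap.BilinForm.mem_orthogonal_iff.2 fun y _ => by
    rw [P.symm, h0], hx0⟩
  obtain ⟨l, hl⟩ := P.exists_mem hq hroot hK (fun a x hx => P.apply_mem_orthogonal (by simp) hx)
    (fun i x hx => P.swap.apply_mem_orthogonal (by simp) hx)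
    fun i x hx => P.swap.apply_mem_orthogonal (by simp) hx
  exact P.form_self_of_mem (U := ⊤) trivial hl

theorem apply_mem_orbit_of_commute (P : HowePair ρ σ B α β v) (hq : q ≠ 0)
    (hroot : ∀ n : ℕ, 0 < n → q ^ n ≠ 1) {h : Module.End ℂ H} (hh : ∀ b, Commute h (σ b)) {l} {x : H}
    (hx : x ∈ orbit ρ (v l)) : h x ∈ orbit ρ (v l) := by
  rw [P.orbit_eq_hwSpace hq hroot, mem_hwSpace] at hx ⊢
  have hh' (b x) : σ b (h x) = h (σ b x) := LinearMap.congr_fun (hh b).eq.symm x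
  exact ⟨fun i => by rw [hh', hx.1, map_zero], fun i => by rw [hh', hx.2, map_smul]⟩

/-- An operator h commuting with σ preserves the orbit of v l under ρ, since that orbit is a highest
weight space of σ; so h (ρ a (v l)) = ρ a' (v l). Likewise g (σ b (v l)) = σ b' (v l). Both products
send ρ a σ b (v l) to ρ a' σ b' (v l), and these vectors span. -/
theorem commute_of_commute (P : HowePair ρ σ B α β v) (hq : q ≠ 0)
    (hroot : ∀ n : ℕ, 0 < n → q ^ n ≠ 1) {g h : Module.End ℂ H} (hg : ∀ a, Commute g (ρ a))
    (hh : ∀ b, Commute h (σ b)) : Commute h g := by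
  have hg' (a x) : g (ρ a x) = ρ a (g x) := LinearMap.congr_fun (hg a).eq x
  have hh' (b x) : h (σ b x) = σ b (h x) := LinearMap.congr_fun (hh b).eq x
  have := P.eq_top hq hroot (U := LinearMap.eqLocus (h * g) (g * h)) fun a b l => by
    obtain ⟨a', ha⟩ := P.apply_mem_orbit_of_commute hq hroot hh (l := l) ⟨a, rfl⟩
    obtain ⟨b', hb⟩ := P.swap.apply_mem_orbit_of_commute hq hroot hg (l := l) ⟨b, rfl⟩
    change ρ a' (v l) = h (ρ a (v l)) at ha
    change σ b' (v l) = g (σ b (v l)) at hb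
    change h (g (ρ a (σ b (v l)))) = g (h (ρ a (σ b (v l))))
    rw [hg', ← hb, P.comm_apply a b, hh', ← ha, ← P.comm_apply, hg', ← hb, P.comm_apply, hh', ← ha,
      P.comm_apply]
  exact LinearMap.ext fun x => (this ▸ Submodule.mem_top : x ∈ LinearMap.eqLocus (h * g) (g * h))

/-- The commutant of one action is the image of the other. -/
theorem centralizer_eq (P : HowePair ρ σ B α β v) (hq : q ≠ 0) (hroot : ∀ n : ℕ, 0 < n → q ^ n ≠ 1) :
    Subalgebra.centralizer ℂ (σ.range : Set (Module.End ℂ H)) = ρ.range := by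
  refine le_antisymm (fun h hh => ?_) ?_
  · have hh' (b) : Commute h (σ b) :=
      ((Subalgebra.mem_centralizer_iff ℂ).1 hh (σ b) ⟨b, rfl⟩).symm
    refine mem_range_of_commute ρ (fun l => orbit ρ (v l)) (fun l a x hx => apply_mem_orbit ρ hx a)
      (fun l U hU hρ => or_iff_not_imp_left.2 fun h0 => P.orbit_simple hq hroot h0 hρ hU)
      (fun U hU => P.eq_top hq hroot fun a b l => ?_) h fun g hg => P.commute_of_commute hq hroot hg hh'
    -- The spanning vectors become σ b (ρ a (v l)), images of orbit vectors under the commutant of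
    -- ρ.
    rw [P.comm_apply]
    exact hU l (σ b) (fun a => (P.comm a b).symm) _ ⟨a, rfl⟩
  · rintro _ ⟨a, rfl⟩
    refine (Subalgebra.mem_centralizer_iff ℂ).2 ?_
    rintro _ ⟨b, rfl⟩
    exact (P.comm a b).eq.symm

end HowePair

/-! ### Irreducible highest weight modules -/

namespace Uq

variable {n : ℕ} {q : ℂ} {H : Type} [AddCommGroup H] [Module ℂ H]

/-- The polynomial with the roots `q ^ d * z`, `1 ≤ d ≤ D`. -/
def lowerPoly (q z : ℂ) (D : ℕ) : Polynomial ℂ :=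
  ∏ d ∈ Finset.range D, (Polynomial.X - Polynomial.C (q ^ (d + 1) * z))

theorem eval_lowerPoly_eq_zero (q z : ℂ) {D k : ℕ} (hk : k < D) :
    (lowerPoly q z D).eval (q ^ (k + 1) * z) = 0 := by
  rw [lowerPoly, Polynomial.eval_prod]
  exact Finset.prod_eq_zero (Finset.mem_range.2 hk) (by simp)

theorem eval_lowerPoly_ne_zero {q z : ℂ} (hroot : ∀ n : ℕ, 0 < n → q ^ n ≠ 1) (hz : z ≠ 0) (D : ℕ) :
    (lowerPoly q z D).eval z ≠ 0 := by
  rw [lowerPoly, Polynomial.eval_prod]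
  refine Finset.prod_ne_zero_iff.2 fun d _ => ?_
  rw [Polynomial.eval_sub, Polynomial.eval_X, Polynomial.eval_C]
  intro h
  exact hroot (d + 1) (Nat.succ_pos d) (mul_right_cancel₀ hz (by rw [one_mul, ← sub_eq_zero.1 h]))

theorem lowerPoly_apply {ρ : Uq n q →ₐ[ℂ] Module.End ℂ H} {x : H} {z : ℂ}
    (h : ρ (height n q) x = z • x) (p : Polynomial ℂ) :
    ρ (Polynomial.aeval (height n q) p) x = p.eval z • x := by
  rw [← Polynomial.aeval_algHom_apply]
  exact Module.End.aeval_apply_of_mem_apply_eq_smul h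

/-- An invariant subspace with a vector that has a component along the highest weight vector contains
the highest weight vector. -/
theorem mem_of_component (hq : q ≠ 0) (hroot : ∀ n : ℕ, 0 < n → q ^ n ≠ 1)
    {ρ : Uq n q →ₐ[ℂ] Module.End ℂ H} {v : H} {θ : Fin n → ℂ} (hv : ∀ i, ρ (t q i) v = θ i • v)
    (hv0 : v ≠ 0) (ℓ : H →ₗ[ℂ] ℂ) (hℓ : ℓ v = 1) (hf : ∀ i x, ℓ (ρ (f q i) x) = 0) {x : H}
    (hx : x ∈ Submodule.span ℂ (Set.range (word ρ v))) (hx0 : ℓ x ≠ 0) {U : Submodule ℂ H}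
    (hU : ∀ a, ∀ x ∈ U, ρ a x ∈ U) (hxU : x ∈ U) : v ∈ U := by
  obtain ⟨z, hz⟩ := exists_height_apply ρ hv
  have hz0 : z ≠ 0 := by
    rintro rfl
    exact height_ne_zero ρ hv0 (by rw [hz, zero_smul])
  -- On a word of length k ≥ 1 `height` acts by q^k z, which is a root of the polynomial once D' ≥
  -- k; on v the value z is not a root. A large enough D' therefore projects to the v-component, up
  -- to a nonzero scalar.
  have key : ∀ x ∈ Submodule.span ℂ (Set.range (word ρ v)), ∃ D, ∀ D' ≥ D,
      ρ (Polynomial.aeval (height n q) (lowerPoly q z D')) x =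
        (ℓ x * (lowerPoly q z D').eval z) • v := by
    intro x hx
    induction hx using Submodule.span_induction with
    | mem x hx =>
      obtain ⟨w, rfl⟩ := hx
      cases w with
      | nil => exact ⟨0, fun D' _ => by rw [word, hℓ, one_mul, lowerPoly_apply hz]⟩
      | cons i w =>
        refine ⟨w.length + 1, fun D' hD => ?_⟩
        rw [lowerPoly_apply (word_height hq hz (i :: w)), List.length_cons,
          eval_lowerPoly_eq_zero q z (by omega), zero_smul, word, hf, zero_mul, zero_smul]
    | zero => exact ⟨0, fun _ _ => by simp⟩
    | add x y _ _ hx hy =>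
      obtain ⟨D, hD⟩ := hx
      obtain ⟨E, hE⟩ := hy
      exact ⟨max D E, fun D' h => by
        rw [map_add, hD D' (by omega), hE D' (by omega), map_add, add_mul, add_smul]⟩
    | smul c x _ hx =>
      obtain ⟨D, hD⟩ := hx
      exact ⟨D, fun D' h => by rw [map_smul, hD D' h, map_smul, smul_smul, smul_eq_mul, mul_assoc]⟩
  obtain ⟨D, hD⟩ := key x hx
  have := hU (Polynomial.aeval (height n q) (lowerPoly q z D)) x hxU
  rw [hD D le_rfl] at this
  exact (Submodule.smul_mem_iff U (mul_ne_zero hx0 (eval_lowerPoly_ne_zero hroot hz0 D))).1 this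

variable (n q) in
/-- The action on a module. -/
abbrev smulRep (X : Type) [AddCommGroup X] [Module ℂ X] [Module (Uq n q) X]
    [IsScalarTower ℂ (Uq n q) X] : Uq n q →ₐ[ℂ] Module.End ℂ X := Algebra.lsmul ℂ ℂ X

/-- A simple highest weight representation is the irreducible module of that highest weight. -/
theorem exists_irr_map (hq : q ≠ 0) (hroot : ∀ n : ℕ, 0 < n → q ^ n ≠ 1)
    {ρ : Uq n q →ₐ[ℂ] Module.End ℂ H} {v : H} {μ : Fin n → ℤ} (he : ∀ i, ρ (e q i) v = 0)
    (hv : ∀ i, ρ (t q i) v = q ^ μ i • v) (ℓ : H →ₗ[ℂ] ℂ) (hℓ : ℓ v = 1)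
    (hf : ∀ i x, ℓ (ρ (f q i) x) = 0)
    (hs : ∀ U : Submodule ℂ H, U ≠ ⊥ → (∀ a, ∀ x ∈ U, ρ a x ∈ U) → U ≤ orbit ρ v → U = orbit ρ v) :
    ∃ (φ : Irr n q μ →ₗ[ℂ] H) (x₀ : Irr n q μ), Function.Injective φ ∧
      (∀ (a : Uq n q) x, φ (a • x) = ρ a (φ x)) ∧ φ x₀ = v ∧ ∀ x, ∃ a : Uq n q, a • x₀ = x := by
  have hv0 : v ≠ 0 := by rintro rfl; rw [map_zero] at hℓ; exact zero_ne_one hℓ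
  let _ : Module (Uq n q) H := Module.compHom H ρ.toRingHom
  have hsmul (a : Uq n q) (x : H) : a • x = ρ a x := rfl
  have : IsScalarTower ℂ (Uq n q) H := ⟨fun c a x => by rw [hsmul, hsmul, map_smul]; rfl⟩
  let ψ : Verma n q μ →ₗ[Uq n q] H := (vermaIdeal n q μ).liftQ (LinearMap.toSpanSingleton _ H v) <| by
    refine Submodule.span_le.2 ?_
    rintro _ (⟨i, rfl⟩ | ⟨i, rfl⟩)
    · exact he i
    · change ρ (t q i - algebraMap ℂ (Uq n q) (q ^ μ i)) v = 0
      rw [map_sub, AlgHom.commutes, LinearMap.sub_apply, hv, Module.algebraMap_end_apply, sub_self]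
  let v₀ : Verma n q μ := Submodule.Quotient.mk 1
  have hgen (x : Verma n q μ) : ∃ a : Uq n q, a • v₀ = x := by
    obtain ⟨a, rfl⟩ := Submodule.Quotient.mk_surjective _ x
    exact ⟨a, by rw [← Submodule.Quotient.mk_smul, smul_eq_mul, mul_one]⟩
  have hψ : ψ v₀ = v := one_smul (Uq n q) v
  have hmem (x : Uq n q) (hx : x ∈ vermaIdeal n q μ) : x • v₀ = 0 := by
    rw [← Submodule.Quotient.mk_smul, smul_eq_mul, mul_one]
    exact (Submodule.Quotient.mk_eq_zero _).2 hx
  have he₀ (i) : smulRep n q (Verma n q μ) (e q i) v₀ = 0 :=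
    hmem _ (Submodule.subset_span (Or.inl ⟨i, rfl⟩))
  have ht₀ (i) : smulRep n q (Verma n q μ) (t q i) v₀ = q ^ μ i • v₀ := by
    have := hmem _ (Submodule.subset_span (Or.inr ⟨i, rfl⟩))
    rw [sub_smul, sub_eq_zero, algebraMap_smul] at this
    exact this
  -- If a proper submodule P were not inside the kernel of ψ, its image would be all of the orbit,
  -- since the orbit is simple. Some p' in P would then map to v, and `mem_of_component` would put
  -- the generator of the Verma module in P.
  have hker : maxSubmodule n q μ = LinearMap.ker ψ := by
    refine le_antisymm (sSup_le fun P hP => ?_) (le_sSup fun h => hv0 ?_)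
    · intro p hp
      by_contra hp0
      obtain ⟨p', hp', hpv⟩ : v ∈ (P.restrictScalars ℂ).map (ψ.restrictScalars ℂ) := by
        have hmap := hs ((P.restrictScalars ℂ).map (ψ.restrictScalars ℂ))
          (fun h0 => hp0 (by
            have : ψ p ∈ (P.restrictScalars ℂ).map (ψ.restrictScalars ℂ) := ⟨p, hp, rfl⟩
            rwa [h0, Submodule.mem_bot] at this))
          (by rintro a _ ⟨x, hx, rfl⟩; exact ⟨a • x, P.smul_mem a hx, ψ.map_smul a x⟩)
          (by
            rintro _ ⟨x, hx, rfl⟩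
            obtain ⟨a, rfl⟩ := hgen x
            refine ⟨a, ?_⟩
            change ρ a v = ψ (a • v₀)
            rw [map_smul, hψ]; rfl)
        rw [hmap]
        exact ⟨1, LinearMap.congr_fun (map_one ρ) v⟩
      have hpv : ψ p' = v := hpv
      have hw : p' ∈ Submodule.span ℂ (Set.range (word (smulRep n q (Verma n q μ)) v₀)) := by
        obtain ⟨a, rfl⟩ := hgen p'
        exact apply_mem_span_word ht₀ he₀ a
      -- The functional ℓ ∘ ψ is 1 on the generator and zero on the images of the f_i, so it reads
      -- off the component along the generator.
      have hm := mem_of_component hq hroot ht₀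
        (fun h => hv0 (by rw [← hψ, h, map_zero])) (ℓ ∘ₗ ψ.restrictScalars ℂ)
        ((congrArg ℓ hψ).trans hℓ) (fun i x => (congrArg ℓ (ψ.map_smul (f q i) x)).trans (hf i _)) hw
        (by
          have : ℓ (ψ p') ≠ 0 := by rw [hpv, hℓ]; exact one_ne_zero
          exact this) (U := P.restrictScalars ℂ) (fun a x hx => P.smul_mem a hx) hp'
      refine hP (eq_top_iff.2 fun x _ => ?_)
      obtain ⟨a, rfl⟩ := hgen x
      exact P.smul_mem a hm
    · rw [← hψ]
      exact LinearMap.mem_ker.1 (h ▸ Submodule.mem_top)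
  let φ : Irr n q μ →ₗ[Uq n q] H := (maxSubmodule n q μ).liftQ ψ hker.le
  refine ⟨φ.restrictScalars ℂ, Submodule.Quotient.mk v₀, ?_, fun a x => φ.map_smul a x, hψ, fun x => ?_⟩
  · have : LinearMap.ker φ = ⊥ := Submodule.ker_liftQ_eq_bot _ _ _ hker.ge
    exact fun x y h => LinearMap.ker_eq_bot.1 this h
  · obtain ⟨y, rfl⟩ := Submodule.Quotient.mk_surjective _ x
    obtain ⟨a, rfl⟩ := hgen y
    exact ⟨a, Submodule.Quotient.mk_smul _ a v₀ |>.symm⟩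

end Uq

open Uq

/-- The action of a tensor product of two algebras on the tensor product of two irreducible modules. -/
abbrev irrAction {N M : ℕ} (q : ℂ) (μ : Fin N → ℤ) (ν : Fin M → ℤ) :
    Uq N q ⊗[ℂ] Uq M q →ₐ[ℂ] Module.End ℂ (Irr N q μ ⊗[ℂ] Irr M q ν) :=
  (Module.endTensorEndAlgHom (R := ℂ) (S := ℂ) (A := ℂ)).comp
    (Algebra.TensorProduct.map (Algebra.lsmul ℂ ℂ _) (Algebra.lsmul ℂ ℂ _))

theorem irrAction_tmul {N M : ℕ} (q : ℂ) (μ : Fin N → ℤ) (ν : Fin M → ℤ) (a : Uq N q) (b : Uq M q)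
    (x : Irr N q μ) (y : Irr M q ν) : irrAction q μ ν (a ⊗ₜ b) (x ⊗ₜ y) = (a • x) ⊗ₜ (b • y) := rfl

/-! ### Assembling the decomposition -/

namespace HowePair

variable {N M : ℕ} {q : ℂ} {H : Type} [AddCommGroup H] [Module ℂ H]
  {ρ : Uq N q →ₐ[ℂ] Module.End ℂ H} {σ : Uq M q →ₐ[ℂ] Module.End ℂ H} {B : H →ₗ[ℂ] H →ₗ[ℂ] ℂ}
  {Λ : Type} {α : Λ → Fin N → ℤ} {β : Λ → Fin M → ℤ} {v : Λ → H} [FiniteDimensional ℂ H]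

/-- Both simplicity and finite dimension are carried over along the embedding onto the orbit of v l:
the image of a nonzero submodule is the whole orbit, so the submodule contains the generator x₀. -/
theorem exists_irr (P : HowePair ρ σ B α β v) (hq : q ≠ 0) (hroot : ∀ n : ℕ, 0 < n → q ^ n ≠ 1) (l) :
    IsSimpleAction (smulRep N q (Irr N q (α l))) ∧ FiniteDimensional ℂ (Irr N q (α l)) ∧
    ∃ (φ : Irr N q (α l) →ₗ[ℂ] H) (x₀ : Irr N q (α l)),
      (∀ (a : Uq N q) x, φ (a • x) = ρ a (φ x)) ∧ φ x₀ = v l ∧ ∀ x, ∃ a : Uq N q, a • x₀ = x := by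
  obtain ⟨φ, x₀, hinj, hφ, hx₀, hgen⟩ := exists_irr_map hq hroot (P.e_left l) (P.t_left l) (B (v l))
    (P.form_self l) (P.form_f_left l) fun U hU hρ hl => P.orbit_simple hq hroot hU hρ hl
  refine ⟨⟨⟨x₀, 0, fun h => P.ne_zero l (by rw [← hx₀, h, map_zero])⟩, fun U hU =>
    or_iff_not_imp_left.2 fun h0 => ?_⟩, FiniteDimensional.of_injective φ hinj, φ, x₀, hφ, hx₀, hgen⟩
  have hmap := P.orbit_simple hq hroot (U := U.map φ)
    (fun h => h0 (Submodule.map_injective_of_injective hinj (h.trans (Submodule.map_bot φ).symm)))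
    (by rintro a _ ⟨x, hx, rfl⟩; exact ⟨a • x, hU a x hx, hφ a x⟩) (l := l)
    (by
      rintro _ ⟨x, hx, rfl⟩
      obtain ⟨a, rfl⟩ := hgen x
      exact ⟨a, by rw [hφ, hx₀]; rfl⟩)
  obtain ⟨x, hx, hxv⟩ : v l ∈ U.map φ := by
    rw [hmap]; exact ⟨1, LinearMap.congr_fun (map_one ρ) (v l)⟩
  have := hinj (hxv.trans hx₀.symm)
  subst this
  refine eq_top_iff.2 fun y _ => ?_
  obtain ⟨a, rfl⟩ := hgen y
  exact hU a x hx

theorem isSimpleAction (P : HowePair ρ σ B α β v) (hq : q ≠ 0)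
    (hroot : ∀ n : ℕ, 0 < n → q ^ n ≠ 1) (l) : IsSimpleAction (irrAction q (α l) (β l)) := by
  obtain ⟨h1, h2, -⟩ := P.exists_irr hq hroot l
  obtain ⟨h3, h4, -⟩ := P.swap.exists_irr hq hroot l
  exact isSimpleAction_tensor h1 h3

theorem exists_tensor_map (P : HowePair ρ σ B α β v) (hq : q ≠ 0)
    (hroot : ∀ n : ℕ, 0 < n → q ^ n ≠ 1) (l) :
    ∃ θ : Irr N q (α l) ⊗[ℂ] Irr M q (β l) →ₗ[ℂ] H, Function.Injective θ ∧
      (∀ a b z, θ (irrAction q (α l) (β l) (a ⊗ₜ b) z) = ρ a (σ b (θ z))) ∧ ∃ z, θ z = v l := by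
  obtain ⟨-, -, φ, x₀, hφ, hx₀, hgen⟩ := P.exists_irr hq hroot l
  obtain ⟨-, -, φ', y₀, hφ', hy₀, hgen'⟩ := P.swap.exists_irr hq hroot l
  -- The map should send (a x₀) ⊗ (b y₀) to ρ a σ b (v l). A linear section s of a ↦ a x₀ allows it
  -- to be defined without first checking independence of a, which `hθ` then provides.
  obtain ⟨s, hs⟩ := LinearMap.exists_rightInverse_of_surjective
    ((LinearMap.toSpanSingleton (Uq N q) (Irr N q (α l)) x₀).restrictScalars ℂ)
    (LinearMap.range_eq_top.2 hgen)
  have hs' (x) : s x • x₀ = x := LinearMap.congr_fun hs x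
  let θ : Irr N q (α l) ⊗[ℂ] Irr M q (β l) →ₗ[ℂ] H :=
    TensorProduct.lift ((ρ.toLinearMap ∘ₗ s).compl₂ φ')
  have hθ (x b) : θ (x ⊗ₜ (b • y₀)) = σ b (φ x) := by
    change ρ (s x) (φ' (b • y₀)) = _
    rw [hφ', hy₀, P.comm_apply, ← hx₀, ← hφ, hs']
  have h1 (a b z) : θ (irrAction q (α l) (β l) (a ⊗ₜ b) z) = ρ a (σ b (θ z)) := by
    induction z using TensorProduct.induction_on with
    | zero => simp only [map_zero]
    | add x y hx hy => simp only [map_add, hx, hy]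
    | tmul x y =>
      obtain ⟨b', rfl⟩ := hgen' y
      rw [irrAction_tmul, ← mul_smul, hθ, hθ, hφ, map_mul, Module.End.mul_apply, P.comm_apply,
        P.comm_apply]
  have h2 : θ (x₀ ⊗ₜ y₀) = v l := by
    have := hθ x₀ 1
    rwa [one_smul, hx₀, map_one, Module.End.one_apply] at this
  refine ⟨θ, LinearMap.ker_eq_bot.1 ?_, h1, _, h2⟩
  -- The kernel is invariant in a simple module and misses a vector mapping to v l, so it is zero.
  refine ((P.isSimpleAction hq hroot l).2 (LinearMap.ker θ) fun c z hz => ?_).resolve_right fun h => ?_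
  · induction c using TensorProduct.induction_on with
    | zero => rw [map_zero]; exact zero_mem _
    | add x y hx hy => rw [map_add]; exact add_mem hx hy
    | tmul a b => rw [LinearMap.mem_ker, h1, LinearMap.mem_ker.1 hz, map_zero, map_zero]
  · exact P.ne_zero l (h2.symm.trans (LinearMap.mem_ker.1 (h ▸ Submodule.mem_top)))

/-- The maps θ l are added up. Images for different l are orthogonal and the pairings with all ρ a σ
b (v l) detect every vector, which gives injectivity; surjectivity holds because these vectors span.
-/
theorem exists_equiv (P : HowePair ρ σ B α β v) (hq : q ≠ 0) (hroot : ∀ n : ℕ, 0 < n → q ^ n ≠ 1) :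
    ∃ T : H ≃ₗ[ℂ] ⨁ l, Irr N q (α l) ⊗[ℂ] Irr M q (β l), ∀ a b x l,
      T (ρ a (σ b x)) l = irrAction q (α l) (β l) (a ⊗ₜ b) (T x l) := by
  classical
  choose θ hinj hθ z hz using P.exists_tensor_map hq hroot
  -- By simplicity the vectors (a ⊗ b) (z l) span the l-th summand, so orthogonality reduces to that
  -- of the vectors generated by v l and v m.
  have orth (l m) (h : l ≠ m) (x a b) : B (θ l x) (ρ a (σ b (v m))) = 0 := by
    suffices LinearMap.ker ((B.flip (ρ a (σ b (v m)))) ∘ₗ θ l) = ⊤ from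
      LinearMap.congr_fun (LinearMap.ker_eq_top.1 this) x
    have hW : ∀ c, ∀ y ∈ Submodule.span ℂ {y | ∃ a b, y = irrAction q (α l) (β l) (a ⊗ₜ b) (z l)},
        irrAction q (α l) (β l) c y ∈
          Submodule.span ℂ {y | ∃ a b, y = irrAction q (α l) (β l) (a ⊗ₜ b) (z l)} := by
      intro c y hy
      induction c using TensorProduct.induction_on with
      | zero => rw [map_zero]; exact zero_mem _
      | add c d hc hd => rw [map_add]; exact add_mem hc hd
      | tmul a b =>
        induction hy using Submodule.span_induction with
        | zero => rw [map_zero]; exact zero_mem _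
        | add x y _ _ hx hy => rw [map_add]; exact add_mem hx hy
        | smul c x _ hx => rw [map_smul]; exact Submodule.smul_mem _ c hx
        | mem y hy =>
          obtain ⟨a', b', rfl⟩ := hy
          refine Submodule.subset_span ⟨a * a', b * b', ?_⟩
          rw [← Module.End.mul_apply, ← map_mul, Algebra.TensorProduct.tmul_mul_tmul]
    have htop := ((P.isSimpleAction hq hroot l).2 _ hW).resolve_left fun h => P.ne_zero l (by
      have : z l ∈ Submodule.span ℂ {y | ∃ a b, y = irrAction q (α l) (β l) (a ⊗ₜ b) (z l)} :=
        Submodule.subset_span ⟨1, 1, by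
          rw [← Algebra.TensorProduct.one_def, map_one]; rfl⟩
      rw [h, Submodule.mem_bot] at this
      rw [← hz, this, map_zero])
    rw [eq_top_iff, ← htop, Submodule.span_le]
    rintro _ ⟨a', b', rfl⟩
    change B (θ l _) _ = 0
    rw [hθ, hz, P.orthogonal h]
  let Ψ : (⨁ l, Irr N q (α l) ⊗[ℂ] Irr M q (β l)) →ₗ[ℂ] H := DirectSum.toModule ℂ Λ H θ
  have hΨ (l y) : Ψ (DirectSum.lof ℂ Λ _ l y) = θ l y := DirectSum.toModule_lof (φ := θ) ℂ l y
  -- Pairing with the vectors generated by v l sees only the l-th component.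
  have comp (y l a b) : B (Ψ y) (ρ a (σ b (v l))) = B (θ l (y l)) (ρ a (σ b (v l))) := by
    suffices (B.flip (ρ a (σ b (v l)))) ∘ₗ Ψ =
        (B.flip (ρ a (σ b (v l)))) ∘ₗ θ l ∘ₗ DirectSum.component ℂ Λ _ l from LinearMap.congr_fun this y
    refine DirectSum.linearMap_ext ℂ fun m => LinearMap.ext fun x => ?_
    change B (Ψ (DirectSum.lof ℂ Λ (fun l => Irr N q (α l) ⊗[ℂ] Irr M q (β l)) m x)) _ =
      B (θ l (DirectSum.lof ℂ Λ (fun l => Irr N q (α l) ⊗[ℂ] Irr M q (β l)) m x l)) _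
    rw [hΨ]
    by_cases h : m = l
    · subst h; rw [DirectSum.lof_apply]
    · rw [orth m l h, DirectSum.lof_eq_of, DirectSum.of_eq_of_ne _ _ _ (Ne.symm h), map_zero, map_zero,
        LinearMap.zero_apply]
  have inj : Function.Injective Ψ := by
    refine fun y y' hy => DFinsupp.ext fun l => hinj l (sub_eq_zero.1 ?_)
    refine P.eq_zero_of_form hq hroot fun a b m => ?_
    rw [map_sub, LinearMap.sub_apply, sub_eq_zero]
    by_cases h : l = m
    · subst h
      rw [← comp, ← comp, hy]
    · rw [orth l m h, orth l m h]
  have surj : Function.Surjective Ψ := by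
    refine LinearMap.range_eq_top.1 (P.eq_top hq hroot fun a b l => ?_)
    exact ⟨DirectSum.lof ℂ Λ _ l (irrAction q (α l) (β l) (a ⊗ₜ b) (z l)), by rw [hΨ, hθ, hz]⟩
  let T := LinearEquiv.ofBijective Ψ ⟨inj, surj⟩
  refine ⟨T.symm, fun a b x l => ?_⟩
  obtain ⟨y, rfl⟩ := T.surjective x
  have : ρ a (σ b (T y)) =
      T (DFinsupp.mapRange.linearMap (fun l => irrAction q (α l) (β l) (a ⊗ₜ b)) y) := by
    suffices (ρ a ∘ₗ σ b) ∘ₗ Ψ =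
        Ψ ∘ₗ DFinsupp.mapRange.linearMap (fun l => irrAction q (α l) (β l) (a ⊗ₜ b)) from
      LinearMap.congr_fun this y
    refine DirectSum.linearMap_ext ℂ fun m => LinearMap.ext fun x => ?_
    change ρ a (σ b (Ψ (DirectSum.lof ℂ Λ _ m x))) =
      Ψ (DFinsupp.mapRange.linearMap (fun l => irrAction q (α l) (β l) (a ⊗ₜ b)) (DFinsupp.single m x))
    rw [hΨ, DFinsupp.mapRange.linearMap_apply, DFinsupp.mapRange_single, ← hθ]
    exact (hΨ m _).symm
  rw [this, LinearEquiv.symm_apply_apply, LinearEquiv.symm_apply_apply]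
  rfl

end HowePair

theorem finiteDimensional_ext (N M : ℕ) : FiniteDimensional ℂ (Ext N M) := by
  let _ : LinearOrder (Fin N × Fin M) :=
    LinearOrder.lift' (Fintype.equivFin (Fin N × Fin M)) (Fintype.equivFin _).injective
  exact Module.Finite.of_basis
    ((Pi.basisFun ℂ (Fin N)).tensorProduct (Pi.basisFun ℂ (Fin M))).ExteriorAlgebra

end SkewHowe

end

theorem proposition5 (N M : ℕ) (q : ℂ) (hq : q ≠ 0) (hq2 : q ^ 2 ≠ 1) :
    (∀ (a : Uq N q) (b : Uq M q), Commute (actN N M hq hq2 a) (actM N M hq hq2 b)) ∧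
    ((∀ n : ℕ, 0 < n → q ^ n ≠ 1) →
      Subalgebra.centralizer ℂ ((actM N M hq hq2).range : Set (Module.End ℂ (Ext N M))) =
        (actN N M hq hq2).range ∧
      Subalgebra.centralizer ℂ ((actN N M hq hq2).range : Set (Module.End ℂ (Ext N M))) =
        (actM N M hq hq2).range ∧
      (∀ lam : BoxDiagram N M, IsSimpleAction (irrTensorAction N M q lam.1)) ∧
      ∃ T : Ext N M ≃ₗ[ℂ] ⨁ lam : BoxDiagram N M,
          Irr N q (rowWeight N lam.1) ⊗[ℂ] Irr M q (rowWeight M lam.1.transpose),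
        ∀ (a : Uq N q) (b : Uq M q) (x : Ext N M) (lam : BoxDiagram N M),
          T (actN N M hq hq2 a (actM N M hq hq2 b x)) lam =
            irrTensorAction N M q lam.1 (a ⊗ₜ[ℂ] b) (T x lam)) := by
  have F := fermiForm gridBasis hq
  have G := gridPair (N := N) (M := M) hq hq2
  refine ⟨G.commute F, fun hroot => ?_⟩
  have := finiteDimensional_ext N M
  obtain ⟨v, P⟩ := G.exists_howePair F hroot
  exact ⟨P.centralizer_eq hq hroot, P.swap.centralizer_eq hq hroot,
    P.isSimpleAction hq hroot, P.exists_equiv hq hroot⟩
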